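/- **Theorem.** Let $c,\Omega,g,R>0$, let $N\ge 0$ be an integer, and let $\boldsymbol{x}_1,\dots,\boldsymbol{x}_N\in\mathbb{R}^3$ be distinct points. Put $r_{j\ell}=|\boldsymbol{x}_j-\boldsymbol{x}_\ell|$, $f(k,r)=4\pi\frac{\sin(kr)}{kr}$ (with $f=4\pi$ when $kr=0$) and $\gamma=\frac{g^2}{(2\pi)^3}$. Define the $N\times N$ matrix functions $$\Gamma_{j\ell}(s)=\frac1{ic}\int_0^\infty\frac{k^2e^{-k^2R^2}f(k,r_{j\ell})}{\frac{s}{ic}+k}\,dk\quad(s\in\mathbb{C}\setminus(-i)[0,\infty)),\qquad E_{j\ell}(y)=\gamma\int_0^\infty\frac{k^2e^{-k^2R^2}f(k,r_{j\ell})}{y+ck}\,dk\quad(y\in\mathbb{C}\setminus(-\infty,0)).$$ 1. The matrix function $y\mapsto(y+\Omega-E(y))^{-1}$ is meromorphic on $\mathbb{C}\setminus(-\infty,0]$. Its poles there are positive real numbers, and there are finitely many of them, $p_1,\dots,p_{n_p}$ (distinct), with $n_p\le N$. Let $R_j$ be the residue at $p_j$. 2. For every $y>0$ the limits $$A^{\mp}(y)=\lim_{\varepsilon\to0^+}ic\,\Gamma(-iy\pm\varepsilon)$$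 exist, and the matrices $y-\Omega+\frac{\gamma}{c}A^{\pm}(y)$ are invertible. Let $H^\pm(y)=\left(y-\Omega+\frac{\gamma}{c}A^\pm(y)\right)^{-1}$. 3. Suppose that $\Omega I-E(0)$ is invertible. Let $\vec\beta:[0,\infty)\to\mathbb{C}^N$ be a solution of $$\beta_j'(t)=-\gamma\sum_{\ell=1}^N\int_0^t\beta_\ell(\tau)e^{i\Omega(t-\tau)}\int_0^\infty k^2e^{-ick(t-\tau)-k^2R^2}f(k,r_{j\ell})\,dk\,d\tau ,\qquad j=1,\dots,N,$$ that is, $\vec\beta$ is continuous on $[0,\infty)$ and differentiable on $(0,\infty)$, and the equation holds for all $t>0$. Then for every $t\ge0$ the integral below converges absolutely and $$\vec\beta(t)=\frac{e^{i\Omega t}}{2\pi i}\int_0^\infty e^{-iyt}\left(H^+(y)-H^-(y)\right)\vec\beta(0)\,dy+\sum_{j=1}^{n_p}R_j\vec\beta(0)\,e^{i(p_j+\Omega)t}.$$ -/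

import Mathlib

open Filter Topology MeasureTheory Set

noncomputable section

namespace AtomPhoton

/-- `f(k, r) = 4π sin(kr) / (kr)`, with its continuous value `4π` at `kr = 0`. -/
def sphKernel (k r : ℝ) : ℝ := 4 * Real.pi * Real.sinc (k * r)

/-- The constant `g² / (2π)³`. -/
def coupling (g : ℝ) : ℝ := g ^ 2 / (2 * Real.pi) ^ 3

/-- `β` is a solution, for `t ≥ 0`, of the integro-differential system
`β_j'(t) = -g²/(2π)³ ∑_ℓ ∫₀ᵗ β_ℓ(τ) e^{iΩ(t-τ)} ∫₀^∞ k² e^{-ick(t-τ) - k²R²} f(k, r_{jℓ}) dk dτ`,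
where `r_{jℓ} = |x_j - x_ℓ|`. -/
structure IsSolution (c Ω g R : ℝ) {N : ℕ} (x : Fin N → EuclideanSpace ℝ (Fin 3))
    (β : ℝ → Fin N → ℂ) : Prop where
  continuousOn : ContinuousOn β (Ici 0)
  hasDerivAt : ∀ t : ℝ, 0 < t → ∀ j : Fin N,
    HasDerivAt (fun s => β s j)
      (-(coupling g : ℂ) * ∑ l : Fin N, ∫ τ in (0 : ℝ)..t,
        β τ l * Complex.exp (Complex.I * Ω * (t - τ)) *
          ∫ k in Ioi (0 : ℝ),
            (k : ℂ) ^ 2 * Complex.exp (-Complex.I * c * k * (t - τ) - (k : ℂ) ^ 2 * (R : ℂ) ^ 2) *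
              (sphKernel k (dist (x j) (x l)) : ℂ)) t

/-- `Γ_{jℓ}(s) = (ic)⁻¹ ∫₀^∞ e^{-k²R²} k² f(k, r_{jℓ}) / (s/(ic) + k) dk`, for complex `s` off
the negative imaginary axis. -/
def Gam (c R : ℝ) {N : ℕ} (x : Fin N → EuclideanSpace ℝ (Fin 3)) (s : ℂ) :
    Matrix (Fin N) (Fin N) ℂ :=
  Matrix.of fun j l =>
    (1 / (Complex.I * c)) * ∫ k in Ioi (0 : ℝ),
      (Real.exp (-(k ^ 2 * R ^ 2)) : ℂ) / (s / (Complex.I * c) + k) * (k : ℂ) ^ 2 *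
        (sphKernel k (dist (x j) (x l)) : ℂ)

/-- `A⁺(y) = lim_{ε → 0⁺} i c Γ(-iy - ε)`, entrywise, for `y > 0`. -/
def APlus (c R : ℝ) {N : ℕ} (x : Fin N → EuclideanSpace ℝ (Fin 3)) (y : ℝ) :
    Matrix (Fin N) (Fin N) ℂ :=
  Matrix.of fun j l =>
    limUnder (𝓝[>] (0 : ℝ)) fun ε : ℝ => Complex.I * c * Gam c R x (-Complex.I * y - ε) j l

/-- `A⁻(y) = lim_{ε → 0⁺} i c Γ(-iy + ε)`, entrywise, for `y > 0`. -/
def AMinus (c R : ℝ) {N : ℕ} (x : Fin N → EuclideanSpace ℝ (Fin 3)) (y : ℝ) :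
    Matrix (Fin N) (Fin N) ℂ :=
  Matrix.of fun j l =>
    limUnder (𝓝[>] (0 : ℝ)) fun ε : ℝ => Complex.I * c * Gam c R x (-Complex.I * y + ε) j l

/-- `y - Ω + g²/((2π)³c) A⁺(y)`. -/
def DPlus (c Ω g R : ℝ) {N : ℕ} (x : Fin N → EuclideanSpace ℝ (Fin 3)) (y : ℝ) :
    Matrix (Fin N) (Fin N) ℂ :=
  ((y : ℂ) - Ω) • (1 : Matrix (Fin N) (Fin N) ℂ) + ((coupling g : ℂ) / c) • APlus c R x y

/-- `y - Ω + g²/((2π)³c) A⁻(y)`. -/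
def DMinus (c Ω g R : ℝ) {N : ℕ} (x : Fin N → EuclideanSpace ℝ (Fin 3)) (y : ℝ) :
    Matrix (Fin N) (Fin N) ℂ :=
  ((y : ℂ) - Ω) • (1 : Matrix (Fin N) (Fin N) ℂ) + ((coupling g : ℂ) / c) • AMinus c R x y

/-- `H⁺(y) = (y - Ω + g²/((2π)³c) A⁺(y))⁻¹`. -/
def HPlus (c Ω g R : ℝ) {N : ℕ} (x : Fin N → EuclideanSpace ℝ (Fin 3)) (y : ℝ) :
    Matrix (Fin N) (Fin N) ℂ := (DPlus c Ω g R x y)⁻¹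

/-- `H⁻(y) = (y - Ω + g²/((2π)³c) A⁻(y))⁻¹`. -/
def HMinus (c Ω g R : ℝ) {N : ℕ} (x : Fin N → EuclideanSpace ℝ (Fin 3)) (y : ℝ) :
    Matrix (Fin N) (Fin N) ℂ := (DMinus c Ω g R x y)⁻¹

/-- `E_{jℓ}(y) = g²/(2π)³ ∫₀^∞ k² f(k, r_{jℓ}) e^{-k²R²} / (y + ck) dk`, for complex `y` outside
the half-line `(-∞, 0)`. -/
def EMat (c g R : ℝ) {N : ℕ} (x : Fin N → EuclideanSpace ℝ (Fin 3)) (y : ℂ) :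
    Matrix (Fin N) (Fin N) ℂ :=
  Matrix.of fun j l =>
    (coupling g : ℂ) * ∫ k in Ioi (0 : ℝ),
      (k : ℂ) ^ 2 * (sphKernel k (dist (x j) (x l)) : ℂ) * (Real.exp (-(k ^ 2 * R ^ 2)) : ℂ) /
        (y + c * k)

/-- The matrix function `(y + Ω - E(y))⁻¹`. -/
def resolv (c Ω g R : ℝ) {N : ℕ} (x : Fin N → EuclideanSpace ℝ (Fin 3)) (y : ℂ) :
    Matrix (Fin N) (Fin N) ℂ :=
  ((y + Ω) • (1 : Matrix (Fin N) (Fin N) ℂ) - EMat c g R x y)⁻¹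

/-- A pole of a matrix-valued function at `p`: some entry has a pole at `p`. -/
def IsMatrixPole {N : ℕ} (F : ℂ → Matrix (Fin N) (Fin N) ℂ) (p : ℂ) : Prop :=
  ∃ j l : Fin N, meromorphicOrderAt (fun y => F y j l) p < 0

/-- The residue of a matrix-valued function at `p`, entrywise
`lim_{ε → 0⁺} (2πi)⁻¹ ∮_{|y - p| = ε} F(y) dy`. -/
def matrixResidue {N : ℕ} (F : ℂ → Matrix (Fin N) (Fin N) ℂ) (p : ℂ) :
    Matrix (Fin N) (Fin N) ℂ :=
  Matrix.of fun j l =>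
    limUnder (𝓝[>] (0 : ℝ)) fun ε : ℝ =>
      (2 * Real.pi * Complex.I)⁻¹ * ∮ y in C(p, ε), F y j l

end AtomPhoton

end

/-! Let W(k) be the matrix γ k² e^{-k²R²} f(k, r_{jℓ}), S(z) = ∫₀^∞ W(k)/(ck - z) dk and F(z) = Ω -
z - S(z). Then E(y) = S(-y), the resolvent of the theorem is F(-y)⁻¹, and the matrices inverted in
H⁻(y) and H⁺(y) are -F(y + i0) and -F(y + i0)*. A Laplace transform turns the Volterra system into
F(is + Ω) β̂(s) = -i β(0). Hence everything rests on a partial fraction formula for G = F⁻¹ in the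
upper half-plane: a Cauchy integral of the jump of G over (0, ∞), minus ∑ R_p / (z + p)
(`inv_herglotz_eq`).

Two properties of W are used. It is positive definite for k > 0, because the sinc kernel is a
spherical average of plane waves and plane waves with distinct centres are independent on the sphere
(`sinc_form_pos`). So Im⟨v, F(z)v⟩ ≤ -Im z ‖v‖² in the upper half-plane; this makes G holomorphic
off ℝ with entries at most 1/|Im z|, makes all its poles on the negative axis simple, and keeps F(x
+ i0) invertible for x > 0. Moreover W is entire with fast decay in a sector, so the path of
integration can be turned to arg k = -π/6. Therefore S is bounded in the upper half-plane and
extends continuously to the real line.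

The bound on the number of poles comes from `eq_zero_of_sum_kernel`: null vectors of F at different
points -p < 0 are linearly independent in ℂ^N.

Once its principal parts are removed, G is continuous on the closed half-plane, the threshold 0
being covered by the invertibility of Ω - E(0), and it is O(1/|z|). Cauchy's formula then gives the
representation (`cauchy_jump`). The jump equals G(F* - F)G*, hence is O(1/x²) and integrable.
Inverting the Laplace transform needs only injectivity: the claimed right-hand side and the solution
have the same transform far to the right (`eq_propagator_mulVec`), where that of the solution
converges by an exponential a priori bound (`exists_exp_bound`). -/

namespace AtomPhoton

/-! ### Stieltjes transforms of weights analytic in a sector -/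

section Stieltjes

/-- An entire function with exponential decay in a sector around the positive half-line. -/
structure SectorDecay (φ : ℂ → ℂ) (K : ℝ) : Prop where
  nonneg : 0 ≤ K
  diff : Differentiable ℂ φ
  bound : ∀ k : ℂ, 0 ≤ k.re → ‖k‖ ^ 2 / 2 ≤ (k ^ 2).re → ‖φ k‖ ≤ K * (‖k‖ * Real.exp (-‖k‖))

/-- The Stieltjes transform `∫₀^∞ φ(k) / (ck - z) dk`. -/
noncomputable def stieltjes (c : ℝ) (φ : ℂ → ℂ) (z : ℂ) : ℂ :=
  ∫ k in Ioi (0 : ℝ), φ k / (c * k - z)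

variable {φ : ℂ → ℂ} {K c : ℝ}

theorem SectorDecay.bound_real (h : SectorDecay φ K) {k : ℝ} (hk : 0 < k) :
    ‖φ k‖ ≤ K * (k * Real.exp (-k)) := by
  have := h.bound k (by simpa using hk.le) (by
    rw [← Complex.ofReal_pow, Complex.ofReal_re, Complex.norm_real, Real.norm_eq_abs, sq_abs]
    nlinarith [sq_nonneg k])
  simpa [abs_of_pos hk] using this

theorem SectorDecay.continuous_real (h : SectorDecay φ K) : Continuous fun k : ℝ => φ k :=
  h.diff.continuous.comp Complex.continuous_ofReal

theorem mul_exp_neg_le (k : ℝ) : (1 + k) * Real.exp (-k) ≤ 2 * Real.exp (-(k / 2)) := by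
  have h1 : Real.exp (-(k / 2)) * Real.exp (k / 2) = 1 := by
    rw [← Real.exp_add]; simp
  have h2 : Real.exp (-k) = Real.exp (-(k / 2)) * Real.exp (-(k / 2)) := by
    rw [← Real.exp_add]; ring_nf
  have h3 := Real.add_one_le_exp (k / 2)
  have h4 := Real.exp_pos (-(k / 2))
  rw [h2, ← mul_assoc]
  refine mul_le_mul_of_nonneg_right ?_ h4.le
  nlinarith

theorem integrableOn_exp_neg_half : IntegrableOn (fun k : ℝ => Real.exp (-(k / 2))) (Ioi 0) := by
  have := exp_neg_integrableOn_Ioi 0 (show (0 : ℝ) < 1 / 2 by norm_num)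
  refine this.congr_fun (fun k _ => ?_) measurableSet_Ioi
  ring_nf

theorem SectorDecay.integrableOn (h : SectorDecay φ K) :
    IntegrableOn (fun k : ℝ => φ k) (Ioi 0) := by
  refine Integrable.mono' (integrableOn_exp_neg_half.const_mul (2 * K))
    h.continuous_real.aestronglyMeasurable ?_
  refine (ae_restrict_mem measurableSet_Ioi).mono fun k hk => (h.bound_real hk).trans ?_
  have hk : 0 < k := hk
  have := mul_exp_neg_le k
  have h5 := Real.exp_pos (-k)
  rw [mul_comm 2, mul_assoc]
  exact mul_le_mul_of_nonneg_left (by nlinarith) h.nonneg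

/-- The bound δ min(1, k) serves two cases at once: z at positive distance from the half-line, and z
= 0, where only |ck| is available and the factor k in the decay of φ pays for it. -/
theorem SectorDecay.norm_div_le (h : SectorDecay φ K) {δ k : ℝ} {w : ℂ} (hδ : 0 < δ) (hk : 0 < k)
    (hw : δ * min 1 k ≤ ‖w‖) : ‖φ k / w‖ ≤ 2 * K / δ * Real.exp (-(k / 2)) := by
  have hm : 0 < min 1 k := lt_min one_pos hk
  have hw0 : 0 < ‖w‖ := lt_of_lt_of_le (by positivity) hw
  rw [norm_div, div_le_iff₀ hw0]
  refine (h.bound_real hk).trans ?_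
  have h1 : k ≤ (1 + k) * min 1 k := by
    rcases le_total 1 k with h' | h'
    · rw [min_eq_left h']; linarith
    · rw [min_eq_right h']; nlinarith
  have h2 := mul_exp_neg_le k
  have hK := h.nonneg
  calc K * (k * Real.exp (-k)) ≤ K * (((1 + k) * min 1 k) * Real.exp (-k)) := by gcongr
    _ = K * (((1 + k) * Real.exp (-k)) * min 1 k) := by ring
    _ ≤ K * ((2 * Real.exp (-(k / 2))) * min 1 k) := by gcongr
    _ = 2 * K / δ * Real.exp (-(k / 2)) * (δ * min 1 k) := by field_simp
    _ ≤ _ := by gcongr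

theorem SectorDecay.integrableOn_div (h : SectorDecay φ K) {δ : ℝ} {z : ℂ} (hδ : 0 < δ)
    (hz : ∀ k : ℝ, 0 < k → δ * min 1 k ≤ ‖c * k - z‖) :
    IntegrableOn (fun k : ℝ => φ k / (c * k - z)) (Ioi 0) := by
  refine Integrable.mono' (integrableOn_exp_neg_half.const_mul (2 * K / δ)) ?_ ?_
  · have hm : Measurable fun k : ℝ => φ k / (c * k - z) :=
      h.continuous_real.measurable.div (by fun_prop)
    exact hm.aestronglyMeasurable
  · exact (ae_restrict_mem measurableSet_Ioi).mono fun k hk => h.norm_div_le hδ hk (hz k hk)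

theorem exists_ball_dist_le {z : ℂ} (hc : 0 < c) (hz : -z ∈ Complex.slitPlane) :
    ∃ δ > 0, ∀ w ∈ Metric.ball z δ, ∀ k : ℝ, 0 < k → δ ≤ ‖(c * k - w : ℂ)‖ := by
  have hop : IsOpen {w : ℂ | -w ∈ Complex.slitPlane} :=
    Complex.isOpen_slitPlane.preimage continuous_neg
  obtain ⟨ε, hε, hb⟩ := Metric.isOpen_iff.1 hop z hz
  refine ⟨ε / 2, by positivity, fun w hw k hk => ?_⟩
  by_contra hlt
  push Not at hlt
  have hmem : (c * k : ℂ) ∈ Metric.ball z ε := by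
    rw [Metric.mem_ball]
    calc dist (c * k : ℂ) z ≤ dist (c * k : ℂ) w + dist w z := dist_triangle _ _ _
      _ < ε / 2 + ε / 2 := by
        rw [dist_eq_norm]; exact add_lt_add hlt hw
      _ = ε := by ring
  have := hb hmem
  simp only [mem_ofPred_eq, Complex.mem_slitPlane_iff] at this
  rcases this with h | h
  · simp at h; nlinarith [mul_pos hc hk]
  · simp at h

theorem mul_min_le {δ k a : ℝ} (hδ : 0 < δ) (h : δ ≤ a) : δ * min 1 k ≤ a :=
  (mul_le_of_le_one_right hδ.le (min_le_left _ _)).trans h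

theorem SectorDecay.differentiableAt_stieltjes (h : SectorDecay φ K) (hc : 0 < c) {z : ℂ}
    (hz : -z ∈ Complex.slitPlane) : DifferentiableAt ℂ (stieltjes c φ) z := by
  obtain ⟨δ, hδ, hb⟩ := exists_ball_dist_le hc hz
  have hmeas : ∀ w : ℂ, Measurable fun k : ℝ => φ k / (c * k - w) := fun w =>
    h.continuous_real.measurable.div (by fun_prop)
  have hmeas2 : Measurable fun k : ℝ => φ k / (c * k - z) ^ 2 :=
    h.continuous_real.measurable.div (by fun_prop)
  refine (hasDerivAt_integral_of_dominated_loc_of_deriv_le (𝕜 := ℂ) (s := Metric.ball z δ)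
    (F := fun w (k : ℝ) => φ k / (c * k - w))
    (F' := fun w (k : ℝ) => φ k / (c * k - w) ^ 2)
    (bound := fun k => 2 * K / δ ^ 2 * Real.exp (-(k / 2)))
    (Metric.ball_mem_nhds z hδ) (Eventually.of_forall fun w => (hmeas w).aestronglyMeasurable)
    ?_ hmeas2.aestronglyMeasurable ?_ (integrableOn_exp_neg_half.const_mul _) ?_).2.differentiableAt
  · exact h.integrableOn_div hδ fun k hk => mul_min_le hδ (hb z (Metric.mem_ball_self hδ) k hk)
  · refine (ae_restrict_mem measurableSet_Ioi).mono fun k hk w hw => ?_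
    refine h.norm_div_le (by positivity) hk (mul_min_le (by positivity) ?_)
    rw [norm_pow]
    have := hb w hw k hk
    gcongr
  · refine (ae_restrict_mem measurableSet_Ioi).mono fun k hk w hw => ?_
    have hne : (c * k - w : ℂ) ≠ 0 := norm_pos_iff.1 (hδ.trans_le (hb w hw k hk))
    have := ((hasDerivAt_const w (φ k)).div ((hasDerivAt_const w (c * k : ℂ)).sub (hasDerivAt_id w))
      hne)
    convert! this using 1
    simp

theorem neg_mem_slitPlane_of_im_pos {z : ℂ} (hz : 0 < z.im) : -z ∈ Complex.slitPlane := by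
  rw [Complex.mem_slitPlane_iff]; right; simp [hz.ne']

theorem SectorDecay.integrableOn_div_of_slit (h : SectorDecay φ K) (hc : 0 < c) {z : ℂ}
    (hz : -z ∈ Complex.slitPlane) : IntegrableOn (fun k : ℝ => φ k / (c * k - z)) (Ioi 0) := by
  obtain ⟨δ, hδ, hb⟩ := exists_ball_dist_le hc hz
  exact h.integrableOn_div hδ fun k hk => mul_min_le hδ (hb z (Metric.mem_ball_self hδ) k hk)

/-- On the imaginary axis |ck - iε| ≥ ck, so φ(k)/k dominates up to a constant. -/
theorem SectorDecay.tendsto_stieltjes_zero (h : SectorDecay φ K) (hc : 0 < c) :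
    Tendsto (fun ε : ℝ => stieltjes c φ (ε * Complex.I)) (𝓝[>] 0) (𝓝 (stieltjes c φ 0)) := by
  refine tendsto_integral_filter_of_dominated_convergence
    (fun k => 2 * K / c * Real.exp (-(k / 2))) ?_ ?_ (integrableOn_exp_neg_half.const_mul _) ?_
  · refine Eventually.of_forall fun ε => ?_
    have hm : Measurable fun k : ℝ => φ k / (c * k - ε * Complex.I) :=
      h.continuous_real.measurable.div (by fun_prop)
    exact hm.aestronglyMeasurable
  · refine Eventually.of_forall fun ε => (ae_restrict_mem measurableSet_Ioi).mono fun k hk => ?_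
    have hk : 0 < k := hk
    refine h.norm_div_le hc hk ?_
    have : c * k ≤ ‖(c * k - ε * Complex.I : ℂ)‖ := by
      refine le_trans (le_of_eq ?_) ((le_abs_self _).trans (Complex.abs_re_le_norm _))
      simp
    refine le_trans ?_ this
    gcongr; exact min_le_right _ _
  · refine (ae_restrict_mem measurableSet_Ioi).mono fun k hk => ?_
    have hk : 0 < k := hk
    have hne : (c * k - 0 : ℂ) ≠ 0 := by simp [hc.ne', hk.ne']
    have h0 : Tendsto (fun ε : ℝ => (c * k - ε * Complex.I : ℂ)) (𝓝[>] 0) (𝓝 (c * k - 0)) := by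
      have : Continuous fun ε : ℝ => (c * k - ε * Complex.I : ℂ) := by fun_prop
      have := (this.tendsto 0).mono_left (nhdsWithin_le_nhds (s := Ioi 0))
      simpa using this
    exact tendsto_const_nhds.div h0 hne

/-! ### Rotation of the path of integration -/

theorem integrable_exp_neg_abs : Integrable fun x : ℝ => Real.exp (-|x|) := by
  rw [← integrableOn_univ, ← Iic_union_Ioi (a := (0 : ℝ))]
  refine IntegrableOn.union ?_ ?_
  · refine (integrableOn_exp_Iic 0).congr_fun (fun x hx => ?_) measurableSet_Iic
    simp only [abs_of_nonpos (show x ≤ 0 from hx), neg_neg]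
  · refine (exp_neg_integrableOn_Ioi 0 one_pos).congr_fun (fun x hx => ?_) measurableSet_Ioi
    simp only [abs_of_pos (show 0 < x from hx), neg_mul, one_mul]

/-- Shifting the line of integration inside a strip. -/
theorem integral_eq_integral_sub_of_strip {f : ℂ → ℂ} {θ C : ℝ} (hθ : 0 ≤ θ)
    (hd : ∀ u : ℂ, -θ ≤ u.im → u.im ≤ 0 → DifferentiableAt ℂ f u)
    (hb : ∀ u : ℂ, -θ ≤ u.im → u.im ≤ 0 → ‖f u‖ ≤ C * Real.exp (-|u.re|)) :
    ∫ x : ℝ, f x = ∫ x : ℝ, f (x - θ * Complex.I) := by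
  have hint : ∀ a : ℝ, -θ ≤ a → a ≤ 0 → Integrable fun x : ℝ => f (x + a * Complex.I) := by
    intro a h1 h2
    refine Integrable.mono' (integrable_exp_neg_abs.const_mul C) ?_ ?_
    · refine Continuous.aestronglyMeasurable (continuous_iff_continuousAt.2 fun x => ?_)
      have := (hd (x + a * Complex.I) (by simpa using h1) (by simpa using h2)).continuousAt
      exact ContinuousAt.comp (f := fun x : ℝ => (x + a * Complex.I : ℂ)) this (by fun_prop)
    · refine Eventually.of_forall fun x => ?_
      simpa using hb (x + a * Complex.I) (by simpa using h1) (by simpa using h2)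
  have hrect : ∀ T : ℝ, (∫ x in (-T)..T, f (x + ((-θ : ℝ) : ℂ) * Complex.I))
      - (∫ x in (-T)..T, f (x + ((0 : ℝ) : ℂ) * Complex.I))
      + Complex.I • (∫ y in (-θ)..0, f (T + y * Complex.I))
      - Complex.I • (∫ y in (-θ)..0, f ((-T : ℝ) + y * Complex.I)) = 0 := by
    intro T
    have := Complex.integral_boundary_rect_eq_zero_of_differentiableOn f ⟨-T, -θ⟩ ⟨T, 0⟩ (by
      intro u hu
      refine (hd u ?_ ?_).differentiableWithinAt
      · have := hu.2
        simp only [mem_preimage] at this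
        rw [uIcc_of_le (by linarith)] at this
        exact this.1
      · have := hu.2
        simp only [mem_preimage] at this
        rw [uIcc_of_le (by linarith)] at this
        exact this.2)
    exact this
  -- Both vertical sides of the rectangle at once: s will be T ↦ T and T ↦ -T.
  have hside : ∀ s : ℝ → ℝ, (∀ T, |s T| = |T|) →
      Tendsto (fun T : ℝ => Complex.I • ∫ y in (-θ)..0, f (s T + y * Complex.I)) atTop (𝓝 0) := by
    intro s hs
    have hlim : Tendsto (fun T : ℝ => C * Real.exp (-T) * |0 - -θ|) atTop (𝓝 0) := by
      have := ((Real.tendsto_exp_neg_atTop_nhds_zero).const_mul C).mul_const |0 - -θ|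
      simpa using this
    refine squeeze_zero_norm' ?_ hlim
    filter_upwards [eventually_ge_atTop 0] with T hT
    rw [norm_smul, Complex.norm_I, one_mul]
    refine intervalIntegral.norm_integral_le_of_norm_le_const fun y hy => ?_
    rw [uIoc_of_le (by linarith)] at hy
    have := hb (s T + y * Complex.I) (by simpa using hy.1.le) (by simpa using hy.2)
    simpa [hs, abs_of_nonneg hT] using this
  have h1 := intervalIntegral_tendsto_integral (hint (-θ) le_rfl (by linarith))
    tendsto_neg_atTop_atBot tendsto_id
  have h0 := intervalIntegral_tendsto_integral (hint 0 (by linarith) le_rfl)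
    tendsto_neg_atTop_atBot tendsto_id
  have htot := ((h1.sub h0).add (hside id fun T => rfl)).sub (hside (fun T => -T) fun T => abs_neg T)
  have hz := tendsto_nhds_unique (htot.congr fun T => hrect T) tendsto_const_nhds
  simp only [add_zero, sub_zero, sub_eq_zero] at hz
  rw [show (fun x : ℝ => f x) = fun x : ℝ => f (x + ((0 : ℝ) : ℂ) * Complex.I) by simp, ← hz]
  congr 1; ext x; push_cast; ring_nf

/-- Decay at both ends after the substitution k = e^a: for a ≤ 0 the factor e^a decays by itself,
for a ≥ 0 the bound r³/3! ≤ e^r with r = e^a gives the constant 6. -/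
theorem exp_mul_exp_neg_le (a : ℝ) :
    Real.exp a * Real.exp (-Real.exp a) ≤ 6 * Real.exp (-|a|) ∧
    Real.exp a * Real.exp a * Real.exp (-Real.exp a) ≤ 6 * Real.exp (-|a|) := by
  set r := Real.exp a with hr
  have hr0 : 0 < r := Real.exp_pos a
  have hq := Real.quadratic_le_exp_of_nonneg hr0.le
  have hcub : r ^ 3 / 6 ≤ Real.exp r := by
    have := Real.pow_div_factorial_le_exp r hr0.le 3
    simpa [Nat.factorial] using this
  have hE : Real.exp (-r) = (Real.exp r)⁻¹ := Real.exp_neg r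
  have he := Real.exp_pos r
  rw [hE]
  rcases le_total 0 a with h | h
  · rw [abs_of_nonneg h, Real.exp_neg, ← hr]
    have h1 : 1 ≤ r := Real.one_le_exp h
    constructor <;> rw [← div_eq_mul_inv, ← div_eq_mul_inv, div_le_div_iff₀ he hr0] <;> nlinarith
  · rw [abs_of_nonpos h, neg_neg, ← hr]
    constructor <;> rw [← div_eq_mul_inv, div_le_iff₀ he] <;> nlinarith [mul_pos hr0 he]

theorem norm_cexp_eq (u : ℂ) : ‖Complex.exp u‖ = Real.exp u.re := Complex.norm_exp u

/-- The exponential maps this strip into the sector of `SectorDecay`, since cos(2 Im u) ≥ cos(π/3) =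
1/2. -/
theorem SectorDecay.bound_exp (h : SectorDecay φ K) {u : ℂ} (h1 : -(Real.pi / 6) ≤ u.im)
    (h2 : u.im ≤ 0) :
    ‖φ (Complex.exp u)‖ ≤ K * (Real.exp u.re * Real.exp (-Real.exp u.re)) := by
  have hpi := Real.pi_pos
  have := h.bound (Complex.exp u) ?_ ?_
  · rwa [norm_cexp_eq] at this
  · rw [Complex.exp_re]
    exact mul_nonneg (Real.exp_pos _).le
      (Real.cos_nonneg_of_neg_pi_div_two_le_of_le (by linarith) (by linarith))
  · rw [norm_cexp_eq, ← Complex.exp_nat_mul, Complex.exp_re]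
    have hcos : 1 / 2 ≤ Real.cos (2 * u.im) := by
      rw [← Real.cos_pi_div_three, ← Real.cos_neg (2 * u.im)]
      exact Real.cos_le_cos_of_nonneg_of_le_pi (by linarith) (by linarith) (by linarith)
    have e1 : (((2 : ℕ) : ℂ) * u).re = u.re + u.re := by simp; ring
    have e2 : (((2 : ℕ) : ℂ) * u).im = 2 * u.im := by simp
    rw [e1, e2, Real.exp_add]
    nlinarith [mul_pos (Real.exp_pos u.re) (Real.exp_pos u.re)]

/-- The Stieltjes transform along the ray `arg k = -π/6`. -/
noncomputable def rotated (c : ℝ) (φ : ℂ → ℂ) (z : ℂ) : ℂ :=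
  ∫ u : ℝ, φ (Complex.exp (u - (Real.pi / 6 : ℝ) * Complex.I)) *
    Complex.exp (u - (Real.pi / 6 : ℝ) * Complex.I) /
      (c * Complex.exp (u - (Real.pi / 6 : ℝ) * Complex.I) - z)

theorem integral_comp_exp_real (g : ℝ → ℂ) :
    ∫ u : ℝ, (Real.exp u : ℂ) * g (Real.exp u) = ∫ k in Ioi (0 : ℝ), g k := by
  have := integral_image_eq_integral_abs_deriv_smul (s := univ) (f := Real.exp) (f' := Real.exp)
    MeasurableSet.univ (fun x _ => (Real.hasDerivAt_exp x).hasDerivWithinAt)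
    Real.exp_injective.injOn g
  rw [image_univ, Real.range_exp] at this
  rw [this]
  simp [abs_of_pos (Real.exp_pos _)]

/-- With k = e^u, turning the ray becomes a shift of the real line by -iπ/6. The points ck swept
over have Im ≤ 0, so they stay at distance at least Im z from z. -/
theorem SectorDecay.stieltjes_eq_rotated (h : SectorDecay φ K) (hc : 0 < c) {z : ℂ}
    (hz : 0 < z.im) : stieltjes c φ z = rotated c φ z := by
  have hpi := Real.pi_pos
  have hlow : ∀ u : ℂ, -(Real.pi / 6) ≤ u.im → u.im ≤ 0 → z.im ≤ ‖c * Complex.exp u - z‖ := by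
    intro u h1 h2
    refine le_trans ?_ (Complex.abs_im_le_norm _)
    have hs : Real.sin u.im ≤ 0 := Real.sin_nonpos_of_nonpos_of_neg_pi_le h2 (by linarith)
    have : (c * Complex.exp u - z).im = c * (Real.exp u.re * Real.sin u.im) - z.im := by
      simp [Complex.exp_im]
    rw [this, abs_of_nonpos]
    · nlinarith [mul_nonneg hc.le (mul_nonneg (Real.exp_pos u.re).le (neg_nonneg.2 hs))]
    · nlinarith [mul_nonneg hc.le (mul_nonneg (Real.exp_pos u.re).le (neg_nonneg.2 hs))]
  have key := integral_eq_integral_sub_of_strip (θ := Real.pi / 6) (C := 6 * K / z.im)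
    (f := fun u => φ (Complex.exp u) * Complex.exp u / (c * Complex.exp u - z)) (by positivity) ?_ ?_
  · rw [rotated, ← key, stieltjes, ← integral_comp_exp_real]
    congr 1; ext u; push_cast; ring
  · intro u h1 h2
    have hne : c * Complex.exp u - z ≠ 0 := norm_pos_iff.1 (hz.trans_le (hlow u h1 h2))
    have := h.diff (Complex.exp u)
    exact ((DifferentiableAt.comp u this Complex.differentiableAt_exp).mul
      Complex.differentiableAt_exp).div (by fun_prop) hne
  · intro u h1 h2
    have hl := hlow u h1 h2
    rw [norm_div, norm_mul, norm_cexp_eq, div_le_iff₀ (hz.trans_le hl)]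
    have hK := h.nonneg
    have := (exp_mul_exp_neg_le u.re).2
    calc ‖φ (Complex.exp u)‖ * Real.exp u.re
        ≤ K * (Real.exp u.re * Real.exp (-Real.exp u.re)) * Real.exp u.re := by
          gcongr; exact h.bound_exp h1 h2
      _ = K * (Real.exp u.re * Real.exp u.re * Real.exp (-Real.exp u.re)) := by ring
      _ ≤ K * (6 * Real.exp (-|u.re|)) := by gcongr
      _ = 6 * K / z.im * Real.exp (-|u.re|) * z.im := by field_simp
      _ ≤ _ := by gcongr

/-- On the turned ray Im(ck) = -c|k|/2, so |ck - z| ≥ c|k|/2 uniformly for Im z ≥ 0, real z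
included. Boundedness and continuity up to the real line both follow from this. -/
theorem SectorDecay.norm_rotated_integrand_le (h : SectorDecay φ K) (hc : 0 < c) {z : ℂ}
    (hz : 0 ≤ z.im) (u : ℝ) :
    ‖φ (Complex.exp (u - (Real.pi / 6 : ℝ) * Complex.I)) *
      Complex.exp (u - (Real.pi / 6 : ℝ) * Complex.I) /
      (c * Complex.exp (u - (Real.pi / 6 : ℝ) * Complex.I) - z)‖ ≤
    12 * K / c * Real.exp (-|u|) ∧ c * Complex.exp (u - (Real.pi / 6 : ℝ) * Complex.I) - z ≠ 0 := by
  have hpi := Real.pi_pos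
  set w : ℂ := u - (Real.pi / 6 : ℝ) * Complex.I with hw
  have hre : w.re = u := by simp [hw]
  have him : w.im = -(Real.pi / 6) := by simp [hw]
  have hlow : c * Real.exp u / 2 ≤ ‖c * Complex.exp w - z‖ := by
    refine le_trans ?_ (Complex.abs_im_le_norm _)
    have : (c * Complex.exp w - z).im = -(c * Real.exp u / 2) - z.im := by
      simp only [Complex.sub_im, Complex.im_ofReal_mul, Complex.exp_im, hre,
        him, Real.sin_neg, Real.sin_pi_div_six]
      ring
    rw [this, abs_of_nonpos]
    · linarith
    · have := mul_pos hc (Real.exp_pos u); linarith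
  have hpos : 0 < c * Real.exp u / 2 := by positivity
  refine ⟨?_, norm_pos_iff.1 (hpos.trans_le hlow)⟩
  rw [norm_div, norm_mul, norm_cexp_eq, hre, div_le_iff₀ (hpos.trans_le hlow)]
  have hK := h.nonneg
  have hb := h.bound_exp (u := w) (by rw [him]) (by rw [him]; linarith)
  rw [hre] at hb
  have := (exp_mul_exp_neg_le u).1
  calc ‖φ (Complex.exp w)‖ * Real.exp u
      ≤ K * (Real.exp u * Real.exp (-Real.exp u)) * Real.exp u := by gcongr
    _ ≤ K * (6 * Real.exp (-|u|)) * Real.exp u := by gcongr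
    _ = 12 * K / c * Real.exp (-|u|) * (c * Real.exp u / 2) := by field_simp; ring
    _ ≤ _ := by gcongr

theorem SectorDecay.continuousOn_rotated (h : SectorDecay φ K) (hc : 0 < c) :
    ContinuousOn (rotated c φ) {z : ℂ | 0 ≤ z.im} := by
  refine continuousOn_of_dominated (bound := fun u => 12 * K / c * Real.exp (-|u|)) ?_ ?_
    (integrable_exp_neg_abs.const_mul _) ?_
  · intro z hz
    refine Continuous.aestronglyMeasurable ?_
    refine Continuous.div ?_ (by fun_prop) fun u => (h.norm_rotated_integrand_le hc hz u).2
    exact (h.diff.continuous.comp (by fun_prop)).mul (by fun_prop)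
  · exact fun z hz => Eventually.of_forall fun u => (h.norm_rotated_integrand_le hc hz u).1
  · refine Eventually.of_forall fun u => ?_
    exact ContinuousOn.div continuousOn_const (by fun_prop)
      fun z hz => (h.norm_rotated_integrand_le hc hz u).2

theorem SectorDecay.exists_norm_stieltjes_le (h : SectorDecay φ K) (hc : 0 < c) :
    ∃ C, ∀ z : ℂ, 0 < z.im → ‖stieltjes c φ z‖ ≤ C := by
  refine ⟨∫ u : ℝ, 12 * K / c * Real.exp (-|u|), fun z hz => ?_⟩
  rw [h.stieltjes_eq_rotated hc hz]
  exact norm_integral_le_of_norm_le (integrable_exp_neg_abs.const_mul _)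
    (Eventually.of_forall fun u => (h.norm_rotated_integrand_le hc hz.le u).1)

theorem SectorDecay.tendsto_stieltjes_upper (h : SectorDecay φ K) (hc : 0 < c) (x : ℝ) :
    Tendsto (stieltjes c φ) (𝓝[{z : ℂ | 0 < z.im}] x) (𝓝 (rotated c φ x)) := by
  have h1 : Tendsto (rotated c φ) (𝓝[{z : ℂ | 0 < z.im}] x) (𝓝 (rotated c φ x)) :=
    (h.continuousOn_rotated hc x (by simp)).mono (fun z (hz : 0 < z.im) => hz.le)
  refine h1.congr' ?_
  filter_upwards [self_mem_nhdsWithin] with z hz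
  exact (h.stieltjes_eq_rotated hc hz).symm

theorem tendsto_add_mul_I_upper (x : ℝ) : Tendsto (fun ε : ℝ => (x + ε * Complex.I : ℂ)) (𝓝[>] 0)
    (𝓝[{z : ℂ | 0 < z.im}] x) := by
  refine tendsto_nhdsWithin_iff.2 ⟨?_, ?_⟩
  · have : Continuous fun ε : ℝ => (x + ε * Complex.I : ℂ) := by fun_prop
    have := (this.tendsto 0).mono_left (nhdsWithin_le_nhds (s := Ioi 0))
    simpa using this
  · filter_upwards [self_mem_nhdsWithin] with ε hε
    simpa using hε

/-- Both sides are the limit of the transform along iε. -/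
theorem SectorDecay.rotated_zero (h : SectorDecay φ K) (hc : 0 < c) :
    rotated c φ 0 = stieltjes c φ 0 := by
  have h1 := (h.tendsto_stieltjes_upper hc 0).comp (tendsto_add_mul_I_upper 0)
  refine tendsto_nhds_unique (by simpa using h1) ((h.tendsto_stieltjes_zero hc).congr fun ε => ?_)
  simp

theorem stieltjes_conj (hφ : ∀ k : ℝ, 0 < k → (starRingEnd ℂ) (φ k) = φ k) (z : ℂ) :
    stieltjes c φ ((starRingEnd ℂ) z) = (starRingEnd ℂ) (stieltjes c φ z) := by
  rw [stieltjes, stieltjes, ← integral_conj]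
  refine setIntegral_congr_fun measurableSet_Ioi fun k hk => ?_
  simp [hφ k hk]

/-! ### Positivity of the imaginary part -/

theorem im_div_eq {a w : ℂ} (ha : a.im = 0) : (a / w).im = a.re * (-w.im) / Complex.normSq w := by
  rw [Complex.div_im, ha]; ring

theorem SectorDecay.im_stieltjes (h : SectorDecay φ K) (hc : 0 < c) {z : ℂ}
    (hz : -z ∈ Complex.slitPlane) (hφ : ∀ k : ℝ, 0 < k → (φ k).im = 0) :
    IntegrableOn (fun k : ℝ => (φ k).re * z.im / Complex.normSq (c * k - z)) (Ioi 0) ∧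
    (stieltjes c φ z).im = ∫ k in Ioi (0 : ℝ), (φ k).re * z.im / Complex.normSq (c * k - z) := by
  have hi := h.integrableOn_div_of_slit hc hz
  have e : EqOn (fun k : ℝ => (φ k / (c * k - z)).im)
      (fun k : ℝ => (φ k).re * z.im / Complex.normSq (c * k - z)) (Ioi 0) := fun k hk => by
    simp only [im_div_eq (hφ k hk)]; simp
  constructor
  · exact IntegrableOn.congr_fun (Integrable.im hi) e measurableSet_Ioi
  · rw [stieltjes]
    rw [← setIntegral_congr_fun measurableSet_Ioi e]
    exact (integral_im hi).symm

theorem SectorDecay.im_stieltjes_nonneg (h : SectorDecay φ K) (hc : 0 < c) {z : ℂ}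
    (hz : 0 < z.im) (hφ : ∀ k : ℝ, 0 < k → (φ k).im = 0) (hpos : ∀ k : ℝ, 0 < k → 0 ≤ (φ k).re) :
    0 ≤ (stieltjes c φ z).im := by
  rw [(h.im_stieltjes hc (neg_mem_slitPlane_of_im_pos hz) hφ).2]
  refine setIntegral_nonneg measurableSet_Ioi fun k hk => ?_
  exact div_nonneg (mul_nonneg (hpos k hk) hz.le) (Complex.normSq_nonneg _)

/-- The Poisson kernel keeps a fixed mass as ε → 0: where 0 < ck - x ≤ ε one has |ck - z|² ≤ 2ε², so
the integrand is at least m/(2ε) on an interval of length ε/c. -/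
theorem SectorDecay.im_stieltjes_ge (h : SectorDecay φ K) (hc : 0 < c) {x m ε : ℝ} (hx : 0 < x)
    (hφ : ∀ k : ℝ, 0 < k → (φ k).im = 0) (hpos : ∀ k : ℝ, 0 < k → 0 ≤ (φ k).re) (hm : 0 ≤ m)
    (hε : 0 < ε) (hmk : ∀ k ∈ Icc (x / c) ((x + ε) / c), m ≤ (φ k).re) :
    m / (2 * c) ≤ (stieltjes c φ (x + ε * Complex.I)).im := by
  obtain ⟨h1, h2⟩ := h.im_stieltjes hc (z := x + ε * Complex.I)
    (neg_mem_slitPlane_of_im_pos (by simpa using hε)) hφ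
  rw [h2]
  have hsub : Ioc (x / c) ((x + ε) / c) ⊆ Ioi 0 := fun k hk => lt_trans (by positivity) hk.1
  have him : (x + ε * Complex.I : ℂ).im = ε := by simp
  refine le_trans ?_ (setIntegral_mono_set h1 ?_ (LE.le.eventuallyLE hsub))
  · have hle : x / c ≤ (x + ε) / c := by gcongr; linarith
    have : ∫ k in Ioc (x / c) ((x + ε) / c), m / (2 * ε) = m / (2 * c) := by
      rw [setIntegral_const, measureReal_def, Real.volume_Ioc, ENNReal.toReal_ofReal (by linarith)]
      rw [smul_eq_mul]; field_simp; ring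
    rw [← this]
    refine setIntegral_mono_on (by simp) (h1.mono_set hsub) measurableSet_Ioc fun k hk => ?_
    have hk1 : x < c * k := by have := hk.1; rw [div_lt_iff₀ hc] at this; linarith
    have hk2 : c * k ≤ x + ε := by have := hk.2; rw [le_div_iff₀ hc] at this; linarith
    have hns : Complex.normSq (c * k - (x + ε * Complex.I)) = (c * k - x) ^ 2 + ε ^ 2 := by
      rw [Complex.normSq_apply]; simp; ring
    rw [him, hns, div_le_div_iff₀ (by positivity) (by positivity)]
    have hmk' := hmk k ⟨hk.1.le, hk.2⟩
    have h3 : (c * k - x) ^ 2 ≤ ε ^ 2 := by nlinarith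
    nlinarith [mul_nonneg hm (sub_nonneg.2 h3), mul_nonneg (sub_nonneg.2 hmk') (sq_nonneg ε)]
  · refine (ae_restrict_mem measurableSet_Ioi).mono fun k hk => ?_
    rw [him]
    exact div_nonneg (mul_nonneg (hpos k hk) hε.le) (Complex.normSq_nonneg _)

end Stieltjes

/-! ### Cauchy's formula in the upper half-plane -/

section HalfPlane

/-- Comparison with 1/(1 + x²): compactness for |x| ≤ max(ρ, 1), and 1 + x² ≤ 2x² beyond. -/
theorem integrable_of_continuous_of_norm_le {f : ℝ → ℂ} (hf : Continuous f) {C ρ : ℝ}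
    (hb : ∀ x : ℝ, ρ ≤ |x| → ‖f x‖ ≤ C / |x| ^ 2) : Integrable f := by
  obtain ⟨B, hB⟩ := (isCompact_Icc (a := -max ρ 1) (b := max ρ 1)).exists_bound_of_continuousOn
    (f := fun x : ℝ => ((1 + x ^ 2 : ℝ) : ℂ) * f x) (by fun_prop)
  refine Integrable.mono' (integrable_inv_one_add_sq.const_mul (max B (2 * C)))
    hf.aestronglyMeasurable (Eventually.of_forall fun x => ?_)
  have h1 : 0 < 1 + x ^ 2 := by positivity
  rw [← div_eq_mul_inv, le_div_iff₀ h1]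
  rcases le_total |x| (max ρ 1) with h | h
  · have := hB x (abs_le.1 h)
    rw [norm_mul, Complex.norm_real, Real.norm_of_nonneg h1.le] at this
    rw [mul_comm]
    exact this.trans (le_max_left _ _)
  · have hx1 : 1 ≤ |x| := (le_max_right _ _).trans h
    have h2 := hb x ((le_max_left _ _).trans h)
    rw [le_div_iff₀ (by positivity), sq_abs] at h2
    have h3 : 1 ≤ x ^ 2 := by rw [← sq_abs]; nlinarith
    refine le_trans ?_ (le_max_right _ _)
    nlinarith [norm_nonneg (f x)]

/-- Cauchy's theorem on [-T, T] × [0, T]: the three other sides have total length 4T and carry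
values at most |C|/T². -/
theorem integral_real_eq_zero_of_upper {f : ℂ → ℂ} (hc : ContinuousOn f {z : ℂ | 0 ≤ z.im})
    (hd : DifferentiableOn ℂ f {z : ℂ | 0 < z.im}) {C ρ : ℝ}
    (hb : ∀ z : ℂ, 0 ≤ z.im → ρ ≤ ‖z‖ → ‖f z‖ ≤ C / ‖z‖ ^ 2) :
    (Integrable fun x : ℝ => f x) ∧ ∫ x : ℝ, f x = 0 := by
  have hcont : Continuous fun x : ℝ => f x :=
    hc.comp_continuous Complex.continuous_ofReal (by simp)
  have hint : Integrable fun x : ℝ => f x :=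
    integrable_of_continuous_of_norm_le (C := C) (ρ := ρ) hcont fun x hx => by
      simpa using hb x (by simp) (by simpa using hx)
  refine ⟨hint, ?_⟩
  have hop : IsOpen {z : ℂ | 0 < z.im} := isOpen_lt continuous_const Complex.continuous_im
  have hrect : ∀ T : ℝ, 0 < T → (∫ x in (-T)..T, f x)
      - (∫ x in (-T)..T, f (x + T * Complex.I))
      + Complex.I • (∫ y in (0)..T, f (T + y * Complex.I))
      - Complex.I • (∫ y in (0)..T, f ((-T : ℝ) + y * Complex.I)) = 0 := by
    intro T hT
    have := Complex.integral_boundary_rect_eq_zero_of_continuousOn_of_differentiableOn f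
      ⟨-T, 0⟩ ⟨T, T⟩ (hc.mono ?_) (hd.mono ?_)
    · simpa using this
    · intro u hu
      have := hu.2
      simp only [mem_preimage, uIcc_of_le hT.le] at this
      exact this.1
    · intro u hu
      have := hu.2
      simp only [mem_preimage, min_eq_left hT.le, max_eq_right hT.le] at this
      exact this.1
  have hC : ∀ T : ℝ, 0 < T → ∀ z : ℂ, 0 ≤ z.im → ρ ≤ T → T ≤ ‖z‖ → ‖f z‖ ≤ |C| / T ^ 2 := by
    intro T hT z hz hρ hTz
    refine (hb z hz (hρ.trans hTz)).trans ?_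
    have : 0 < ‖z‖ := hT.trans_le hTz
    gcongr
    exact le_abs_self C
  have hlim : Tendsto (fun T : ℝ => 4 * (|C| / T)) atTop (𝓝 0) := by
    have := (tendsto_const_nhds (x := |C|)).div_atTop (tendsto_id (α := ℝ) (x := atTop))
    simpa using this.const_mul 4
  have hsum : Tendsto (fun T : ℝ => ∫ x in (-T)..T, f x) atTop (𝓝 0) := by
    refine squeeze_zero_norm' ?_ hlim
    filter_upwards [eventually_ge_atTop ρ, eventually_gt_atTop 0] with T hρ hT
    have e := hrect T hT
    have b1 : ‖∫ x in (-T)..T, f (x + T * Complex.I)‖ ≤ |C| / T ^ 2 * |T - -T| := by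
      refine intervalIntegral.norm_integral_le_of_norm_le_const fun x _ => ?_
      refine hC T hT _ (by simpa using hT.le) hρ ?_
      refine le_trans ?_ (Complex.abs_im_le_norm _)
      simp [le_abs_self]
    have b2 : ‖Complex.I • ∫ y in (0)..T, f (T + y * Complex.I)‖ ≤ |C| / T ^ 2 * |T - 0| := by
      rw [norm_smul, Complex.norm_I, one_mul]
      refine intervalIntegral.norm_integral_le_of_norm_le_const fun y hy => ?_
      rw [uIoc_of_le hT.le] at hy
      refine hC T hT _ (by simpa using hy.1.le) hρ ?_
      refine le_trans ?_ (Complex.abs_re_le_norm _)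
      simp [le_abs_self]
    have b3 : ‖Complex.I • ∫ y in (0)..T, f ((-T : ℝ) + y * Complex.I)‖ ≤
        |C| / T ^ 2 * |T - 0| := by
      rw [norm_smul, Complex.norm_I, one_mul]
      refine intervalIntegral.norm_integral_le_of_norm_le_const fun y hy => ?_
      rw [uIoc_of_le hT.le] at hy
      refine hC T hT _ (by simpa using hy.1.le) hρ ?_
      refine le_trans ?_ (Complex.abs_re_le_norm _)
      simp [le_abs_self]
    have e' : (∫ x in (-T)..T, f x) = (∫ x in (-T)..T, f (x + T * Complex.I))
        - Complex.I • (∫ y in (0)..T, f (T + y * Complex.I))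
        + Complex.I • (∫ y in (0)..T, f ((-T : ℝ) + y * Complex.I)) := by
      linear_combination e
    rw [e']
    refine (norm_add_le _ _).trans ((add_le_add (norm_sub_le _ _) le_rfl).trans
      ((add_le_add (add_le_add b1 b2) b3).trans (le_of_eq ?_)))
    rw [abs_of_pos (show 0 < T - -T by linarith), abs_of_pos (show 0 < T - 0 by linarith)]
    field_simp; ring
  exact tendsto_nhds_unique
    (intervalIntegral_tendsto_integral hint tendsto_neg_atTop_atBot tendsto_id) hsum

theorem integrable_and_integral_poisson {z : ℂ} (hz : 0 < z.im) :
    (Integrable fun x : ℝ => ((x - (starRingEnd ℂ) z) * (x - z) : ℂ)⁻¹) ∧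
    ∫ x : ℝ, ((x - (starRingEnd ℂ) z) * (x - z) : ℂ)⁻¹ = Real.pi / z.im := by
  set a := z.re
  set b := z.im
  have e : (fun x : ℝ => ((x - (starRingEnd ℂ) z) * (x - z) : ℂ)⁻¹) =
      fun x : ℝ => (((b ^ 2)⁻¹ * (1 + ((x - a) / b) ^ 2)⁻¹ : ℝ) : ℂ) := by
    ext x
    have h1 : ((x - (starRingEnd ℂ) z) * (x - z) : ℂ) = ((b ^ 2 * (1 + ((x - a) / b) ^ 2) : ℝ) : ℂ) := by
      have : b ^ 2 * (1 + ((x - a) / b) ^ 2) = b ^ 2 + (x - a) ^ 2 := by field_simp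
      rw [this]
      apply Complex.ext <;> simp [a, b, pow_two] <;> ring
    rw [h1, ← Complex.ofReal_inv, mul_inv]
  have hi : Integrable fun x : ℝ => (b ^ 2)⁻¹ * (1 + ((x - a) / b) ^ 2)⁻¹ :=
    (((integrable_inv_one_add_sq).comp_div hz.ne').comp_sub_right a).const_mul _
  rw [e]
  refine ⟨hi.ofReal, ?_⟩
  rw [integral_complex_ofReal, integral_const_mul,
    integral_sub_right_eq_self (fun y : ℝ => (1 + (y / b) ^ 2)⁻¹) a,
    Measure.integral_comp_div (fun y : ℝ => (1 + y ^ 2)⁻¹) b, integral_univ_inv_one_add_sq,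
    abs_of_pos hz]
  have : (b : ℂ) ≠ 0 := by exact_mod_cast hz.ne'
  push_cast
  simp only [smul_eq_mul]
  push_cast
  field_simp

theorem norm_le_two_mul_norm_sub {z w : ℂ} (h : 2 * ‖z‖ ≤ ‖w‖) : ‖w‖ / 2 ≤ ‖w - z‖ := by
  have := norm_sub_norm_le w z
  linarith

variable {U V : ℂ → ℂ} {C ρ : ℝ}

/-- The pole lies below the real line, and the denominator improves the decay from 1/|w| to 1/|w|².
-/
theorem cauchy_lower (hc : ContinuousOn U {z : ℂ | 0 ≤ z.im})
    (hd : DifferentiableOn ℂ U {z : ℂ | 0 < z.im})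
    (hb : ∀ z : ℂ, 0 ≤ z.im → ρ ≤ ‖z‖ → ‖U z‖ ≤ C / ‖z‖) {z : ℂ} (hz : 0 < z.im) :
    (Integrable fun x : ℝ => U x / (x - (starRingEnd ℂ) z)) ∧
    ∫ x : ℝ, U x / (x - (starRingEnd ℂ) z) = 0 := by
  have hne : ∀ w : ℂ, 0 ≤ w.im → w - (starRingEnd ℂ) z ≠ 0 := fun w hw h => by
    have := congrArg Complex.im h
    simp at this; linarith
  refine integral_real_eq_zero_of_upper (f := fun w => U w / (w - (starRingEnd ℂ) z))
    (C := 2 * C) (ρ := max (max ρ (2 * ‖z‖)) 1) ?_ ?_ ?_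
  · exact hc.div (by fun_prop) fun w hw => hne w hw
  · exact hd.div (by fun_prop) fun w hw => hne w (le_of_lt hw)
  · intro w hw hρ
    have h1 : ρ ≤ ‖w‖ := (le_max_left _ _).trans ((le_max_left _ _).trans hρ)
    have h2 : 2 * ‖(starRingEnd ℂ) z‖ ≤ ‖w‖ := by
      rw [Complex.norm_conj]
      exact (le_max_right _ _).trans ((le_max_left _ _).trans hρ)
    have h3 : 0 < ‖w‖ := one_pos.trans_le ((le_max_right _ _).trans hρ)
    have h4 := norm_le_two_mul_norm_sub h2
    have h5 := hb w hw h1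
    rw [norm_div, div_le_iff₀ (lt_of_lt_of_le (by positivity) h4)]
    have hC : 0 ≤ C / ‖w‖ := (norm_nonneg _).trans h5
    calc ‖U w‖ ≤ C / ‖w‖ := h5
      _ = (C / ‖w‖) * (2 / ‖w‖) * (‖w‖ / 2) := by field_simp
      _ ≤ (C / ‖w‖) * (2 / ‖w‖) * ‖w - (starRingEnd ℂ) z‖ := by gcongr
      _ = _ := by field_simp

/-- To avoid an indented contour, subtract the multiple of 1/(w - z̄) that agrees with U at z. The
quotient of the difference by w - z extends holomorphically over z and integrates to zero; the
subtracted term gives a Poisson integral with value 2πi U(z). -/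
theorem cauchy_upper (hc : ContinuousOn U {z : ℂ | 0 ≤ z.im})
    (hd : DifferentiableOn ℂ U {z : ℂ | 0 < z.im})
    (hb : ∀ z : ℂ, 0 ≤ z.im → ρ ≤ ‖z‖ → ‖U z‖ ≤ C / ‖z‖) {z : ℂ} (hz : 0 < z.im) :
    (Integrable fun x : ℝ => U x / (x - z)) ∧
    ∫ x : ℝ, U x / (x - z) = 2 * Real.pi * Complex.I * U z := by
  set zb := (starRingEnd ℂ) z with hzb
  have hop : IsOpen {w : ℂ | 0 < w.im} := isOpen_lt continuous_const Complex.continuous_im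
  have hne : ∀ w : ℂ, 0 ≤ w.im → w - zb ≠ 0 := fun w hw h => by
    have := congrArg Complex.im h
    simp [hzb] at this; linarith
  set V0 : ℂ → ℂ := fun w => U w - U z * (z - zb) / (w - zb) with hV0
  have hV0z : V0 z = 0 := by
    simp only [hV0]; field_simp [hne z hz.le]; ring
  have hV0c : ContinuousOn V0 {z : ℂ | 0 ≤ z.im} :=
    hc.sub (continuousOn_const.div (by fun_prop) fun w hw => hne w hw)
  have hV0d : DifferentiableOn ℂ V0 {z : ℂ | 0 < z.im} :=
    hd.sub ((differentiableOn_const _).div (by fun_prop) fun w hw => hne w (le_of_lt hw))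
  have hds : ∀ w, w ≠ z → dslope V0 z w = V0 w / (w - z) := fun w hw => by
    rw [dslope_of_ne _ hw, slope_def_field, hV0z, sub_zero]
  have hreal : ∀ x : ℝ, (x : ℂ) ≠ z := fun x h => by
    have := congrArg Complex.im h
    simp at this; linarith
  have hr : ∀ x : ℝ, dslope V0 z x = U x / (x - z) - U z * (z - zb) * ((x - zb) * (x - z))⁻¹ := by
    intro x
    rw [hds x (hreal x)]
    have h1 := sub_ne_zero.2 (hreal x)
    have h2 := hne x (by simp)
    simp only [hV0]; field_simp
  obtain ⟨hpi, hpv⟩ := integrable_and_integral_poisson hz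
  have key := integral_real_eq_zero_of_upper (f := dslope V0 z)
    (C := 2 * C + 4 * ‖U z * (z - zb)‖) (ρ := max (max ρ (2 * ‖z‖ + 1)) 1) ?_ ?_ ?_
  · have hI : Integrable fun x : ℝ => U x / (x - z) := by
      refine (key.1.add (hpi.const_mul (U z * (z - zb)))).congr (Eventually.of_forall fun x => ?_)
      simp only [Pi.add_apply, hr]; ring
    refine ⟨hI, ?_⟩
    have := key.2
    simp_rw [hr] at this
    rw [integral_sub hI (hpi.const_mul _), integral_const_mul, hpv, sub_eq_zero] at this
    rw [this]
    have hb0 : (z.im : ℂ) ≠ 0 := by exact_mod_cast hz.ne'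
    have : z - zb = 2 * z.im * Complex.I := by
      rw [hzb, Complex.sub_conj]; push_cast; ring
    rw [this]; field_simp
  · intro w hw
    by_cases hwz : w = z
    · subst hwz
      exact (continuousAt_dslope_same.2
        (hV0d.differentiableAt (hop.mem_nhds hz))).continuousWithinAt
    · exact (continuousWithinAt_dslope_of_ne hwz).2 (hV0c w hw)
  · exact (Complex.differentiableOn_dslope (hop.mem_nhds hz)).2 hV0d
  · intro w hw hρ
    have h1 : ρ ≤ ‖w‖ := (le_max_left _ _).trans ((le_max_left _ _).trans hρ)
    have h2' : 2 * ‖z‖ + 1 ≤ ‖w‖ := (le_max_right _ _).trans ((le_max_left _ _).trans hρ)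
    have h2 : 2 * ‖z‖ ≤ ‖w‖ := by linarith
    have h2b : 2 * ‖zb‖ ≤ ‖w‖ := by rwa [hzb, Complex.norm_conj]
    have h3 : 0 < ‖w‖ := one_pos.trans_le ((le_max_right _ _).trans hρ)
    have h4 := norm_le_two_mul_norm_sub h2
    have h4b := norm_le_two_mul_norm_sub h2b
    have h5 := hb w hw h1
    have hwz : w ≠ z := by rintro rfl; linarith [norm_nonneg w]
    rw [hds w hwz, norm_div, div_le_iff₀ (lt_of_lt_of_le (by positivity) h4)]
    have hC : 0 ≤ C := by
      have := (norm_nonneg _).trans h5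
      rwa [le_div_iff₀ h3, zero_mul] at this
    have h6 : ‖U z * (z - zb) / (w - zb)‖ ≤ ‖U z * (z - zb)‖ * (2 / ‖w‖) := by
      rw [norm_div, div_le_iff₀ (lt_of_lt_of_le (by positivity) h4b)]
      calc ‖U z * (z - zb)‖ = ‖U z * (z - zb)‖ * (2 / ‖w‖) * (‖w‖ / 2) := by field_simp
        _ ≤ _ := by gcongr
    calc ‖V0 w‖ ≤ C / ‖w‖ + ‖U z * (z - zb)‖ * (2 / ‖w‖) :=
          (norm_sub_le _ _).trans (add_le_add h5 h6)
      _ = (2 * C + 4 * ‖U z * (z - zb)‖) / ‖w‖ ^ 2 * (‖w‖ / 2) := by field_simp; ring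
      _ ≤ _ := by gcongr

/-- Recovery of a function in the upper half-plane from the jump of its boundary values. -/
theorem cauchy_jump (hUc : ContinuousOn U {z : ℂ | 0 ≤ z.im})
    (hUd : DifferentiableOn ℂ U {z : ℂ | 0 < z.im})
    (hUb : ∀ z : ℂ, 0 ≤ z.im → ρ ≤ ‖z‖ → ‖U z‖ ≤ C / ‖z‖)
    (hVc : ContinuousOn V {z : ℂ | 0 ≤ z.im})
    (hVd : DifferentiableOn ℂ V {z : ℂ | 0 < z.im})
    (hVb : ∀ z : ℂ, 0 ≤ z.im → ρ ≤ ‖z‖ → ‖V z‖ ≤ C / ‖z‖)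
    (hneg : ∀ᵐ x : ℝ, x < 0 → U x = (starRingEnd ℂ) (V x)) {z : ℂ} (hz : 0 < z.im) :
    U z = (2 * Real.pi * Complex.I)⁻¹ *
      ∫ x in Ioi (0 : ℝ), (U x - (starRingEnd ℂ) (V x)) / (x - z) := by
  obtain ⟨h1, h2⟩ := cauchy_upper hUc hUd hUb hz
  obtain ⟨h3, h4⟩ := cauchy_lower hVc hVd hVb hz
  -- The conjugate of V plays the boundary value from below; by conjugating `cauchy_lower` its
  -- Cauchy integral at z vanishes, so it may be subtracted freely.
  have e : ∀ x : ℝ, (starRingEnd ℂ) (V x / (x - (starRingEnd ℂ) z)) =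
      (starRingEnd ℂ) (V x) / (x - z) := fun x => by simp
  have h3' : Integrable fun x : ℝ => (starRingEnd ℂ) (V x) / (x - z) := by
    refine Integrable.congr (f := fun x : ℝ => Complex.conjCLE (V x / (x - (starRingEnd ℂ) z)))
      (Complex.conjCLE.toContinuousLinearMap.integrable_comp h3) (Eventually.of_forall fun x => ?_)
    exact e x
  have h4' : ∫ x : ℝ, (starRingEnd ℂ) (V x) / (x - z) = 0 := by
    simp_rw [← e]
    rw [integral_conj, h4, map_zero]
  have h5 : ∫ x : ℝ, (U x - (starRingEnd ℂ) (V x)) / (x - z) = 2 * Real.pi * Complex.I * U z := by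
    simp_rw [sub_div]
    rw [integral_sub h1 h3', h2, h4', sub_zero]
  rw [setIntegral_eq_integral_of_ae_compl_eq_zero, h5]
  · have : (Real.pi : ℂ) ≠ 0 := by exact_mod_cast Real.pi_ne_zero
    field_simp
  · have h0 : ∀ᵐ x : ℝ, x ≠ 0 := by
      simp [ae_iff]
    filter_upwards [hneg, h0] with x hx hx0 hxm
    have : x < 0 := lt_of_le_of_ne (not_lt.1 hxm) hx0
    rw [hx this]; simp

end HalfPlane

/-! ### Simple poles -/

/-- A bound C/ε on one vertical ray is enough: were (y - p) f(y) of negative order, its norm would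
tend to infinity along that ray too. So it extends analytically, and `g` is its divided difference
at p. -/
theorem exists_simple_pole {f : ℂ → ℂ} {p : ℂ} (hf : MeromorphicAt f p) {C : ℝ}
    (hb : ∀ᶠ ε : ℝ in 𝓝[>] 0, ‖f (p + ε * Complex.I)‖ ≤ C / ε) :
    ∃ r : ℂ, ∃ g : ℂ → ℂ, AnalyticAt ℂ g p ∧ ∀ᶠ y in 𝓝[≠] p, f y = r / (y - p) + g y := by
  have hm : MeromorphicAt (fun y => (y - p) * f y) p :=
    (MeromorphicAt.sub (MeromorphicAt.id p) (MeromorphicAt.const p p)).mul hf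
  have hpath : Tendsto (fun ε : ℝ => (p + ε * Complex.I : ℂ)) (𝓝[>] 0) (𝓝[≠] p) := by
    refine tendsto_nhdsWithin_iff.2 ⟨?_, ?_⟩
    · have : Continuous fun ε : ℝ => (p + ε * Complex.I : ℂ) := by fun_prop
      have := (this.tendsto 0).mono_left (nhdsWithin_le_nhds (s := Ioi 0))
      simpa using this
    · filter_upwards [self_mem_nhdsWithin] with ε hε
      have : ε ≠ 0 := ne_of_gt hε
      simp [this]
  have hord : 0 ≤ meromorphicOrderAt (fun y => (y - p) * f y) p := by
    by_contra hneg
    have h1 := (tendsto_cobounded_iff_meromorphicOrderAt_neg hm).2 (not_le.1 hneg)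
    have h2 := (tendsto_norm_atTop_iff_cobounded.2 (h1.comp hpath)).eventually_gt_atTop C
    obtain ⟨ε, h3, h4, h5⟩ := (h2.and (hb.and self_mem_nhdsWithin)).exists
    have hε : 0 < ε := h5
    simp only [Function.comp_apply, add_sub_cancel_left, norm_mul, Complex.norm_real,
      Complex.norm_I, mul_one, Real.norm_of_nonneg hε.le] at h3
    rw [le_div_iff₀ hε] at h4
    linarith
  obtain ⟨r, hr⟩ := tendsto_nhds_of_meromorphicOrderAt_nonneg hm hord
  set h0 : ℂ → ℂ := Function.update (fun y => (y - p) * f y) p r with hh0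
  have hcont : ContinuousAt h0 p := continuousAt_update_same.2 hr
  have hne : ∀ᶠ y in 𝓝[≠] p, y ≠ p := self_mem_nhdsWithin
  have hdiff : ∀ᶠ y in 𝓝[≠] p, DifferentiableAt ℂ h0 y := by
    filter_upwards [hm.eventually_analyticAt, hne] with y hy hyp
    refine hy.differentiableAt.congr_of_eventuallyEq ?_
    filter_upwards [isOpen_ne.mem_nhds hyp] with w hw
    exact Function.update_of_ne hw _ _
  have han : AnalyticAt ℂ h0 p :=
    Complex.analyticAt_of_differentiable_on_punctured_nhds_of_continuousAt hdiff hcont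
  refine ⟨r, dslope h0 p, ?_, ?_⟩
  · obtain ⟨s, hs, hd⟩ := han.eventually_analyticAt.exists_mem
    have : DifferentiableOn ℂ (dslope h0 p) s :=
      (Complex.differentiableOn_dslope hs).2
        fun y hy => (hd y hy).differentiableAt.differentiableWithinAt
    exact this.analyticAt hs
  · filter_upwards [hne] with y hy
    have hsub := sub_ne_zero.2 hy
    rw [dslope_of_ne _ hy, slope_def_field]
    simp only [hh0, Function.update_of_ne hy, Function.update_self]
    field_simp; ring

/-- For small ε the expression is constantly r. -/
theorem tendsto_circleIntegral_of_simple_pole {f g : ℂ → ℂ} {p r : ℂ} (hg : AnalyticAt ℂ g p)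
    (hf : ∀ᶠ y in 𝓝[≠] p, f y = r / (y - p) + g y) :
    Tendsto (fun ε : ℝ => (2 * Real.pi * Complex.I)⁻¹ * ∮ y in C(p, ε), f y) (𝓝[>] 0) (𝓝 r) := by
  refine tendsto_const_nhds.congr' ?_
  obtain ⟨δ, hδ, hd⟩ := Metric.eventually_nhds_iff_ball.1 hg.eventually_analyticAt
  obtain ⟨δ', hδ', hd'⟩ := Metric.eventually_nhds_iff_ball.1 (eventually_nhdsWithin_iff.1 hf)
  filter_upwards [Ioo_mem_nhdsGT (lt_min hδ hδ')] with ε hε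
  have h1 : ε < δ := hε.2.trans_le (min_le_left _ _)
  have h2 : ε < δ' := hε.2.trans_le (min_le_right _ _)
  have hε0 : 0 < ε := hε.1
  have hgc : ContinuousOn g (Metric.closedBall p ε) := fun y hy =>
    (hd y (Metric.closedBall_subset_ball h1 hy)).continuousAt.continuousWithinAt
  have hg0 : (∮ y in C(p, ε), g y) = 0 :=
    Complex.circleIntegral_eq_zero_of_differentiable_on_off_countable hε0.le countable_empty hgc
      fun y hy => (hd y (Metric.ball_subset_ball h1.le hy.1)).differentiableAt
  have e : (∮ y in C(p, ε), f y) = ∮ y in C(p, ε), (r * (y - p)⁻¹ + g y) := by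
    refine circleIntegral.integral_congr hε0.le fun y hy => ?_
    have hyp : y ≠ p := by
      rintro rfl
      simp at hy; linarith
    rw [hd' y (Metric.sphere_subset_closedBall.trans (Metric.closedBall_subset_ball h2) hy) hyp,
      div_eq_mul_inv]
  have hi1 : CircleIntegrable (fun y => r * (y - p)⁻¹) p ε := by
    refine ContinuousOn.circleIntegrable hε0.le ?_
    refine continuousOn_const.mul (ContinuousOn.inv₀ (by fun_prop) fun y hy => ?_)
    rintro h
    rw [sub_eq_zero] at h
    subst h
    simp at hy; linarith
  have hi2 : CircleIntegrable g p ε :=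
    (hgc.mono Metric.sphere_subset_closedBall).circleIntegrable hε0.le
  rw [e, circleIntegral.integral_add hi1 hi2, hg0, add_zero, circleIntegral.integral_const_mul,
    circleIntegral.integral_sub_center_inv p hε0.ne']
  have : (Real.pi : ℂ) ≠ 0 := by exact_mod_cast Real.pi_ne_zero
  field_simp

/-! ### Laplace transforms -/

open FourierTransform in
/-- A function whose Laplace transform vanishes on a vertical line is zero. -/
theorem eq_zero_of_laplace_eq_zero {h : ℝ → ℂ} {σ : ℝ} (hc : ContinuousOn h (Ioi 0))
    (hi : IntegrableOn (fun t : ℝ => Complex.exp (-(σ * t)) * h t) (Ioi 0))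
    (hz : ∀ τ : ℝ, ∫ t in Ioi (0 : ℝ), Complex.exp (-((σ + τ * Complex.I) * t)) * h t = 0)
    {t : ℝ} (ht : 0 < t) : h t = 0 := by
  -- On the line Re s = σ the Laplace transform is the Fourier transform of this truncated function;
  -- Fourier inversion applies at its points of continuity.
  set f : ℝ → ℂ := (Ioi (0 : ℝ)).indicator fun t => Complex.exp (-(σ * t)) * h t with hf
  have hfi : Integrable f := (integrable_indicator_iff measurableSet_Ioi).2 hi
  have hF : 𝓕 f = 0 := by
    ext w
    rw [Real.fourier_real_eq_integral_exp_smul, Pi.zero_apply, ← hz (2 * Real.pi * w),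
      ← integral_indicator measurableSet_Ioi]
    congr 1
    ext v
    simp only [hf, indicator]
    split_ifs
    · rw [smul_eq_mul, ← mul_assoc, ← Complex.exp_add]
      congr 2
      push_cast; ring
    · simp
  have hcont : ContinuousAt f t := by
    have h1 : ContinuousAt (fun t : ℝ => Complex.exp (-(σ * t)) * h t) t :=
      (Continuous.continuousAt (by fun_prop)).mul (hc.continuousAt (Ioi_mem_nhds ht))
    refine h1.congr ?_
    filter_upwards [Ioi_mem_nhds ht] with v hv
    simp only [hf, indicator_of_mem hv]
  have hinv := hfi.fourierInv_fourier_eq (by rw [hF]; exact integrable_zero _ _ _) hcont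
  rw [hF] at hinv
  have h0 : f t = 0 := by
    rw [← hinv, Real.fourierInv_eq']
    simp
  simp only [hf, indicator_of_mem (show t ∈ Ioi (0 : ℝ) from ht)] at h0
  simpa [Complex.exp_ne_zero] using h0

theorem integrableOn_cexp_neg_mul {s : ℂ} (hs : 0 < s.re) :
    IntegrableOn (fun t : ℝ => Complex.exp (-(s * t))) (Ioi 0) := by
  have := integrableOn_exp_mul_complex_Ioi (a := -s) (by simpa using hs) 0
  simpa using this

theorem integral_cexp_neg_mul {s : ℂ} (hs : 0 < s.re) :
    ∫ t in Ioi (0 : ℝ), Complex.exp (-(s * t)) = 1 / s := by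
  have := integral_exp_mul_complex_Ioi (a := -s) (by simpa using hs) 0
  simpa using this

/-- Laplace transform of a superposition of oscillating exponentials. -/
theorem laplace_superposition {a : ℝ → ℂ} (ha : IntegrableOn a (Ioi 0)) (μ : ℝ) {s : ℂ}
    (hs : 0 < s.re) :
    ∫ t in Ioi (0 : ℝ), Complex.exp (-(s * t)) *
        ∫ y in Ioi (0 : ℝ), a y * Complex.exp (-Complex.I * μ * y * t) =
      ∫ y in Ioi (0 : ℝ), a y / (s + Complex.I * μ * y) := by
  have hint : Integrable (Function.uncurry fun (t y : ℝ) =>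
      Complex.exp (-(s * t)) * (a y * Complex.exp (-Complex.I * μ * y * t)))
      ((volume.restrict (Ioi 0)).prod (volume.restrict (Ioi 0))) := by
    have h1 := (integrableOn_cexp_neg_mul hs).mul_prod ha
    refine h1.mono ?_ (Eventually.of_forall fun q => ?_)
    · have h2 : AEStronglyMeasurable (fun q : ℝ × ℝ => Complex.exp (-Complex.I * μ * q.2 * q.1))
        ((volume.restrict (Ioi 0)).prod (volume.restrict (Ioi 0))) :=
          Continuous.aestronglyMeasurable (by fun_prop)
      refine (h1.aestronglyMeasurable.mul h2).congr (Eventually.of_forall fun q => ?_)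
      simp only [Function.uncurry, Pi.mul_apply]; ring
    · have : ‖Complex.exp (-Complex.I * μ * q.2 * q.1)‖ = 1 := by
        rw [show -Complex.I * μ * q.2 * q.1 = ((-(μ * q.2 * q.1) : ℝ) : ℂ) * Complex.I by
          push_cast; ring, Complex.norm_exp_ofReal_mul_I]
      simp only [Function.uncurry, norm_mul, this, mul_one, le_refl]
  calc _ = ∫ t in Ioi (0 : ℝ), ∫ y in Ioi (0 : ℝ),
        Complex.exp (-(s * t)) * (a y * Complex.exp (-Complex.I * μ * y * t)) := by
        simp_rw [integral_const_mul]
    _ = ∫ y in Ioi (0 : ℝ), ∫ t in Ioi (0 : ℝ),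
        Complex.exp (-(s * t)) * (a y * Complex.exp (-Complex.I * μ * y * t)) :=
        integral_integral_swap hint
    _ = _ := by
        refine integral_congr_ae (Eventually.of_forall fun y => ?_)
        have e : ∀ t : ℝ, Complex.exp (-(s * t)) * (a y * Complex.exp (-Complex.I * μ * y * t)) =
            a y * Complex.exp (-((s + Complex.I * μ * y) * t)) := fun t => by
          rw [mul_left_comm, ← Complex.exp_add]; congr 2; ring
        simp only [e]
        rw [integral_const_mul, integral_cexp_neg_mul (by simpa using hs), mul_one_div]

/-! ### Volterra equations -/

section Volterra

variable {N : ℕ} {β : ℝ → Fin N → ℂ} {k : Fin N → Fin N → ℝ → ℂ}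

theorem integral_exp_mul_real (σ x : ℝ) (hσ : 0 < σ) :
    ∫ τ in (0 : ℝ)..x, Real.exp (σ * τ) = (Real.exp (σ * x) - 1) / σ := by
  rw [intervalIntegral.integral_comp_mul_left _ hσ.ne', integral_exp]
  simp; field_simp

/-- Solutions of a linear Volterra integro-differential system with bounded kernel grow at most
exponentially. -/
theorem exists_exp_bound (hβ : ContinuousOn β (Ici 0)) {M : ℝ} (hM : 0 ≤ M)
    (hkb : ∀ j l t, 0 ≤ t → ‖k j l t‖ ≤ M)
    (hd : ∀ t : ℝ, 0 < t → ∀ j, HasDerivAt (fun s => β s j)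
      (-∑ l, ∫ τ in (0 : ℝ)..t, β τ l * k j l (t - τ)) t) :
    ∃ σ > 0, ∀ t : ℝ, 0 ≤ t → ‖β t‖ ≤ 2 * ‖β 0‖ * Real.exp (σ * t) := by
  set L : ℝ := N * M + 1 with hL
  have hLpos : 0 < L := by positivity
  -- In the sup norm weighted by e^{-σt}, the memory integral and the integration of β' each gain
  -- 1/σ. With σ² = 2L the total factor is L/σ² = 1/2, which is absorbed into the left side. The `+
  -- 1` in `L` keeps σ positive when N M = 0.
  set σ : ℝ := Real.sqrt (2 * L) with hσdef
  have hσ : 0 < σ := Real.sqrt_pos.2 (by linarith)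
  have hσ2 : σ ^ 2 = 2 * L := Real.sq_sqrt (by linarith)
  refine ⟨σ, hσ, fun T hT => ?_⟩
  obtain ⟨t0, ht0, hmax⟩ := (isCompact_Icc (a := (0 : ℝ)) (b := T)).exists_isMaxOn
    ⟨0, by simp [hT]⟩ (f := fun t => Real.exp (-(σ * t)) * ‖β t‖)
    ((Continuous.continuousOn (by fun_prop)).mul (hβ.mono Icc_subset_Ici_self).norm)
  set m := Real.exp (-(σ * t0)) * ‖β t0‖ with hm
  have hm0 : 0 ≤ m := by positivity
  have hle : ∀ t ∈ Icc 0 T, ‖β t‖ ≤ m * Real.exp (σ * t) := fun t ht => by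
    have : Real.exp (-(σ * t)) * ‖β t‖ ≤ m := hmax ht
    rw [Real.exp_neg, inv_mul_le_iff₀ (Real.exp_pos _)] at this
    linarith
  have hder : ∀ t : ℝ, 0 < t → HasDerivAt β
      (fun j => -∑ l, ∫ τ in (0 : ℝ)..t, β τ l * k j l (t - τ)) t := fun t ht =>
    hasDerivAt_pi.2 fun j => hd t ht j
  have hdb : ∀ t : ℝ, 0 < t → t ≤ T →
      ‖fun j => -∑ l, ∫ τ in (0 : ℝ)..t, β τ l * k j l (t - τ)‖ ≤
        L * m / σ ^ 2 * (Real.exp (σ * t) * σ) := by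
    intro t ht htT
    refine (pi_norm_le_iff_of_nonneg (by positivity)).2 fun j => ?_
    rw [norm_neg]
    have h1 : ∀ l, ‖∫ τ in (0 : ℝ)..t, β τ l * k j l (t - τ)‖ ≤ M * m * (Real.exp (σ * t) / σ) := by
      intro l
      have := intervalIntegral.norm_integral_le_of_norm_le (f := fun τ => β τ l * k j l (t - τ))
        (g := fun τ => M * m * Real.exp (σ * τ)) (μ := volume) ht.le (Eventually.of_forall ?_)
        (Continuous.intervalIntegrable (by fun_prop) _ _)
      · refine this.trans ?_
        rw [intervalIntegral.integral_const_mul, integral_exp_mul_real σ t hσ]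
        gcongr
        linarith
      · intro τ hτ
        rw [norm_mul]
        have a1 : ‖β τ l‖ ≤ m * Real.exp (σ * τ) :=
          (norm_le_pi_norm _ _).trans (hle τ ⟨hτ.1.le, hτ.2.trans htT⟩)
        have a2 := hkb j l (t - τ) (by linarith [hτ.2])
        calc _ ≤ (m * Real.exp (σ * τ)) * M := by gcongr
          _ = _ := by ring
    refine (norm_sum_le _ _).trans ((Finset.sum_le_sum fun l _ => h1 l).trans ?_)
    rw [Finset.sum_const, Finset.card_univ, Fintype.card_fin, nsmul_eq_mul]
    have e : L * m / σ ^ 2 * (Real.exp (σ * t) * σ) = (L * m) * (Real.exp (σ * t) / σ) := by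
      field_simp
    rw [e, ← mul_assoc, ← mul_assoc]
    gcongr
    linarith
  -- The equation holds only for t > 0, so the mean value inequality starts at ε; continuity at 0
  -- then gives `hfin`.
  have hstep : ∀ ε : ℝ, 0 < ε → ε ≤ t0 → ‖β t0 - β ε‖ ≤ L * m / σ ^ 2 * Real.exp (σ * t0) := by
    intro ε hε hεt
    refine image_norm_le_of_norm_deriv_right_le_deriv_boundary (f := fun t => β t - β ε)
      (f' := fun t j => -∑ l, ∫ τ in (0 : ℝ)..t, β τ l * k j l (t - τ))
      (B := fun t => L * m / σ ^ 2 * Real.exp (σ * t))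
      (B' := fun t => L * m / σ ^ 2 * (Real.exp (σ * t) * σ))
      (a := ε) (b := t0) ?_ ?_ ?_ ?_ ?_ (right_mem_Icc.2 hεt)
    · exact (hβ.mono fun t ht => hε.le.trans ht.1).sub continuousOn_const
    · intro t ht
      exact ((hder t (hε.trans_le ht.1)).sub_const _).hasDerivWithinAt
    · simp only [sub_self, norm_zero]; positivity
    · intro t
      have : HasDerivAt (fun t => Real.exp (σ * t)) (Real.exp (σ * t) * σ) t := by
        simpa using ((hasDerivAt_id t).const_mul σ).exp
      exact this.const_mul _
    · intro t ht
      exact hdb t (hε.trans_le ht.1) (ht.2.le.trans ht0.2)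
  have hfin : ‖β t0 - β 0‖ ≤ L * m / σ ^ 2 * Real.exp (σ * t0) := by
    rcases ht0.1.eq_or_lt with h | h
    · rw [← h, sub_self, norm_zero]; positivity
    · have hc0 : Tendsto β (𝓝[>] 0) (𝓝 (β 0)) :=
        (hβ 0 (by simp)).mono Ioi_subset_Ici_self
      refine le_of_tendsto ((tendsto_const_nhds (x := β t0)).sub hc0).norm ?_
      filter_upwards [Ioc_mem_nhdsGT h] with ε hε using hstep ε hε.1 hε.2
  have hm2 : m ≤ 2 * ‖β 0‖ := by
    have h1 : ‖β t0‖ ≤ ‖β 0‖ + L * m / σ ^ 2 * Real.exp (σ * t0) := by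
      have := norm_le_norm_add_norm_sub' (β t0) (β 0)
      linarith
    have h2 : L * m / σ ^ 2 = m / 2 := by rw [hσ2]; field_simp
    rw [h2] at h1
    have h3 : ‖β t0‖ = m * Real.exp (σ * t0) := by
      rw [hm, mul_right_comm, ← Real.exp_add]; simp
    have h4 : 1 ≤ Real.exp (σ * t0) := Real.one_le_exp (mul_nonneg hσ.le ht0.1)
    have h5 : m / 2 * Real.exp (σ * t0) ≤ ‖β 0‖ := by linarith
    nlinarith
  exact (hle T ⟨hT, le_rfl⟩).trans (by gcongr)

theorem norm_cexp_neg_mul (s : ℂ) (t : ℝ) : ‖Complex.exp (-(s * t))‖ = Real.exp (-(s.re * t)) := by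
  rw [Complex.norm_exp]; simp

theorem integrableOn_laplace {f : ℝ → ℂ} (hf : ContinuousOn f (Ici 0)) {C σ : ℝ}
    (hb : ∀ t : ℝ, 0 ≤ t → ‖f t‖ ≤ C * Real.exp (σ * t)) {s : ℂ} (hs : σ < s.re) :
    IntegrableOn (fun t : ℝ => Complex.exp (-(s * t)) * f t) (Ioi 0) := by
  have h1 := (exp_neg_integrableOn_Ioi 0 (sub_pos.2 hs)).const_mul C
  refine Integrable.mono' h1 ?_ ((ae_restrict_mem measurableSet_Ioi).mono fun t ht => ?_)
  · exact ContinuousOn.aestronglyMeasurable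
      ((Continuous.continuousOn (by fun_prop)).mul (hf.mono Ioi_subset_Ici_self)) measurableSet_Ioi
  · rw [norm_mul, norm_cexp_neg_mul]
    calc _ ≤ Real.exp (-(s.re * t)) * (C * Real.exp (σ * t)) := by
          gcongr; exact hb t (le_of_lt ht)
      _ = _ := by
          rw [mul_left_comm, ← Real.exp_add]; ring_nf

theorem tendsto_laplace_zero {f : ℝ → ℂ} {C σ : ℝ}
    (hb : ∀ t : ℝ, 0 ≤ t → ‖f t‖ ≤ C * Real.exp (σ * t)) {s : ℂ} (hs : σ < s.re) :
    Tendsto (fun t : ℝ => Complex.exp (-(s * t)) * f t) atTop (𝓝 0) := by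
  have hlim : Tendsto (fun t : ℝ => C * Real.exp (-((s.re - σ) * t))) atTop (𝓝 0) := by
    have := (Real.tendsto_exp_neg_atTop_nhds_zero.comp
      (tendsto_id.const_mul_atTop (sub_pos.2 hs))).const_mul C
    simpa using this
  refine squeeze_zero_norm' ?_ hlim
  filter_upwards [eventually_ge_atTop 0] with t ht
  rw [norm_mul, norm_cexp_neg_mul]
  calc _ ≤ Real.exp (-(s.re * t)) * (C * Real.exp (σ * t)) := by
        gcongr; exact hb t ht
    _ = _ := by
        rw [mul_left_comm, ← Real.exp_add]; ring_nf

/-- Since e^{-st} = e^{-sτ} e^{-s(t-τ)}, the damped memory term is a convolution of integrable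
functions and its integral factors. The rest is integration of the derivative of e^{-st} β_j(t),
whose limit at infinity is zero. -/
theorem laplace_volterra (hβ : ContinuousOn β (Ici 0)) {M : ℝ}
    (hkc : ∀ j l, ContinuousOn (k j l) (Ici 0)) (hkb : ∀ j l t, 0 ≤ t → ‖k j l t‖ ≤ M)
    (hd : ∀ t : ℝ, 0 < t → ∀ j, HasDerivAt (fun s => β s j)
      (-∑ l, ∫ τ in (0 : ℝ)..t, β τ l * k j l (t - τ)) t)
    {C σ : ℝ} (hσ : 0 < σ) (hb : ∀ t : ℝ, 0 ≤ t → ‖β t‖ ≤ C * Real.exp (σ * t))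
    {s : ℂ} (hs : σ < s.re) (j : Fin N) :
    s * (∫ t in Ioi (0 : ℝ), Complex.exp (-(s * t)) * β t j) +
      ∑ l, (∫ t in Ioi (0 : ℝ), Complex.exp (-(s * t)) * β t l) *
        (∫ t in Ioi (0 : ℝ), Complex.exp (-(s * t)) * k j l t) = β 0 j := by
  have hβc : ∀ l, ContinuousOn (fun t => β t l) (Ici 0) := fun l => continuousOn_pi.1 hβ l
  have hβb : ∀ l, ∀ t : ℝ, 0 ≤ t → ‖β t l‖ ≤ C * Real.exp (σ * t) := fun l t ht =>
    (norm_le_pi_norm _ _).trans (hb t ht)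
  have hβi := fun l => integrableOn_laplace (hβc l) (hβb l) hs
  have hki : ∀ l, IntegrableOn (fun t : ℝ => Complex.exp (-(s * t)) * k j l t) (Ioi 0) := fun l =>
    integrableOn_laplace (hkc j l) (C := M) (σ := 0) (fun t ht => by simpa using hkb j l t ht)
      (hσ.trans hs)
  have hconv : ∀ t : ℝ, ∀ l, ∫ τ in (0 : ℝ)..t, ContinuousLinearMap.mul ℝ ℂ
      (Complex.exp (-(s * τ)) * β τ l) (Complex.exp (-(s * ((t - τ : ℝ) : ℂ))) * k j l (t - τ)) =
      Complex.exp (-(s * t)) * ∫ τ in (0 : ℝ)..t, β τ l * k j l (t - τ) := by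
    intro t l
    rw [← intervalIntegral.integral_const_mul]
    congr 1; ext τ
    have : Complex.exp (-(s * t)) =
        Complex.exp (-(s * τ)) * Complex.exp (-(s * ((t - τ : ℝ) : ℂ))) := by
      rw [← Complex.exp_add]; congr 1; push_cast; ring
    rw [this, ContinuousLinearMap.mul_apply']; ring
  have hcv : ∀ l, ∫ t in Ioi (0 : ℝ), Complex.exp (-(s * t)) *
      ∫ τ in (0 : ℝ)..t, β τ l * k j l (t - τ) =
      (∫ t in Ioi (0 : ℝ), Complex.exp (-(s * t)) * β t l) *
        (∫ t in Ioi (0 : ℝ), Complex.exp (-(s * t)) * k j l t) := fun l =>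
    (integral_congr_ae (Eventually.of_forall fun t => (hconv t l).symm)).trans
      (integral_posConvolution (hβi l) (hki l) (ContinuousLinearMap.mul ℝ ℂ))
  have hci : ∀ l, IntegrableOn (fun t : ℝ => Complex.exp (-(s * t)) *
      ∫ τ in (0 : ℝ)..t, β τ l * k j l (t - τ)) (Ioi 0) := fun l => by
    have := integrable_posConvolution (hβi l) (hki l) (ContinuousLinearMap.mul ℝ ℂ)
    rw [posConvolution, integrable_indicator_iff measurableSet_Ioi] at this
    simpa only [hconv] using this
  have hcs : IntegrableOn (fun t : ℝ => ∑ l, Complex.exp (-(s * t)) *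
      ∫ τ in (0 : ℝ)..t, β τ l * k j l (t - τ)) (Ioi 0) :=
    integrable_finsetSum _ fun l _ => hci l
  have hder : ∀ t ∈ Ioi (0 : ℝ), HasDerivAt (fun t : ℝ => Complex.exp (-(s * t)) * β t j)
      (-(s * (Complex.exp (-(s * t)) * β t j)) - ∑ l, Complex.exp (-(s * t)) *
        ∫ τ in (0 : ℝ)..t, β τ l * k j l (t - τ)) t := by
    intro t ht
    have h1 : HasDerivAt (fun t : ℝ => Complex.exp (-(s * t))) (Complex.exp (-(s * t)) * -s) t := by
      have := ((Complex.ofRealCLM.hasDerivAt (x := t)).const_mul s).neg.cexp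
      simpa using this
    refine (h1.mul (hd t ht j)).congr_deriv ?_
    rw [← Finset.mul_sum]; ring
  have hsi : IntegrableOn (fun t : ℝ => -(s * (Complex.exp (-(s * t)) * β t j))) (Ioi 0) :=
    ((hβi j).const_mul s).neg
  have key := integral_Ioi_of_hasDerivAt_of_tendsto (a := (0 : ℝ)) ?_ hder (hsi.sub hcs)
    (tendsto_laplace_zero (hβb j) hs)
  · rw [integral_sub hsi hcs, integral_neg, integral_const_mul,
      integral_finsetSum _ fun l _ => hci l] at key
    simp only [hcv] at key
    simp only [Complex.ofReal_zero, mul_zero, neg_zero, Complex.exp_zero, one_mul, zero_sub] at key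
    linear_combination -key
  · exact ((Continuous.continuousOn (by fun_prop)).mul (hβc j)) 0 (by simp)

end Volterra

/-! ### The matrix-valued Herglotz function -/

theorem SectorDecay.const_mul {φ : ℂ → ℂ} {K : ℝ} (h : SectorDecay φ K) (a : ℂ) :
    SectorDecay (fun k => a * φ k) (‖a‖ * K) :=
  ⟨mul_nonneg (norm_nonneg _) h.nonneg, h.diff.const_mul a, fun k h1 h2 => by
    rw [norm_mul, mul_assoc]
    exact mul_le_mul_of_nonneg_left (h.bound k h1 h2) (norm_nonneg _)⟩

theorem SectorDecay.sum {ι : Type*} (s : Finset ι) {φ : ι → ℂ → ℂ} {K : ι → ℝ}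
    (h : ∀ i, SectorDecay (φ i) (K i)) : SectorDecay (fun k => ∑ i ∈ s, φ i k) (∑ i ∈ s, K i) :=
  ⟨Finset.sum_nonneg fun i _ => (h i).nonneg, Differentiable.fun_sum fun i _ => (h i).diff,
    fun k h1 h2 => by
      rw [Finset.sum_mul]
      exact (norm_sum_le _ _).trans (Finset.sum_le_sum fun i _ => (h i).bound k h1 h2)⟩

/-- Analytic matrix weights: real symmetric positive definite on the positive half-line. -/
structure AdmissibleWeight {N : ℕ} (W : ℂ → Matrix (Fin N) (Fin N) ℂ) (K : ℝ) : Prop where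
  decay : ∀ j l, SectorDecay (fun k => W k j l) K
  real : ∀ j l (k : ℝ), 0 < k → (starRingEnd ℂ) (W k j l) = W k j l
  symm : ∀ j l k, W k j l = W k l j
  pos : ∀ k : ℝ, 0 < k → ∀ v : Fin N → ℂ, v ≠ 0 → 0 < (star v ⬝ᵥ (W k).mulVec v).re

section Herglotz

variable {N : ℕ} {W : ℂ → Matrix (Fin N) (Fin N) ℂ} {K c Ω : ℝ}

/-- `S(z) = ∫₀^∞ W(k) / (ck - z) dk`. -/
noncomputable def selfEnergy (c : ℝ) (W : ℂ → Matrix (Fin N) (Fin N) ℂ) (z : ℂ) :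
    Matrix (Fin N) (Fin N) ℂ := Matrix.of fun j l => stieltjes c (fun k => W k j l) z

/-- `F(z) = Ω - z - S(z)`. -/
noncomputable def herglotz (c Ω : ℝ) (W : ℂ → Matrix (Fin N) (Fin N) ℂ) (z : ℂ) :
    Matrix (Fin N) (Fin N) ℂ := ((Ω : ℂ) - z) • (1 : Matrix (Fin N) (Fin N) ℂ) - selfEnergy c W z

/-- The boundary values of `F` from the upper half-plane. -/
noncomputable def herglotzUp (c Ω : ℝ) (W : ℂ → Matrix (Fin N) (Fin N) ℂ) (x : ℝ) :
    Matrix (Fin N) (Fin N) ℂ := ((Ω : ℂ) - x) • (1 : Matrix (Fin N) (Fin N) ℂ) -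
      Matrix.of fun j l => rotated c (fun k => W k j l) x

theorem dotProduct_mulVec_eq_sum (A : Matrix (Fin N) (Fin N) ℂ) (u v : Fin N → ℂ) :
    star u ⬝ᵥ A.mulVec v = ∑ j, ∑ l, (star (u j) * v l) * A j l := by
  simp only [dotProduct, Matrix.mulVec, Pi.star_apply, Finset.mul_sum]
  refine Finset.sum_congr rfl fun j _ => Finset.sum_congr rfl fun l _ => by ring

theorem AdmissibleWeight.form_decay (h : AdmissibleWeight W K) (u v : Fin N → ℂ) :
    ∃ K', SectorDecay (fun k => star u ⬝ᵥ (W k).mulVec v) K' := by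
  simp only [dotProduct_mulVec_eq_sum]
  exact ⟨_, SectorDecay.sum _ fun j => SectorDecay.sum _ fun l => (h.decay j l).const_mul _⟩

theorem form_selfEnergy (u v : Fin N → ℂ) {z : ℂ}
    (hi : ∀ j l, IntegrableOn (fun k : ℝ => W k j l / (c * k - z)) (Ioi 0)) :
    star u ⬝ᵥ (selfEnergy c W z).mulVec v =
      stieltjes c (fun k => star u ⬝ᵥ (W k).mulVec v) z := by
  simp only [dotProduct_mulVec_eq_sum, selfEnergy, Matrix.of_apply, stieltjes]
  simp_rw [Finset.sum_div, mul_div_assoc]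
  rw [integral_finsetSum]
  · refine Finset.sum_congr rfl fun j _ => ?_
    rw [integral_finsetSum]
    · exact Finset.sum_congr rfl fun l _ => (integral_const_mul _ _).symm
    · exact fun l _ => (hi j l).const_mul _
  · exact fun j _ => integrable_finsetSum _ fun l _ => (hi j l).const_mul _

theorem AdmissibleWeight.form_selfEnergy_of_slit (h : AdmissibleWeight W K) (hc : 0 < c)
    (u v : Fin N → ℂ) {z : ℂ} (hz : -z ∈ Complex.slitPlane) :
    star u ⬝ᵥ (selfEnergy c W z).mulVec v =
      stieltjes c (fun k => star u ⬝ᵥ (W k).mulVec v) z :=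
  form_selfEnergy u v fun j l => (h.decay j l).integrableOn_div_of_slit hc hz

theorem AdmissibleWeight.form_im (h : AdmissibleWeight W K) (v : Fin N → ℂ) {k : ℝ} (hk : 0 < k) :
    (star v ⬝ᵥ (W k).mulVec v).im = 0 := by
  rw [← Complex.conj_eq_iff_im, dotProduct_mulVec_eq_sum]
  simp only [map_sum, map_mul, h.real _ _ _ hk]
  rw [Finset.sum_comm]
  refine Finset.sum_congr rfl fun j _ => Finset.sum_congr rfl fun l _ => ?_
  rw [h.symm l j]
  simp only [Complex.star_def, Complex.conj_conj]; ring

theorem AdmissibleWeight.form_nonneg (h : AdmissibleWeight W K) (v : Fin N → ℂ) {k : ℝ}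
    (hk : 0 < k) : 0 ≤ (star v ⬝ᵥ (W k).mulVec v).re := by
  by_cases hv : v = 0
  · simp [hv]
  · exact (h.pos k hk v hv).le

theorem star_dotProduct_self (v : Fin N → ℂ) : star v ⬝ᵥ v = ((∑ j, ‖v j‖ ^ 2 : ℝ) : ℂ) := by
  simp only [dotProduct, Pi.star_apply, Complex.ofReal_sum]
  refine Finset.sum_congr rfl fun j _ => ?_
  rw [Complex.star_def, Complex.conj_mul']; push_cast; rfl

theorem form_herglotz (u v : Fin N → ℂ) (z : ℂ) : star u ⬝ᵥ (herglotz c Ω W z).mulVec v =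
    (Ω - z) * (star u ⬝ᵥ v) - star u ⬝ᵥ (selfEnergy c W z).mulVec v := by
  rw [herglotz, Matrix.sub_mulVec, Matrix.smul_mulVec, Matrix.one_mulVec, dotProduct_sub,
    dotProduct_smul, smul_eq_mul]

/-- The matrix -F is a Herglotz function: the self-energy only strengthens the bound, because its
form is the Stieltjes transform of a nonnegative weight. -/
theorem AdmissibleWeight.im_form_herglotz_le (h : AdmissibleWeight W K) (hc : 0 < c)
    (v : Fin N → ℂ) {z : ℂ} (hz : 0 < z.im) :
    (star v ⬝ᵥ (herglotz c Ω W z).mulVec v).im ≤ -(z.im * ∑ j, ‖v j‖ ^ 2) := by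
  obtain ⟨K', hK'⟩ := h.form_decay v v
  have h1 := hK'.im_stieltjes_nonneg hc hz (fun k hk => h.form_im v hk)
    (fun k hk => h.form_nonneg v hk)
  rw [form_herglotz, h.form_selfEnergy_of_slit hc v v (neg_mem_slitPlane_of_im_pos hz),
    star_dotProduct_self, Complex.sub_im, Complex.im_mul_ofReal]
  simp only [Complex.sub_im, Complex.ofReal_im, zero_sub, neg_mul]
  linarith

theorem sum_sq_pos {v : Fin N → ℂ} (hv : v ≠ 0) : 0 < ∑ j, ‖v j‖ ^ 2 := by
  obtain ⟨j, hj⟩ := Function.ne_iff.1 hv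
  exact Finset.sum_pos' (fun i _ => by positivity)
    ⟨j, Finset.mem_univ _, pow_pos (norm_pos_iff.2 hj) 2⟩

theorem AdmissibleWeight.det_herglotz_ne_zero_upper (h : AdmissibleWeight W K) (hc : 0 < c)
    {z : ℂ} (hz : 0 < z.im) : (herglotz c Ω W z).det ≠ 0 := by
  intro hdet
  obtain ⟨v, hv, hv0⟩ := Matrix.exists_mulVec_eq_zero_iff.2 hdet
  have := h.im_form_herglotz_le (Ω := Ω) hc v hz
  rw [hv0, dotProduct_zero, Complex.zero_im] at this
  nlinarith [mul_pos hz (sum_sq_pos hv)]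

theorem AdmissibleWeight.herglotz_conj (h : AdmissibleWeight W K) (z : ℂ) :
    herglotz c Ω W ((starRingEnd ℂ) z) = (herglotz c Ω W z).conjTranspose := by
  ext j l
  have e : stieltjes c (fun k => W k j l) ((starRingEnd ℂ) z) =
      (starRingEnd ℂ) (stieltjes c (fun k => W k l j) z) := by
    rw [stieltjes_conj (h.real j l)]
    simp only [h.symm j l]
  simp only [herglotz, selfEnergy, Matrix.sub_apply, Matrix.smul_apply, Matrix.of_apply,
    Matrix.conjTranspose_apply, e, smul_eq_mul, star_sub, star_mul', Complex.star_def,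
    Complex.conj_ofReal, Matrix.one_apply]
  by_cases hjl : j = l
  · simp [hjl]
  · simp [hjl, Ne.symm hjl]

theorem AdmissibleWeight.det_herglotz_ne_zero (h : AdmissibleWeight W K) (hc : 0 < c)
    {z : ℂ} (hz : z.im ≠ 0) : (herglotz c Ω W z).det ≠ 0 := by
  rcases hz.lt_or_gt with hneg | hpos
  · have := h.det_herglotz_ne_zero_upper (Ω := Ω) hc (z := (starRingEnd ℂ) z) (by simpa using hneg)
    rw [h.herglotz_conj, Matrix.det_conjTranspose] at this
    simpa using this
  · exact h.det_herglotz_ne_zero_upper hc hpos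

theorem AdmissibleWeight.inv_herglotz_conj (h : AdmissibleWeight W K) (z : ℂ) (j l : Fin N) :
    (herglotz c Ω W ((starRingEnd ℂ) z))⁻¹ j l =
      (starRingEnd ℂ) ((herglotz c Ω W z)⁻¹ l j) := by
  rw [h.herglotz_conj, ← Matrix.conjTranspose_nonsing_inv]
  rfl

theorem mulVec_inv_col {A : Matrix (Fin N) (Fin N) ℂ} (hA : A.det ≠ 0) (l : Fin N) :
    A.mulVec (fun j => A⁻¹ j l) = Pi.single l 1 := by
  have h1 : A * A⁻¹ = 1 := Matrix.mul_nonsing_inv A (isUnit_iff_ne_zero.2 hA)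
  ext i
  have := congrFun (congrFun h1 i) l
  rw [Matrix.mul_apply] at this
  rw [Matrix.mulVec, dotProduct, this, Matrix.one_apply, Pi.single_apply]

/-- For a column u of the inverse, F u = e_l, and the form bound reads Im z ‖u‖² ≤ |u_l| in the
Euclidean norm. This first gives Im z |u_l| ≤ 1, then (Im z |u_j|)² ≤ 1. -/
theorem AdmissibleWeight.norm_inv_herglotz_le_upper (h : AdmissibleWeight W K) (hc : 0 < c)
    {z : ℂ} (hz : 0 < z.im) (j l : Fin N) : ‖(herglotz c Ω W z)⁻¹ j l‖ ≤ 1 / z.im := by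
  set u : Fin N → ℂ := fun j => (herglotz c Ω W z)⁻¹ j l
  have hu : (herglotz c Ω W z).mulVec u = Pi.single l 1 :=
    mulVec_inv_col (h.det_herglotz_ne_zero_upper hc hz) l
  have h1 := h.im_form_herglotz_le (Ω := Ω) hc u hz
  rw [hu] at h1
  have h2 : (star u ⬝ᵥ Pi.single l (1 : ℂ)).im = -(u l).im := by simp
  rw [h2] at h1
  have h3 : z.im * ∑ j, ‖u j‖ ^ 2 ≤ ‖u l‖ := by
    have := (le_abs_self _).trans (Complex.abs_im_le_norm (u l)); linarith
  have h4 : ∀ i, ‖u i‖ ^ 2 ≤ ∑ j, ‖u j‖ ^ 2 := fun i =>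
    Finset.single_le_sum (f := fun i => ‖u i‖ ^ 2) (fun i _ => by positivity) (Finset.mem_univ i)
  have h5 : ∀ i, z.im * ‖u i‖ ^ 2 ≤ ‖u l‖ := fun i =>
    (mul_le_mul_of_nonneg_left (h4 i) hz.le).trans h3
  have h6 : z.im * ‖u l‖ ≤ 1 := by
    rcases (norm_nonneg (u l)).eq_or_lt with h0 | h0
    · rw [← h0]; simp
    · have := h5 l
      rw [pow_two, ← mul_assoc] at this
      exact le_of_mul_le_mul_right (by linarith) h0
  rw [le_div_iff₀ hz]
  have h7 : (‖u j‖ * z.im) ^ 2 ≤ 1 := by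
    have := h5 j
    nlinarith
  exact (sq_le_one_iff₀ (by positivity)).1 h7

theorem AdmissibleWeight.norm_inv_herglotz_le (h : AdmissibleWeight W K) (hc : 0 < c)
    {z : ℂ} (hz : z.im ≠ 0) (j l : Fin N) : ‖(herglotz c Ω W z)⁻¹ j l‖ ≤ 1 / |z.im| := by
  rcases hz.lt_or_gt with hneg | hpos
  · have := h.norm_inv_herglotz_le_upper (Ω := Ω) hc (z := (starRingEnd ℂ) z)
      (by simpa using hneg) l j
    rw [h.inv_herglotz_conj, Complex.norm_conj, Complex.conj_im] at this
    rwa [abs_of_neg hneg]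
  · rw [abs_of_pos hpos]; exact h.norm_inv_herglotz_le_upper hc hpos j l

/-! Behaviour at infinity and at the boundary -/

/-- The equation w u = e_l + A u gives ‖w‖ ‖u‖ ≤ 1 + N B ‖u‖ in the sup norm, and N B ‖u‖ is at most
half of the left side. -/
theorem norm_inv_le_of_entries_le {A : Matrix (Fin N) (Fin N) ℂ} {w : ℂ} {B : ℝ}
    (hB : ∀ j l, ‖A j l‖ ≤ B) (hw : 2 * (N * B) + 1 ≤ ‖w‖)
    (hdet : (w • (1 : Matrix (Fin N) (Fin N) ℂ) - A).det ≠ 0) (j l : Fin N) :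
    ‖(w • (1 : Matrix (Fin N) (Fin N) ℂ) - A)⁻¹ j l‖ ≤ 2 / ‖w‖ := by
  set u : Fin N → ℂ := fun j => (w • (1 : Matrix (Fin N) (Fin N) ℂ) - A)⁻¹ j l
  have hu := mulVec_inv_col hdet l
  change (w • (1 : Matrix (Fin N) (Fin N) ℂ) - A).mulVec u = _ at hu
  rw [Matrix.sub_mulVec, Matrix.smul_mulVec, Matrix.one_mulVec] at hu
  have hB0 : 0 ≤ B := (norm_nonneg _).trans (hB j l)
  have hwpos : 0 < ‖w‖ := by have : (0 : ℝ) ≤ N * B := by positivity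
                             linarith
  have h1 : ∀ i, ‖w‖ * ‖u i‖ ≤ 1 + N * B * ‖u‖ := by
    intro i
    have h2 := congrFun hu i
    simp only [Pi.sub_apply, Pi.smul_apply, smul_eq_mul] at h2
    rw [← norm_mul, sub_eq_iff_eq_add.1 h2]
    refine (norm_add_le _ _).trans (add_le_add ?_ ?_)
    · rw [Pi.single_apply]; split_ifs <;> simp
    · rw [Matrix.mulVec, dotProduct]
      refine (norm_sum_le _ _).trans ?_
      calc ∑ m, ‖A i m * u m‖ ≤ ∑ _m : Fin N, B * ‖u‖ := by
            refine Finset.sum_le_sum fun m _ => ?_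
            rw [norm_mul]
            exact mul_le_mul (hB i m) (norm_le_pi_norm u m) (norm_nonneg _) hB0
        _ = N * B * ‖u‖ := by simp [mul_assoc]
  have h3 : ‖u‖ ≤ (1 + N * B * ‖u‖) / ‖w‖ :=
    (pi_norm_le_iff_of_nonneg (by positivity)).2 fun i => by
      rw [le_div_iff₀ hwpos, mul_comm]; exact h1 i
  rw [le_div_iff₀ hwpos] at h3
  have h4 : ‖u‖ ≤ 2 / ‖w‖ := by
    rw [le_div_iff₀ hwpos]
    have := mul_le_mul_of_nonneg_right hw (norm_nonneg u)
    nlinarith [norm_nonneg u]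
  exact (norm_le_pi_norm u j).trans h4

/-- The self-energy is bounded on the whole upper half-plane, so Ω - z dominates for large |z|, up
to the real line. -/
theorem AdmissibleWeight.exists_norm_inv_le (h : AdmissibleWeight W K) (hc : 0 < c) :
    ∃ ρ > 0, ∀ z : ℂ, 0 < z.im → ρ ≤ ‖z‖ → ∀ j l, ‖(herglotz c Ω W z)⁻¹ j l‖ ≤ 4 / ‖z‖ := by
  choose B hB using fun j l => (h.decay j l).exists_norm_stieltjes_le hc
  set B' : ℝ := ∑ j, ∑ l, |B j l| with hB'
  have hle : ∀ j l, B j l ≤ B' := fun j l =>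
    (le_abs_self _).trans ((Finset.single_le_sum (f := fun l => |B j l|)
      (fun _ _ => abs_nonneg _) (Finset.mem_univ l)).trans
      (Finset.single_le_sum (f := fun j => ∑ l, |B j l|)
        (fun _ _ => Finset.sum_nonneg fun _ _ => abs_nonneg _) (Finset.mem_univ j)))
  have hB'0 : 0 ≤ B' := Finset.sum_nonneg fun _ _ => Finset.sum_nonneg fun _ _ => abs_nonneg _
  refine ⟨2 * (2 * (N * B') + 1) + 2 * |Ω|, by positivity, fun z hz hρ j l => ?_⟩
  have hNB : (0 : ℝ) ≤ N * B' := by positivity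
  have h1 : ‖z‖ / 2 ≤ ‖(Ω : ℂ) - z‖ := by
    have := norm_sub_norm_le z (Ω : ℂ)
    rw [Complex.norm_real, Real.norm_eq_abs] at this
    rw [norm_sub_rev]
    linarith
  have hz0 : 0 < ‖z‖ := by linarith [abs_nonneg Ω]
  have := norm_inv_le_of_entries_le (A := selfEnergy c W z) (w := (Ω : ℂ) - z) (B := B')
    (fun j l => (hB j l z hz).trans (hle j l)) (by linarith [abs_nonneg Ω])
    (h.det_herglotz_ne_zero_upper hc hz) j l
  refine this.trans ?_
  calc 2 / ‖(Ω : ℂ) - z‖ ≤ 2 / (‖z‖ / 2) := by gcongr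
    _ = 4 / ‖z‖ := by field_simp; norm_num

theorem AdmissibleWeight.tendsto_herglotz_upper (h : AdmissibleWeight W K) (hc : 0 < c) (x : ℝ) :
    Tendsto (herglotz c Ω W) (𝓝[{z : ℂ | 0 < z.im}] x) (𝓝 (herglotzUp c Ω W x)) := by
  refine tendsto_pi_nhds.2 fun j => tendsto_pi_nhds.2 fun l => ?_
  simp only [herglotz, herglotzUp, selfEnergy, Matrix.sub_apply, Matrix.smul_apply, Matrix.of_apply]
  refine Tendsto.sub (Tendsto.smul_const ?_ _) ((h.decay j l).tendsto_stieltjes_upper hc x)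
  exact tendsto_const_nhds.sub (tendsto_id.mono_left nhdsWithin_le_nhds)

theorem tendsto_inv_matrix {α : Type*} {f : Filter α} {A : α → Matrix (Fin N) (Fin N) ℂ}
    {B : Matrix (Fin N) (Fin N) ℂ} (hA : Tendsto A f (𝓝 B)) (hB : B.det ≠ 0) (j l : Fin N) :
    Tendsto (fun x => (A x)⁻¹ j l) f (𝓝 (B⁻¹ j l)) := by
  simp only [Matrix.inv_def, Matrix.smul_apply, smul_eq_mul, Ring.inverse_eq_inv']
  have h1 : Continuous fun M : Matrix (Fin N) (Fin N) ℂ => M.det := continuous_id.matrix_det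
  have h2 : Continuous fun M : Matrix (Fin N) (Fin N) ℂ => M.adjugate j l :=
    (continuous_id.matrix_adjugate).matrix_elem j l
  exact (((h1.tendsto B).comp hA).inv₀ hB).mul ((h2.tendsto B).comp hA)

/-- On a null vector v of the boundary matrix the imaginary part of the form of F(x + iε) would tend
to 0. By `im_stieltjes_ge` it stays below -m/(2c), where m > 0 is the minimum of the weight's form
on an interval containing [x/c, (x + ε)/c] for all ε < 1. -/
theorem AdmissibleWeight.det_herglotzUp_ne_zero (h : AdmissibleWeight W K) (hc : 0 < c) {x : ℝ}
    (hx : 0 < x) : (herglotzUp c Ω W x).det ≠ 0 := by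
  intro hdet
  obtain ⟨v, hv, hv0⟩ := Matrix.exists_mulVec_eq_zero_iff.2 hdet
  obtain ⟨K', hK'⟩ := h.form_decay v v
  have hcont : Continuous fun k : ℝ => (star v ⬝ᵥ (W k).mulVec v).re :=
    Complex.continuous_re.comp hK'.continuous_real
  have hle : x / c ≤ (x + 1) / c := by gcongr; linarith
  obtain ⟨k0, hk0, hmin⟩ := (isCompact_Icc (a := x / c) (b := (x + 1) / c)).exists_isMinOn
    ⟨_, left_mem_Icc.2 hle⟩ hcont.continuousOn
  have hk0pos : 0 < k0 := lt_of_lt_of_le (by positivity) hk0.1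
  set m := (star v ⬝ᵥ (W k0).mulVec v).re with hm
  have hmpos : 0 < m := h.pos k0 hk0pos v hv
  have hlim : Tendsto (fun ε : ℝ => (star v ⬝ᵥ
      (herglotz c Ω W (x + ε * Complex.I)).mulVec v).im) (𝓝[>] 0) (𝓝 0) := by
    have h1 := (h.tendsto_herglotz_upper (Ω := Ω) hc x).comp (tendsto_add_mul_I_upper x)
    have h2 : Continuous fun M : Matrix (Fin N) (Fin N) ℂ => (star v ⬝ᵥ M.mulVec v).im :=
      Complex.continuous_im.comp (by fun_prop)
    have h3 := (h2.tendsto _).comp h1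
    rw [hv0, dotProduct_zero, Complex.zero_im] at h3
    exact h3
  have hub : ∀ᶠ ε : ℝ in 𝓝[>] 0, (star v ⬝ᵥ
      (herglotz c Ω W (x + ε * Complex.I)).mulVec v).im ≤ -(m / (2 * c)) := by
    filter_upwards [Ioo_mem_nhdsGT one_pos] with ε hε
    have h1 := hK'.im_stieltjes_ge hc hx (m := m) (ε := ε) (fun k hk => h.form_im v hk)
      (fun k hk => h.form_nonneg v hk) hmpos.le hε.1 fun k hk => hmin ⟨hk.1, hk.2.trans (by
        gcongr; exact hε.2.le)⟩
    rw [form_herglotz, h.form_selfEnergy_of_slit hc v v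
      (neg_mem_slitPlane_of_im_pos (by simpa using hε.1)), star_dotProduct_self, Complex.sub_im,
      Complex.im_mul_ofReal]
    have h2 : ((Ω : ℂ) - (x + ε * Complex.I)).im = -ε := by simp
    rw [h2]
    have h3 : 0 ≤ ε * ∑ j, ‖v j‖ ^ 2 :=
      mul_nonneg hε.1.le (Finset.sum_nonneg fun _ _ => by positivity)
    linarith
  have := le_of_tendsto hlim hub
  have : 0 < m / (2 * c) := by positivity
  linarith

theorem AdmissibleWeight.herglotzUp_zero (h : AdmissibleWeight W K) (hc : 0 < c) :
    herglotzUp c Ω W 0 = herglotz c Ω W 0 := by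
  ext j l
  simp only [herglotz, herglotzUp, selfEnergy, Matrix.sub_apply, Matrix.of_apply,
    Complex.ofReal_zero, (h.decay j l).rotated_zero hc]

/-! ### The negative zeros of the determinant -/

theorem AdmissibleWeight.neg_ofReal_mem {p : ℝ} (hp : 0 < p) : -(-(p : ℂ)) ∈ Complex.slitPlane := by
  rw [neg_neg]; exact Complex.ofReal_mem_slitPlane.2 hp

/-- F(-p) is Hermitian for real p, so a null vector annihilates it from the left as well; the two
formulas use u at p and v at q. -/
theorem AdmissibleWeight.form_eq_of_kernel (h : AdmissibleWeight W K) (hc : 0 < c) {p q : ℝ}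
    (hp : 0 < p) (hq : 0 < q) {u v : Fin N → ℂ}
    (hu : (herglotz c Ω W (-(p : ℂ))).mulVec u = 0)
    (hv : (herglotz c Ω W (-(q : ℂ))).mulVec v = 0) :
    stieltjes c (fun k => star u ⬝ᵥ (W k).mulVec v) (-(p : ℂ)) = (Ω + p) * (star u ⬝ᵥ v) ∧
    stieltjes c (fun k => star u ⬝ᵥ (W k).mulVec v) (-(q : ℂ)) = (Ω + q) * (star u ⬝ᵥ v) := by
  constructor
  · rw [← h.form_selfEnergy_of_slit hc u v (AdmissibleWeight.neg_ofReal_mem hp)]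
    have h1 := form_herglotz (c := c) (Ω := Ω) (W := W) u v (-(p : ℂ))
    have h2 : star u ⬝ᵥ (herglotz c Ω W (-(p : ℂ))).mulVec v = 0 := by
      have e : (herglotz c Ω W (-(p : ℂ))).conjTranspose = herglotz c Ω W (-(p : ℂ)) := by
        rw [← h.herglotz_conj]; simp
      rw [Matrix.dotProduct_mulVec, ← e, ← Matrix.star_mulVec, hu]
      simp
    rw [h2] at h1
    linear_combination h1
  · rw [← h.form_selfEnergy_of_slit hc u v (AdmissibleWeight.neg_ofReal_mem hq)]
    have h1 := form_herglotz (c := c) (Ω := Ω) (W := W) u v (-(q : ℂ))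
    rw [hv, dotProduct_zero] at h1
    linear_combination h1

/-- Integrate ck ⟨w, W(k)w⟩ ≥ 0 for w = ∑ u_p/(p + ck). Off the diagonal, the terms equal (p + q +
Ω)⟨u_p, u_q⟩; on the diagonal they are at most (p + Ω)‖u_p‖², which falls short of that formula by
p‖u_p‖². Since ∑ u_p = 0 kills the double sum of (p + q + Ω)⟨u_p, u_q⟩, what remains is 0 ≤ -∑
p‖u_p‖². -/
theorem AdmissibleWeight.eq_zero_of_sum_kernel (h : AdmissibleWeight W K) (hc : 0 < c)
    (Q : Finset ℝ) (hQ : ∀ p ∈ Q, 0 < p) (u : ℝ → Fin N → ℂ)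
    (hu : ∀ p ∈ Q, (herglotz c Ω W (-(p : ℂ))).mulVec (u p) = 0) (hsum : ∑ p ∈ Q, u p = 0) :
    ∀ p ∈ Q, u p = 0 := by
  set B : ℝ → ℝ → ℝ → ℂ := fun p q k => star (u p) ⬝ᵥ (W k).mulVec (u q) with hB
  set J : ℝ → ℝ → ℝ → ℂ := fun p q k => B p q k * (c * k) / ((p + c * k) * (q + c * k)) with hJ
  have hne : ∀ p ∈ Q, ∀ k : ℝ, 0 < k → (p + c * k : ℂ) ≠ 0 := fun p hp k hk => by
    have := hQ p hp
    have : 0 < p + c * k := by positivity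
    exact_mod_cast this.ne'
  have hst : ∀ p ∈ Q, ∀ q r : ℝ, IntegrableOn (fun k : ℝ => B q r k / (p + c * k)) (Ioi 0) ∧
      ∫ k in Ioi (0 : ℝ), B q r k / (p + c * k) =
        stieltjes c (fun k => star (u q) ⬝ᵥ (W k).mulVec (u r)) (-(p : ℂ)) := by
    intro p hp q r
    obtain ⟨K', hK'⟩ := h.form_decay (u q) (u r)
    have := hK'.integrableOn_div_of_slit hc (AdmissibleWeight.neg_ofReal_mem (hQ p hp))
    simp only [sub_neg_eq_add, add_comm _ (p : ℂ)] at this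
    refine ⟨this, ?_⟩
    simp only [stieltjes, sub_neg_eq_add, add_comm _ (p : ℂ), hB]
  have hoff : ∀ p ∈ Q, ∀ q ∈ Q, p ≠ q → IntegrableOn (J p q) (Ioi 0) ∧
      ∫ k in Ioi (0 : ℝ), J p q k = (p + q + Ω) * (star (u p) ⬝ᵥ u q) := by
    intro p hp q hq hpq
    have hpq' : (q - p : ℂ) ≠ 0 := by
      rw [sub_ne_zero]; exact_mod_cast hpq.symm
    -- Partial fractions. The null vector equations give [q(Ω + q) - p(Ω + p)]/(q - p) = p + q + Ω
    -- as the factor of ⟨u_p, u_q⟩.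
    have e : EqOn (fun k => (q / (q - p) : ℂ) * (B p q k / (q + c * k)) -
        (p / (q - p) : ℂ) * (B p q k / (p + c * k))) (J p q) (Ioi 0) := fun k hk => by
      have h1 := hne p hp k hk
      have h2 := hne q hq k hk
      simp only [hJ]; field_simp; ring
    obtain ⟨h1, h2⟩ := hst p hp p q
    obtain ⟨h3, h4⟩ := hst q hq p q
    obtain ⟨h5, h6⟩ := h.form_eq_of_kernel hc (hQ p hp) (hQ q hq) (hu p hp) (hu q hq)
    refine ⟨IntegrableOn.congr_fun ((h3.const_mul _).sub (h1.const_mul _)) e measurableSet_Ioi, ?_⟩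
    rw [← setIntegral_congr_fun measurableSet_Ioi e, integral_sub (h3.const_mul _) (h1.const_mul _),
      integral_const_mul, integral_const_mul, h2, h4, h5, h6]
    field_simp; ring
  -- No partial fractions exist for p = q; the bound ck/(p + ck) ≤ 1 suffices and is the source of
  -- the gain.
  have hdiag : ∀ p ∈ Q, IntegrableOn (J p p) (Ioi 0) ∧
      (∫ k in Ioi (0 : ℝ), J p p k).re ≤ (p + Ω) * (∑ j, ‖u p j‖ ^ 2) := by
    intro p hp
    obtain ⟨h1, h2⟩ := hst p hp p p
    obtain ⟨h5, -⟩ := h.form_eq_of_kernel hc (hQ p hp) (hQ p hp) (hu p hp) (hu p hp)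
    have hp0 := hQ p hp
    have hre : ∀ k : ℝ, 0 < k → B p p k = ((B p p k).re : ℂ) ∧ 0 ≤ (B p p k).re := fun k hk =>
      ⟨Complex.ext (by simp) (by simpa using h.form_im (u p) hk), h.form_nonneg (u p) hk⟩
    have hJB : ∀ k : ℝ, J p p k = (B p p k / (p + c * k)) * ((c * k : ℝ) / (p + c * k)) := by
      intro k
      simp only [hJ, div_mul_div_comm]
      push_cast; rfl
    have hint : IntegrableOn (J p p) (Ioi 0) := by
      refine Integrable.mono h1 ?_ ((ae_restrict_mem measurableSet_Ioi).mono fun k hk => ?_)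
      · have hm : Measurable fun k : ℝ => ((c * k : ℝ) / (p + c * k) : ℂ) := by fun_prop
        exact (h1.aestronglyMeasurable.mul hm.aestronglyMeasurable).congr
          (Eventually.of_forall fun k => (hJB k).symm)
      · have hk : 0 < k := hk
        rw [hJB, norm_mul]
        refine mul_le_of_le_one_right (norm_nonneg _) ?_
        have hpos : 0 < p + c * k := by positivity
        rw [show ((c * k : ℝ) / (p + c * k) : ℂ) = ((c * k / (p + c * k) : ℝ) : ℂ) by push_cast; rfl,
          Complex.norm_real, Real.norm_of_nonneg (by positivity), div_le_one hpos]
        linarith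
    refine ⟨hint, ?_⟩
    have hval : (∫ k in Ioi (0 : ℝ), B p p k / (p + c * k)).re =
        (p + Ω) * (∑ j, ‖u p j‖ ^ 2) := by
      rw [h2, h5, star_dotProduct_self, ← Complex.ofReal_add, ← Complex.ofReal_mul,
        Complex.ofReal_re]
      ring
    rw [← hval]
    have r1 : ∀ f : ℝ → ℂ, IntegrableOn f (Ioi 0) →
        (∫ k in Ioi (0 : ℝ), f k).re = ∫ k in Ioi (0 : ℝ), (f k).re := fun f hf =>
      (integral_re hf).symm
    rw [r1 _ hint, r1 _ h1]
    refine setIntegral_mono_on (Integrable.re hint) (Integrable.re h1) measurableSet_Ioi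
      fun k hk => ?_
    have hk : 0 < k := hk
    have hpos : 0 < p + c * k := by positivity
    obtain ⟨e1, e2⟩ := hre k hk
    have e3 : B p p k / (p + c * k) = (((B p p k).re / (p + c * k) : ℝ) : ℂ) := by
      rw [e1]; push_cast; simp
    have e4 : ((c * k : ℝ) / (p + c * k) : ℂ) = ((c * k / (p + c * k) : ℝ) : ℂ) := by push_cast; rfl
    rw [hJB, e4, e3, ← Complex.ofReal_mul, Complex.ofReal_re, Complex.ofReal_re]
    refine mul_le_of_le_one_right (by positivity) ?_
    rw [div_le_one hpos]; linarith
  have hJi : ∀ p ∈ Q, ∀ q ∈ Q, IntegrableOn (J p q) (Ioi 0) := fun p hp q hq => by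
    by_cases hpq : p = q
    · subst hpq; exact (hdiag p hp).1
    · exact (hoff p hp q hq hpq).1
  have htot : 0 ≤ (∑ p ∈ Q, ∑ q ∈ Q, ∫ k in Ioi (0 : ℝ), J p q k).re := by
    have e : ∑ p ∈ Q, ∑ q ∈ Q, ∫ k in Ioi (0 : ℝ), J p q k =
        ∫ k in Ioi (0 : ℝ), ∑ p ∈ Q, ∑ q ∈ Q, J p q k := by
      rw [integral_finsetSum _ fun p hp => integrable_finsetSum _ fun q hq => hJi p hp q hq]
      exact Finset.sum_congr rfl fun p hp =>
        (integral_finsetSum _ fun q hq => hJi p hp q hq).symm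
    have hi : IntegrableOn (fun k => ∑ p ∈ Q, ∑ q ∈ Q, J p q k) (Ioi 0) :=
      integrable_finsetSum _ fun p hp => integrable_finsetSum _ fun q hq => hJi p hp q hq
    rw [e]
    have r1 : (∫ k in Ioi (0 : ℝ), ∑ p ∈ Q, ∑ q ∈ Q, J p q k).re =
      ∫ k in Ioi (0 : ℝ), (∑ p ∈ Q, ∑ q ∈ Q, J p q k).re := (integral_re hi).symm
    rw [r1]
    refine setIntegral_nonneg measurableSet_Ioi fun k hk => ?_
    have hk : 0 < k := hk
    have e2 : ∑ p ∈ Q, ∑ q ∈ Q, J p q k = ((c * k : ℝ) : ℂ) *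
        (star (∑ p ∈ Q, (p + c * k : ℂ)⁻¹ • u p) ⬝ᵥ
          (W k).mulVec (∑ p ∈ Q, (p + c * k : ℂ)⁻¹ • u p)) := by
      rw [star_sum, sum_dotProduct, Finset.mul_sum]
      refine Finset.sum_congr rfl fun p hp => ?_
      rw [← Matrix.mulVecLin_apply, map_sum, dotProduct_sum, Finset.mul_sum]
      refine Finset.sum_congr rfl fun q hq => ?_
      rw [map_smul, Matrix.mulVecLin_apply, star_smul, smul_dotProduct, dotProduct_smul]
      have : star ((p + c * k : ℂ)⁻¹) = (p + c * k : ℂ)⁻¹ := by simp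
      rw [this]
      simp only [hJ, hB, smul_eq_mul]
      push_cast
      rw [div_eq_mul_inv, mul_inv]; ring
    rw [e2, Complex.re_ofReal_mul]
    exact mul_nonneg (by positivity) (h.form_nonneg _ hk)
  have hbound : (∑ p ∈ Q, ∑ q ∈ Q, ∫ k in Ioi (0 : ℝ), J p q k).re ≤
      (∑ p ∈ Q, ∑ q ∈ Q, ((p + q + Ω : ℂ) * (star (u p) ⬝ᵥ u q))).re -
        ∑ p ∈ Q, p * ∑ j, ‖u p j‖ ^ 2 := by
    simp only [Complex.re_sum]
    rw [← Finset.sum_sub_distrib]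
    refine Finset.sum_le_sum fun p hp => ?_
    have e : p * ∑ j, ‖u p j‖ ^ 2 = ∑ q ∈ Q, if q = p then p * ∑ j, ‖u p j‖ ^ 2 else 0 := by
      rw [Finset.sum_ite_eq' Q p, if_pos hp]
    rw [e, ← Finset.sum_sub_distrib]
    refine Finset.sum_le_sum fun q hq => ?_
    by_cases hpq : q = p
    · subst hpq
      rw [if_pos rfl, star_dotProduct_self, show ((q + q + Ω : ℂ)) = ((q + q + Ω : ℝ) : ℂ) by
        push_cast; rfl, ← Complex.ofReal_mul, Complex.ofReal_re]
      have := (hdiag q hq).2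
      linarith
    · rw [if_neg hpq, sub_zero, (hoff p hp q hq (Ne.symm hpq)).2]
  -- Each summand of p + q + Ω depends on at most one index, so summing over the other one produces
  -- ∑ u_p = 0.
  have hzero : ∑ p ∈ Q, ∑ q ∈ Q, ((p + q + Ω : ℂ) * (star (u p) ⬝ᵥ u q)) = 0 := by
    have e1 : ∀ p, ∑ q ∈ Q, (star (u p) ⬝ᵥ u q) = 0 := fun p => by
      rw [← dotProduct_sum, hsum, dotProduct_zero]
    have e2 : ∀ q, ∑ p ∈ Q, (star (u p) ⬝ᵥ u q) = 0 := fun q => by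
      rw [← sum_dotProduct, ← star_sum, hsum, star_zero, zero_dotProduct]
    simp only [add_mul, Finset.sum_add_distrib]
    have a1 : ∑ p ∈ Q, ∑ q ∈ Q, (p : ℂ) * (star (u p) ⬝ᵥ u q) = 0 := by
      simp only [← Finset.mul_sum, e1, mul_zero, Finset.sum_const_zero]
    have a2 : ∑ p ∈ Q, ∑ q ∈ Q, (q : ℂ) * (star (u p) ⬝ᵥ u q) = 0 := by
      rw [Finset.sum_comm]
      simp only [← Finset.mul_sum, e2, mul_zero, Finset.sum_const_zero]
    have a3 : ∑ p ∈ Q, ∑ q ∈ Q, (Ω : ℂ) * (star (u p) ⬝ᵥ u q) = 0 := by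
      simp only [← Finset.mul_sum, e1, mul_zero, Finset.sum_const_zero]
    rw [a1, a2, a3]; simp
  rw [hzero, Complex.zero_re, zero_sub] at hbound
  have hnn : ∀ p ∈ Q, 0 ≤ p * ∑ j, ‖u p j‖ ^ 2 := fun p hp =>
    mul_nonneg (hQ p hp).le (Finset.sum_nonneg fun _ _ => by positivity)
  have hs0 : ∑ p ∈ Q, p * ∑ j, ‖u p j‖ ^ 2 = 0 :=
    le_antisymm (by linarith) (Finset.sum_nonneg hnn)
  intro p hp
  by_contra hne0
  have := (Finset.sum_eq_zero_iff_of_nonneg hnn).1 hs0 p hp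
  have := mul_pos (hQ p hp) (sum_sq_pos hne0)
  linarith

/-- There are at most `N` negative zeros of `det F`. -/
theorem AdmissibleWeight.card_zeros_le (h : AdmissibleWeight W K) (hc : 0 < c)
    (Q : Finset ℝ) (hQ : ∀ p ∈ Q, 0 < p ∧ (herglotz c Ω W (-(p : ℂ))).det = 0) : Q.card ≤ N := by
  have hex : ∀ p : ℝ, ∃ v : Fin N → ℂ, p ∈ Q → v ≠ 0 ∧
      (herglotz c Ω W (-(p : ℂ))).mulVec v = 0 := fun p => by
    by_cases hp : p ∈ Q
    · obtain ⟨v, hv⟩ := Matrix.exists_mulVec_eq_zero_iff.2 (hQ p hp).2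
      exact ⟨v, fun _ => hv⟩
    · exact ⟨0, fun h => absurd h hp⟩
  choose v hv using hex
  have hli : LinearIndependent ℂ fun p : Q => v p := by
    rw [Fintype.linearIndependent_iff]
    intro a ha p
    set a' : ℝ → ℂ := fun p => if hp : p ∈ Q then a ⟨p, hp⟩ else 0 with ha'
    have hap : ∀ p : Q, a' p = a p := fun p => by simp [ha']
    -- Multiples of null vectors are null vectors, so a vanishing combination has the form treated
    -- there.
    have hz := h.eq_zero_of_sum_kernel (Ω := Ω) hc Q (fun p hp => (hQ p hp).1)
      (fun p => a' p • v p) (fun p hp => by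
        rw [Matrix.mulVec_smul, (hv p hp).2, smul_zero]) (by
        rw [← Finset.sum_coe_sort]
        simpa only [hap] using ha) p p.2
    rw [hap] at hz
    exact (smul_eq_zero.1 hz).resolve_right (hv p p.2).1
  have := hli.fintype_card_le_finrank
  simpa using this

end Herglotz

/-! ### Poles of the resolvent and its partial fraction representation -/

section Poles

variable {N : ℕ} {W : ℂ → Matrix (Fin N) (Fin N) ℂ} {K c Ω : ℝ}

theorem differentiableAt_det {A : ℂ → Matrix (Fin N) (Fin N) ℂ} {z : ℂ}
    (hA : ∀ j l, DifferentiableAt ℂ (fun w => A w j l) z) :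
    DifferentiableAt ℂ (fun w => (A w).det) z := by
  simp only [Matrix.det_apply]
  refine DifferentiableAt.fun_sum fun σ _ => ?_
  exact (DifferentiableAt.fun_finsetProd fun i _ => hA _ _).const_smul _

theorem differentiableAt_adjugate {A : ℂ → Matrix (Fin N) (Fin N) ℂ} {z : ℂ}
    (hA : ∀ j l, DifferentiableAt ℂ (fun w => A w j l) z) (j l : Fin N) :
    DifferentiableAt ℂ (fun w => (A w).adjugate j l) z := by
  simp only [Matrix.adjugate_apply]
  refine differentiableAt_det fun i m => ?_
  simp only [Matrix.updateRow_apply]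
  split_ifs
  · exact differentiableAt_const _
  · exact hA i m

theorem AdmissibleWeight.differentiableAt_herglotz (h : AdmissibleWeight W K) (hc : 0 < c) {z : ℂ}
    (hz : -z ∈ Complex.slitPlane) (j l : Fin N) :
    DifferentiableAt ℂ (fun w => herglotz c Ω W w j l) z := by
  simp only [herglotz, selfEnergy, Matrix.sub_apply, Matrix.smul_apply, Matrix.of_apply, smul_eq_mul]
  exact ((differentiableAt_const _).sub differentiableAt_id).mul_const _ |>.sub
    ((h.decay j l).differentiableAt_stieltjes hc hz)

theorem inv_entry (A : Matrix (Fin N) (Fin N) ℂ) (j l : Fin N) :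
    A⁻¹ j l = A.det⁻¹ * A.adjugate j l := by
  simp [Matrix.inv_def]

theorem AdmissibleWeight.differentiableAt_inv (h : AdmissibleWeight W K) (hc : 0 < c) {z : ℂ}
    (hz : -z ∈ Complex.slitPlane) (hdet : (herglotz c Ω W z).det ≠ 0) (j l : Fin N) :
    DifferentiableAt ℂ (fun w => (herglotz c Ω W w)⁻¹ j l) z := by
  simp only [inv_entry]
  exact ((differentiableAt_det fun j l => h.differentiableAt_herglotz hc hz j l).inv hdet).mul
    (differentiableAt_adjugate (fun j l => h.differentiableAt_herglotz hc hz j l) j l)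

theorem analyticAt_of_forall_slit {f : ℂ → ℂ}
    (hf : ∀ y ∈ Complex.slitPlane, DifferentiableAt ℂ f y) {y : ℂ} (hy : y ∈ Complex.slitPlane) :
    AnalyticAt ℂ f y :=
  DifferentiableOn.analyticAt (fun w hw => (hf w hw).differentiableWithinAt)
    (Complex.isOpen_slitPlane.mem_nhds hy)

theorem AdmissibleWeight.differentiableAt_comp_neg (h : AdmissibleWeight W K) (hc : 0 < c) {y : ℂ}
    (hy : y ∈ Complex.slitPlane) (j l : Fin N) :
    DifferentiableAt ℂ (fun w => herglotz c Ω W (-w) j l) y :=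
  DifferentiableAt.comp y (g := fun w => herglotz c Ω W w j l)
    (h.differentiableAt_herglotz hc (by rwa [neg_neg]) j l) differentiableAt_id.neg

theorem AdmissibleWeight.analyticAt_det (h : AdmissibleWeight W K) (hc : 0 < c) {y : ℂ}
    (hy : y ∈ Complex.slitPlane) : AnalyticAt ℂ (fun w => (herglotz c Ω W (-w)).det) y :=
  analyticAt_of_forall_slit
    (fun _ hw => differentiableAt_det fun j l => h.differentiableAt_comp_neg hc hw j l) hy

theorem AdmissibleWeight.analyticAt_adjugate (h : AdmissibleWeight W K) (hc : 0 < c) {y : ℂ}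
    (hy : y ∈ Complex.slitPlane) (j l : Fin N) :
    AnalyticAt ℂ (fun w => (herglotz c Ω W (-w)).adjugate j l) y :=
  analyticAt_of_forall_slit (fun _ hw =>
    differentiableAt_adjugate (fun j l => h.differentiableAt_comp_neg hc hw j l) j l) hy

theorem AdmissibleWeight.meromorphicAt_inv (h : AdmissibleWeight W K) (hc : 0 < c) {y : ℂ}
    (hy : y ∈ Complex.slitPlane) (j l : Fin N) :
    MeromorphicAt (fun w => (herglotz c Ω W (-w))⁻¹ j l) y := by
  simp only [inv_entry]
  exact (h.analyticAt_det hc hy).meromorphicAt.inv.mul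
    (h.analyticAt_adjugate hc hy j l).meromorphicAt

/-- The inverse is the adjugate over the determinant, both analytic here. Only this implication is
needed for counting poles. -/
theorem AdmissibleWeight.det_eq_zero_of_pole (h : AdmissibleWeight W K) (hc : 0 < c) {y : ℂ}
    (hy : y ∈ Complex.slitPlane) (hp : IsMatrixPole (fun w => (herglotz c Ω W (-w))⁻¹) y) :
    (herglotz c Ω W (-y)).det = 0 := by
  by_contra hdet
  obtain ⟨j, l, hjl⟩ := hp
  have : AnalyticAt ℂ (fun w => (herglotz c Ω W (-w))⁻¹ j l) y := by
    simp only [inv_entry]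
    exact ((h.analyticAt_det hc hy).inv hdet).mul (h.analyticAt_adjugate hc hy j l)
  exact absurd this.meromorphicOrderAt_nonneg (not_le.2 hjl)

theorem AdmissibleWeight.pole_real_pos (h : AdmissibleWeight W K) (hc : 0 < c) {y : ℂ}
    (hy : y ∈ Complex.slitPlane) (hp : IsMatrixPole (fun w => (herglotz c Ω W (-w))⁻¹) y) :
    0 < y.re ∧ y = (y.re : ℂ) := by
  have hdet := h.det_eq_zero_of_pole hc hy hp
  have him : y.im = 0 := by
    by_contra hne
    exact h.det_herglotz_ne_zero hc (z := -y) (by simpa using hne) hdet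
  refine ⟨?_, Complex.ext (by simp) (by simpa using him)⟩
  rcases Complex.mem_slitPlane_iff.1 hy with h1 | h1
  · exact h1
  · exact absurd him h1

theorem AdmissibleWeight.finite_zeros (h : AdmissibleWeight W K) (hc : 0 < c) :
    {p : ℝ | 0 < p ∧ (herglotz c Ω W (-(p : ℂ))).det = 0}.Finite := by
  by_contra hinf
  obtain ⟨t, ht, hcard⟩ := Set.Infinite.exists_subset_card_eq hinf (N + 1)
  have := h.card_zeros_le (Ω := Ω) hc t fun p hp => ht hp
  omega

/-- The last clause repeats the first for positive reals, in the form used when principal parts are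
removed. -/
theorem AdmissibleWeight.exists_poles (h : AdmissibleWeight W K) (hc : 0 < c) :
    ∃ P : Finset ℝ, {p : ℂ | p ∈ Complex.slitPlane ∧
        IsMatrixPole (fun w => (herglotz c Ω W (-w))⁻¹) p} = (fun p : ℝ => (p : ℂ)) '' P ∧
      (∀ p ∈ P, 0 < p) ∧ P.card ≤ N ∧
      ∀ p : ℝ, 0 < p → (p ∈ P ↔ IsMatrixPole (fun w => (herglotz c Ω W (-w))⁻¹) p) := by
  set A : Set ℝ := {p : ℝ | 0 < p ∧ IsMatrixPole (fun w => (herglotz c Ω W (-w))⁻¹) (p : ℂ)}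
  have hsub : A ⊆ {p : ℝ | 0 < p ∧ (herglotz c Ω W (-(p : ℂ))).det = 0} := fun p hp =>
    ⟨hp.1, h.det_eq_zero_of_pole hc (Complex.ofReal_mem_slitPlane.2 hp.1) hp.2⟩
  have hfin : A.Finite := (h.finite_zeros hc).subset hsub
  refine ⟨hfin.toFinset, ?_, fun p hp => (hfin.mem_toFinset.1 hp).1, ?_, fun p hp => ?_⟩
  · ext y
    constructor
    · rintro ⟨h1, h2⟩
      obtain ⟨h3, h4⟩ := h.pole_real_pos hc h1 h2
      exact ⟨y.re, hfin.mem_toFinset.2 ⟨h3, h4 ▸ h2⟩, h4.symm⟩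
    · rintro ⟨p, hp, rfl⟩
      have := hfin.mem_toFinset.1 hp
      exact ⟨Complex.ofReal_mem_slitPlane.2 this.1, this.2⟩
  · exact h.card_zeros_le hc _ fun p hp => hsub (hfin.mem_toFinset.1 hp)
  · exact hfin.mem_toFinset.trans ⟨fun h => h.2, fun h => ⟨hp, h⟩⟩

/-- Simplicity comes from the bound 1/|Im z| along a vertical ray. It also shows that the limit
defining `matrixResidue` exists, so `limUnder` returns the true residue. -/
theorem AdmissibleWeight.simple_pole (h : AdmissibleWeight W K) (hc : 0 < c) {p : ℝ} (hp : 0 < p)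
    (j l : Fin N) : ∃ g : ℂ → ℂ, AnalyticAt ℂ g p ∧ ∀ᶠ y in 𝓝[≠] (p : ℂ),
      (herglotz c Ω W (-y))⁻¹ j l =
        matrixResidue (fun w => (herglotz c Ω W (-w))⁻¹) p j l / (y - p) + g y := by
  obtain ⟨r, g, hg, hf⟩ := exists_simple_pole
    (h.meromorphicAt_inv (Ω := Ω) hc (Complex.ofReal_mem_slitPlane.2 hp) j l) (C := 1) (by
      filter_upwards [self_mem_nhdsWithin] with ε hε
      have hε : 0 < ε := hε
      have := h.norm_inv_herglotz_le (Ω := Ω) hc (z := -(p + ε * Complex.I)) (by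
        simpa using hε.ne') j l
      simpa [abs_of_pos hε] using this)
  have : matrixResidue (fun w => (herglotz c Ω W (-w))⁻¹) p j l = r :=
    (tendsto_circleIntegral_of_simple_pole hg hf).limUnder_eq
  exact ⟨g, hg, by rwa [this]⟩

theorem tendsto_ofReal_punctured (p : ℝ) :
    Tendsto (fun y : ℝ => (y : ℂ)) (𝓝[≠] p) (𝓝[≠] (p : ℂ)) := by
  refine tendsto_nhdsWithin_iff.2 ⟨?_, ?_⟩
  · exact (Complex.continuous_ofReal.tendsto p).mono_left nhdsWithin_le_nhds
  · filter_upwards [self_mem_nhdsWithin] with y hy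
    exact fun h => hy (Complex.ofReal_injective h)

theorem tendsto_sub_mul_of_simple_pole {f g : ℂ → ℂ} {p r : ℂ} (hg : AnalyticAt ℂ g p)
    (hf : ∀ᶠ y in 𝓝[≠] p, f y = r / (y - p) + g y) :
    Tendsto (fun y => (y - p) * f y) (𝓝[≠] p) (𝓝 r) := by
  have h1 : Tendsto (fun y => r + (y - p) * g y) (𝓝[≠] p) (𝓝 r) := by
    have h2 : ContinuousAt (fun y => r + (y - p) * g y) p :=
      continuousAt_const.add ((continuousAt_id.sub continuousAt_const).mul hg.continuousAt)
    have := h2.tendsto.mono_left (nhdsWithin_le_nhds (s := {p}ᶜ))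
    simpa using this
  refine h1.congr' ?_
  filter_upwards [hf, self_mem_nhdsWithin] with y hy hne
  have := sub_ne_zero.2 hne
  rw [hy]; field_simp

/-- Both entries are limits of (y - p) F(-y)⁻¹ along real y, where F is Hermitian. -/
theorem AdmissibleWeight.residue_hermitian (h : AdmissibleWeight W K) (hc : 0 < c) {p : ℝ}
    (hp : 0 < p) (j l : Fin N) :
    (starRingEnd ℂ) (matrixResidue (fun w => (herglotz c Ω W (-w))⁻¹) p l j) =
      matrixResidue (fun w => (herglotz c Ω W (-w))⁻¹) p j l := by
  obtain ⟨g, hg, hf⟩ := h.simple_pole (Ω := Ω) hc hp j l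
  obtain ⟨g', hg', hf'⟩ := h.simple_pole (Ω := Ω) hc hp l j
  have h1 := (tendsto_sub_mul_of_simple_pole hg hf).comp (tendsto_ofReal_punctured p)
  have h2 := (Complex.continuous_conj.tendsto _).comp
    ((tendsto_sub_mul_of_simple_pole hg' hf').comp (tendsto_ofReal_punctured p))
  refine tendsto_nhds_unique (h2.congr fun y => ?_) h1
  have := h.inv_herglotz_conj (c := c) (Ω := Ω) (-(y : ℂ)) j l
  simp only [map_neg, Complex.conj_ofReal] at this
  simp only [Function.comp_apply, map_mul, map_sub, Complex.conj_ofReal, this]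

/-- `G(z) + ∑ R_p / (z + p)`, the resolvent with its poles removed. -/
noncomputable def regular (c Ω : ℝ) (W : ℂ → Matrix (Fin N) (Fin N) ℂ) (P : Finset ℝ)
    (j l : Fin N) (z : ℂ) : ℂ :=
  (herglotz c Ω W z)⁻¹ j l +
    ∑ p ∈ P, matrixResidue (fun w => (herglotz c Ω W (-w))⁻¹) (p : ℂ) j l / (z + p)

theorem nhdsUpper_le_punctured (x : ℝ) : 𝓝[{z : ℂ | 0 < z.im}] (x : ℂ) ≤ 𝓝[≠] (x : ℂ) := by
  refine nhdsWithin_mono _ fun z hz h => ?_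
  rw [mem_singleton_iff] at h
  rw [h] at hz
  simp at hz

theorem tendsto_neg_punctured (x : ℝ) :
    Tendsto (fun z : ℂ => -z) (𝓝[≠] (x : ℂ)) (𝓝[≠] ((-x : ℝ) : ℂ)) := by
  refine tendsto_nhdsWithin_iff.2 ⟨?_, ?_⟩
  · have := (continuous_neg.tendsto (x : ℂ)).mono_left (nhdsWithin_le_nhds (s := {(x : ℂ)}ᶜ))
    simpa using this
  · filter_upwards [self_mem_nhdsWithin] with y hy h
    apply hy
    simp only [mem_singleton_iff, Complex.ofReal_neg, neg_inj] at h
    exact h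

theorem tendsto_pole_sum {ι : Type*} (s : Finset ι) (a : ι → ℂ) (p : ι → ℝ) {x : ℂ}
    (hx : ∀ i ∈ s, x + p i ≠ 0) {f : Filter ℂ} (hf : f ≤ 𝓝 x) :
    Tendsto (fun z : ℂ => ∑ i ∈ s, a i / (z + p i)) f (𝓝 (∑ i ∈ s, a i / (x + p i))) := by
  refine tendsto_finsetSum _ fun i hi => tendsto_const_nhds.div ?_ (hx i hi)
  exact ((continuous_id.add continuous_const).tendsto x).mono_left hf

theorem ofReal_add_ne_zero {x p : ℝ} (h : x ≠ -p) : (x + p : ℂ) ≠ 0 := fun h0 => by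
  have : x + p = 0 := by exact_mod_cast h0
  exact h (by linarith)

/-- Positivity gives invertibility of the boundary matrix only for x > 0; at the threshold x = 0 it
is the hypothesis `h0`. -/
theorem AdmissibleWeight.tendsto_regular_nonneg (h : AdmissibleWeight W K) (hc : 0 < c)
    {P : Finset ℝ} (hP : ∀ p ∈ P, 0 < p) (h0 : (herglotz c Ω W 0).det ≠ 0) {x : ℝ} (hx : 0 ≤ x)
    (j l : Fin N) :
    Tendsto (regular c Ω W P j l) (𝓝[{z : ℂ | 0 < z.im}] x)
      (𝓝 ((herglotzUp c Ω W x)⁻¹ j l +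
        ∑ p ∈ P, matrixResidue (fun w => (herglotz c Ω W (-w))⁻¹) (p : ℂ) j l / (x + p))) := by
  have hdet : (herglotzUp c Ω W x).det ≠ 0 := by
    rcases hx.eq_or_lt with rfl | hx
    · rwa [h.herglotzUp_zero hc]
    · exact h.det_herglotzUp_ne_zero hc hx
  refine (tendsto_inv_matrix (h.tendsto_herglotz_upper hc x) hdet j l).add ?_
  refine tendsto_pole_sum _ _ _ (fun p hp => ofReal_add_ne_zero ?_) nhdsWithin_le_nhds
  have := hP p hp
  linarith

/-- At a pole the principal part R/(-z - p) of the resolvent cancels against the added R/(z + p).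
Elsewhere a meromorphic function of nonnegative order has a limit, and nothing need be known about
the determinant. -/
theorem AdmissibleWeight.exists_tendsto_regular_neg (h : AdmissibleWeight W K) (hc : 0 < c)
    {P : Finset ℝ}
    (hP : ∀ p : ℝ, 0 < p → (p ∈ P ↔ IsMatrixPole (fun w => (herglotz c Ω W (-w))⁻¹) (p : ℂ)))
    {x : ℝ} (hx : x < 0) (j l : Fin N) :
    ∃ a, Tendsto (regular c Ω W P j l) (𝓝[{z : ℂ | 0 < z.im}] x) (𝓝 a) := by
  have hle := nhdsUpper_le_punctured x
  have hq : 0 < -x := by linarith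
  have htn := (tendsto_neg_punctured x).mono_left hle
  by_cases hmem : -x ∈ P
  · obtain ⟨g, hg, hf⟩ := h.simple_pole (Ω := Ω) hc hq j l
    have hsplit : ∀ z : ℂ, regular c Ω W P j l z = ((herglotz c Ω W (-(-z)))⁻¹ j l +
        matrixResidue (fun w => (herglotz c Ω W (-w))⁻¹) ((-x : ℝ) : ℂ) j l / (z + (-x : ℝ))) +
        ∑ p ∈ P.erase (-x),
          matrixResidue (fun w => (herglotz c Ω W (-w))⁻¹) (p : ℂ) j l / (z + p) := by
      intro z
      rw [regular, ← Finset.add_sum_erase P _ hmem, neg_neg]; ring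
    refine ⟨g (-x : ℝ) + ∑ p ∈ P.erase (-x),
          matrixResidue (fun w => (herglotz c Ω W (-w))⁻¹) (p : ℂ) j l / (x + p), ?_⟩
    rw [funext hsplit]
    refine Tendsto.add ?_ (tendsto_pole_sum _ _ _ (fun p hp => ofReal_add_ne_zero ?_)
      nhdsWithin_le_nhds)
    · have h1 : Tendsto (fun z : ℂ => g (-z)) (𝓝[{z : ℂ | 0 < z.im}] (x : ℂ)) (𝓝 (g (-x : ℝ))) :=
        hg.continuousAt.tendsto.comp (htn.mono_right nhdsWithin_le_nhds)
      refine h1.congr' ?_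
      have hne : ∀ᶠ z : ℂ in 𝓝[{z : ℂ | 0 < z.im}] (x : ℂ), z ≠ (x : ℂ) := hle self_mem_nhdsWithin
      filter_upwards [htn.eventually hf, hne] with z hz hzx
      rw [hz]
      have e1 : -z - ((-x : ℝ) : ℂ) = -(z + ((-x : ℝ) : ℂ)) := by ring
      rw [e1, div_neg]; ring
    · have := (Finset.mem_erase.1 hp).1
      intro hxp; apply this; linarith
  · have hnp : ¬ IsMatrixPole (fun w => (herglotz c Ω W (-w))⁻¹) ((-x : ℝ) : ℂ) := fun hpole =>
      hmem ((hP _ hq).2 hpole)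
    have hord : 0 ≤ meromorphicOrderAt (fun w => (herglotz c Ω W (-w))⁻¹ j l) ((-x : ℝ) : ℂ) := by
      by_contra hneg
      exact hnp ⟨j, l, not_le.1 hneg⟩
    obtain ⟨a, ha⟩ := tendsto_nhds_of_meromorphicOrderAt_nonneg
      (h.meromorphicAt_inv hc (Complex.ofReal_mem_slitPlane.2 hq) j l) hord
    refine ⟨a + ∑ p ∈ P,
          matrixResidue (fun w => (herglotz c Ω W (-w))⁻¹) (p : ℂ) j l / (x + p), ?_⟩
    refine Tendsto.add ?_ (tendsto_pole_sum _ _ _ (fun p hp => ofReal_add_ne_zero ?_)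
      nhdsWithin_le_nhds)
    · simpa [Function.comp_def] using ha.comp htn
    · rintro rfl; exact hmem (by simpa using hp)

theorem AdmissibleWeight.differentiableAt_regular (h : AdmissibleWeight W K) (hc : 0 < c)
    {P : Finset ℝ} {z : ℂ} (hz : -z ∈ Complex.slitPlane)
    (hdet : (herglotz c Ω W z).det ≠ 0) (hne : ∀ p ∈ P, (z + (p : ℝ) : ℂ) ≠ 0) (j l : Fin N) :
    DifferentiableAt ℂ (regular c Ω W P j l) z := by
  refine (h.differentiableAt_inv hc hz hdet j l).add (DifferentiableAt.fun_sum fun p hp => ?_)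
  exact (differentiableAt_const _).div (by fun_prop) (hne p hp)

theorem add_ofReal_ne_zero_of_im {z : ℂ} (hz : z.im ≠ 0) (p : ℝ) : z + p ≠ 0 := fun h => by
  have := congrArg Complex.im h
  simp at this
  exact hz this

/-- The continuous extension of `regular` to the closed upper half-plane. -/
noncomputable def regularExt (c Ω : ℝ) (W : ℂ → Matrix (Fin N) (Fin N) ℂ) (P : Finset ℝ)
    (j l : Fin N) : ℂ → ℂ := extendFrom {z : ℂ | 0 < z.im} (regular c Ω W P j l)

theorem AdmissibleWeight.regularExt_eq (h : AdmissibleWeight W K) (hc : 0 < c)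
    (P : Finset ℝ) {z : ℂ} (hz : 0 < z.im) (j l : Fin N) :
    regularExt c Ω W P j l z = regular c Ω W P j l z :=
  extendFrom_eq (subset_closure hz) ((h.differentiableAt_regular hc
    (neg_mem_slitPlane_of_im_pos hz) (h.det_herglotz_ne_zero_upper hc hz)
    (fun p _ => add_ofReal_ne_zero_of_im hz.ne' p) j l).continuousAt.tendsto.mono_left
      nhdsWithin_le_nhds)

theorem closure_upper : closure {z : ℂ | 0 < z.im} = {z : ℂ | 0 ≤ z.im} := by
  exact Complex.closure_setOfPred_lt_im 0

theorem ofReal_mem_closure_upper (x : ℝ) : (x : ℂ) ∈ closure {z : ℂ | 0 < z.im} := by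
  rw [closure_upper]; simp

variable {P : Finset ℝ}

theorem AdmissibleWeight.continuousOn_regularExt (h : AdmissibleWeight W K) (hc : 0 < c)
    (hP0 : ∀ p ∈ P, 0 < p)
    (hP : ∀ p : ℝ, 0 < p → (p ∈ P ↔ IsMatrixPole (fun w => (herglotz c Ω W (-w))⁻¹) (p : ℂ)))
    (h0 : (herglotz c Ω W 0).det ≠ 0) (j l : Fin N) :
    ContinuousOn (regularExt c Ω W P j l) {z : ℂ | 0 ≤ z.im} := by
  refine continuousOn_extendFrom closure_upper.ge fun z hz => ?_
  have hz : 0 ≤ z.im := hz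
  rcases hz.eq_or_lt with hz | hz
  · have e : z = (z.re : ℂ) := Complex.ext (by simp) (by simp [← hz])
    rw [e]
    rcases lt_or_ge z.re 0 with hx | hx
    · exact h.exists_tendsto_regular_neg hc hP hx j l
    · exact ⟨_, h.tendsto_regular_nonneg hc hP0 h0 hx j l⟩
  · exact ⟨_, (h.differentiableAt_regular hc
      (neg_mem_slitPlane_of_im_pos hz) (h.det_herglotz_ne_zero_upper hc hz)
      (fun p _ => add_ofReal_ne_zero_of_im hz.ne' p) j l).continuousAt.tendsto.mono_left
      nhdsWithin_le_nhds⟩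

theorem isOpen_upper : IsOpen {z : ℂ | 0 < z.im} := isOpen_lt continuous_const Complex.continuous_im

theorem AdmissibleWeight.differentiableOn_regularExt (h : AdmissibleWeight W K) (hc : 0 < c)
    (P : Finset ℝ) (j l : Fin N) :
    DifferentiableOn ℂ (regularExt c Ω W P j l) {z : ℂ | 0 < z.im} := fun z hz => by
  have hd := h.differentiableAt_regular (Ω := Ω) hc (P := P)
    (neg_mem_slitPlane_of_im_pos hz) (h.det_herglotz_ne_zero_upper hc hz)
    (fun p _ => add_ofReal_ne_zero_of_im (ne_of_gt hz) p) j l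
  refine (hd.congr_of_eventuallyEq ?_).differentiableWithinAt
  filter_upwards [isOpen_upper.mem_nhds hz] with w hw using h.regularExt_eq hc P hw j l

theorem exists_norm_pole_sum_le (P : Finset ℝ) (a : ℝ → ℂ) :
    ∃ C ρ, 0 ≤ C ∧ ∀ z : ℂ, ρ ≤ ‖z‖ → ‖∑ p ∈ P, a p / (z + p)‖ ≤ C / ‖z‖ := by
  refine ⟨∑ p ∈ P, 2 * ‖a p‖, 2 * (∑ p ∈ P, |p|) + 1,
    Finset.sum_nonneg fun _ _ => by positivity, fun z hz => ?_⟩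
  rw [Finset.sum_div]
  refine (norm_sum_le _ _).trans (Finset.sum_le_sum fun p hp => ?_)
  have h1 : |p| ≤ ∑ p ∈ P, |p| :=
    Finset.single_le_sum (f := fun p : ℝ => |p|) (fun _ _ => abs_nonneg _) hp
  have h2 : ‖z‖ / 2 ≤ ‖z + p‖ := by
    have := norm_le_two_mul_norm_sub (z := -(p : ℂ)) (w := z) (by
      rw [norm_neg, Complex.norm_real, Real.norm_eq_abs]; linarith)
    rwa [sub_neg_eq_add] at this
  have hz0 : 0 < ‖z‖ := by linarith [abs_nonneg p]
  rw [norm_div]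
  calc ‖a p‖ / ‖z + p‖ ≤ ‖a p‖ / (‖z‖ / 2) := by gcongr
    _ = 2 * ‖a p‖ / ‖z‖ := by field_simp

theorem norm_le_of_tendsto_upper {f : ℂ → ℂ} {a : ℂ} {x C ρ : ℝ}
    (hf : Tendsto f (𝓝[{z : ℂ | 0 < z.im}] x) (𝓝 a)) (hx : ρ < |x|) (hx0 : 0 < |x|)
    (hb : ∀ z : ℂ, 0 < z.im → ρ ≤ ‖z‖ → ‖f z‖ ≤ C / ‖z‖) : ‖a‖ ≤ C / |x| := by
  have hne : (𝓝[{z : ℂ | 0 < z.im}] (x : ℂ)).NeBot :=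
    mem_closure_iff_nhdsWithin_neBot.1 (ofReal_mem_closure_upper x)
  have hn : Tendsto (fun z : ℂ => ‖z‖) (𝓝[{z : ℂ | 0 < z.im}] (x : ℂ)) (𝓝 |x|) := by
    have := (continuous_norm.tendsto (x : ℂ)).mono_left
      (nhdsWithin_le_nhds (s := {z : ℂ | 0 < z.im}))
    simpa using this
  refine le_of_tendsto_of_tendsto hf.norm (tendsto_const_nhds.div hn hx0.ne') ?_
  filter_upwards [self_mem_nhdsWithin, hn.eventually (eventually_gt_nhds hx)] with z hz hzρ
  exact hb z hz hzρ.le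

theorem AdmissibleWeight.exists_norm_regularExt_le (h : AdmissibleWeight W K) (hc : 0 < c)
    (hP0 : ∀ p ∈ P, 0 < p)
    (hP : ∀ p : ℝ, 0 < p → (p ∈ P ↔ IsMatrixPole (fun w => (herglotz c Ω W (-w))⁻¹) (p : ℂ)))
    (h0 : (herglotz c Ω W 0).det ≠ 0) (j l : Fin N) :
    ∃ C ρ : ℝ, ∀ z : ℂ, 0 ≤ z.im → ρ ≤ ‖z‖ → ‖regularExt c Ω W P j l z‖ ≤ C / ‖z‖ := by
  obtain ⟨ρ1, hρ1, h1⟩ := h.exists_norm_inv_le (Ω := Ω) hc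
  obtain ⟨C, ρ2, -, h2⟩ := exists_norm_pole_sum_le P
    fun p => matrixResidue (fun w => (herglotz c Ω W (-w))⁻¹) (p : ℂ) j l
  have hup : ∀ z : ℂ, 0 < z.im → max ρ1 ρ2 ≤ ‖z‖ →
      ‖regularExt c Ω W P j l z‖ ≤ (4 + C) / ‖z‖ := by
    intro z hz hρ
    rw [h.regularExt_eq hc P hz, add_div]
    exact (norm_add_le _ _).trans (add_le_add (h1 z hz ((le_max_left _ _).trans hρ) j l)
      (h2 z ((le_max_right _ _).trans hρ)))
  -- The extra 1 makes the inequality strict on the real line, so that it holds at nearby points of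
  -- the upper half-plane and the bound passes to the limit.
  refine ⟨4 + C, max ρ1 ρ2 + 1, fun z hz hρ => ?_⟩
  rcases hz.eq_or_lt with hz | hz
  · have e : z = (z.re : ℂ) := Complex.ext (by simp) (by simp [← hz])
    have hn : ‖z‖ = |z.re| := by rw [e]; simp
    have hcont := h.continuousOn_regularExt hc hP0 hP h0 j l z (by simp [← hz])
    have ht : Tendsto (regularExt c Ω W P j l) (𝓝[{z : ℂ | 0 < z.im}] z)
        (𝓝 (regularExt c Ω W P j l z)) :=
      hcont.mono (fun w (hw : 0 < w.im) => (hw.le : 0 ≤ w.im))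
    rw [hn] at hρ ⊢
    nth_rewrite 1 [e] at ht
    exact norm_le_of_tendsto_upper ht (by linarith) (by
      have := le_max_left ρ1 ρ2; linarith) hup
  · exact hup z hz (by linarith)

/-- The jump `G(x + i0) - G(x - i0)`. -/
noncomputable def jump (c Ω : ℝ) (W : ℂ → Matrix (Fin N) (Fin N) ℂ) (x : ℝ) :
    Matrix (Fin N) (Fin N) ℂ :=
  (herglotzUp c Ω W x)⁻¹ - ((herglotzUp c Ω W x)⁻¹).conjTranspose

theorem AdmissibleWeight.regularExt_nonneg (h : AdmissibleWeight W K) (hc : 0 < c)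
    (hP0 : ∀ p ∈ P, 0 < p) (h0 : (herglotz c Ω W 0).det ≠ 0) {x : ℝ} (hx : 0 ≤ x)
    (j l : Fin N) : regularExt c Ω W P j l x = (herglotzUp c Ω W x)⁻¹ j l +
        ∑ p ∈ P, matrixResidue (fun w => (herglotz c Ω W (-w))⁻¹) (p : ℂ) j l / (x + p) :=
  extendFrom_eq (ofReal_mem_closure_upper x) (h.tendsto_regular_nonneg hc hP0 h0 hx j l)

theorem AdmissibleWeight.conj_pole_sum (h : AdmissibleWeight W K) (hc : 0 < c)
    (hP0 : ∀ p ∈ P, 0 < p) (x : ℝ) (j l : Fin N) :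
    (starRingEnd ℂ) (∑ p ∈ P,
      matrixResidue (fun w => (herglotz c Ω W (-w))⁻¹) (p : ℂ) l j / (x + p)) =
    ∑ p ∈ P, matrixResidue (fun w => (herglotz c Ω W (-w))⁻¹) (p : ℂ) j l / (x + p) := by
  rw [map_sum]
  refine Finset.sum_congr rfl fun p hp => ?_
  rw [map_div₀, h.residue_hermitian hc (hP0 p hp)]
  simp

/-- The residues are Hermitian, so the pole sums cancel and the jump of the regularised function is
that of the resolvent. -/
theorem AdmissibleWeight.jump_eq (h : AdmissibleWeight W K) (hc : 0 < c)
    (hP0 : ∀ p ∈ P, 0 < p) (h0 : (herglotz c Ω W 0).det ≠ 0) {x : ℝ} (hx : 0 ≤ x)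
    (j l : Fin N) : jump c Ω W x j l =
      regularExt c Ω W P j l x - (starRingEnd ℂ) (regularExt c Ω W P l j x) := by
  rw [h.regularExt_nonneg hc hP0 h0 hx, h.regularExt_nonneg hc hP0 h0 hx, map_add,
    h.conj_pole_sum hc hP0, jump, Matrix.sub_apply, Matrix.conjTranspose_apply]
  simp

/-- The partial fraction (Stieltjes) representation of the resolvent. -/
theorem AdmissibleWeight.inv_herglotz_eq (h : AdmissibleWeight W K) (hc : 0 < c)
    (hP0 : ∀ p ∈ P, 0 < p)
    (hP : ∀ p : ℝ, 0 < p → (p ∈ P ↔ IsMatrixPole (fun w => (herglotz c Ω W (-w))⁻¹) (p : ℂ)))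
    (h0 : (herglotz c Ω W 0).det ≠ 0) {z : ℂ} (hz : 0 < z.im) (j l : Fin N) :
    (herglotz c Ω W z)⁻¹ j l = (2 * Real.pi * Complex.I)⁻¹ *
        (∫ x in Ioi (0 : ℝ), jump c Ω W x j l / (x - z)) -
      ∑ p ∈ P, matrixResidue (fun w => (herglotz c Ω W (-w))⁻¹) (p : ℂ) j l / (z + p) := by
  obtain ⟨C1, ρ1, hb1⟩ := h.exists_norm_regularExt_le hc hP0 hP h0 j l
  obtain ⟨C2, ρ2, hb2⟩ := h.exists_norm_regularExt_le hc hP0 hP h0 l j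
  -- V is the transposed entry: since F(z̄) = F(z)*, its conjugate is the boundary value of entry
  -- (j, l) from below.
  have key := cauchy_jump (U := regularExt c Ω W P j l) (V := regularExt c Ω W P l j)
    (C := max C1 C2) (ρ := max ρ1 ρ2) (h.continuousOn_regularExt hc hP0 hP h0 j l)
    (h.differentiableOn_regularExt hc P j l)
    (fun w hw hρ => (hb1 w hw ((le_max_left _ _).trans hρ)).trans (by
      gcongr; exact le_max_left _ _))
    (h.continuousOn_regularExt hc hP0 hP h0 l j) (h.differentiableOn_regularExt hc P l j)
    (fun w hw hρ => (hb2 w hw ((le_max_right _ _).trans hρ)).trans (by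
      gcongr; exact le_max_right _ _)) ?_ hz
  · rw [h.regularExt_eq hc P hz, regular] at key
    rw [eq_sub_iff_add_eq, key]
    congr 1
    refine setIntegral_congr_fun measurableSet_Ioi fun x hx => ?_
    simp only [h.jump_eq hc hP0 h0 (le_of_lt hx)]
  -- On the negative axis the two boundary values agree off the zeros of det F, a finite and hence
  -- null set.
  · have hfin : ((fun x : ℝ => -x) ⁻¹'
        {p : ℝ | 0 < p ∧ (herglotz c Ω W (-(p : ℂ))).det = 0}).Finite :=
      (h.finite_zeros hc).preimage neg_injective.injOn
    have hae : ∀ᵐ x : ℝ, x ∉ ((fun x : ℝ => -x) ⁻¹'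
        {p : ℝ | 0 < p ∧ (herglotz c Ω W (-(p : ℂ))).det = 0}) :=
      measure_eq_zero_iff_ae_notMem.1 (hfin.measure_zero _)
    filter_upwards [hae] with x hx hx0
    have hdet : (herglotz c Ω W x).det ≠ 0 := fun hd => hx ⟨by linarith, by simpa using hd⟩
    have hslit : -(x : ℂ) ∈ Complex.slitPlane := by
      rw [← Complex.ofReal_neg]; exact Complex.ofReal_mem_slitPlane.2 (by linarith)
    have hval : ∀ j l, regularExt c Ω W P j l x = regular c Ω W P j l x := fun j l => by
      refine extendFrom_eq (ofReal_mem_closure_upper x) ((h.differentiableAt_regular hc hslit hdet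
        (fun p hp => ofReal_add_ne_zero ?_) j l).continuousAt.tendsto.mono_left nhdsWithin_le_nhds)
      intro hxp
      have hpole := (hP p (hP0 p hp)).1 hp
      have := h.det_eq_zero_of_pole hc (Complex.ofReal_mem_slitPlane.2 (hP0 p hp)) hpole
      apply hdet
      rw [hxp]; simpa using this
    rw [hval, hval, regular, regular, map_add, h.conj_pole_sum hc hP0, ← h.inv_herglotz_conj]
    simp

/-- The factorisation G - G* = G (F* - F) G* has a bounded middle factor and outer factors of size
4/x, so the jump is O(1/x²) and not merely O(1/x). -/
theorem AdmissibleWeight.integrableOn_jump (h : AdmissibleWeight W K) (hc : 0 < c)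
    (hP0 : ∀ p ∈ P, 0 < p)
    (hP : ∀ p : ℝ, 0 < p → (p ∈ P ↔ IsMatrixPole (fun w => (herglotz c Ω W (-w))⁻¹) (p : ℂ)))
    (h0 : (herglotz c Ω W 0).det ≠ 0) (j l : Fin N) :
    IntegrableOn (fun x => jump c Ω W x j l) (Ioi 0) := by
  obtain ⟨ρ, hρ, hG⟩ := h.exists_norm_inv_le (Ω := Ω) hc
  choose B hB using fun j l => (h.decay j l).exists_norm_stieltjes_le hc
  have hS : ∀ (x : ℝ) j l, ‖rotated c (fun k => W k j l) x‖ ≤ B j l := fun x j l => by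
    have hne : (𝓝[{z : ℂ | 0 < z.im}] (x : ℂ)).NeBot :=
      mem_closure_iff_nhdsWithin_neBot.1 (ofReal_mem_closure_upper x)
    refine le_of_tendsto ((h.decay j l).tendsto_stieltjes_upper hc x).norm ?_
    filter_upwards [self_mem_nhdsWithin] with z hz using hB j l z hz
  have hGup : ∀ x : ℝ, 0 < x → ρ < |x| → ∀ j l, ‖(herglotzUp c Ω W x)⁻¹ j l‖ ≤ 4 / |x| :=
    fun x hx hxρ j l => norm_le_of_tendsto_upper (tendsto_inv_matrix
      (h.tendsto_herglotz_upper hc x) (h.det_herglotzUp_ne_zero hc hx) j l) hxρ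
      (abs_pos.2 hx.ne') fun z hz hzρ => hG z hz hzρ j l
  have hid : ∀ x : ℝ, 0 < x → jump c Ω W x = (herglotzUp c Ω W x)⁻¹ *
      ((herglotzUp c Ω W x).conjTranspose - herglotzUp c Ω W x) *
        ((herglotzUp c Ω W x)⁻¹).conjTranspose := by
    intro x hx
    have hu : IsUnit (herglotzUp c Ω W x).det :=
      isUnit_iff_ne_zero.2 (h.det_herglotzUp_ne_zero hc hx)
    rw [jump, mul_sub, sub_mul, mul_assoc, Matrix.conjTranspose_nonsing_inv,
      Matrix.mul_nonsing_inv _ (by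
        rw [Matrix.det_conjTranspose]; exact hu.star), mul_one, Matrix.nonsing_inv_mul _ hu, one_mul]
  have hdiff : ∀ (x : ℝ) m n, ‖((herglotzUp c Ω W x).conjTranspose - herglotzUp c Ω W x) m n‖ ≤
      B m n + B n m := by
    intro x m n
    have : ((herglotzUp c Ω W x).conjTranspose - herglotzUp c Ω W x) m n =
        rotated c (fun k => W k m n) x - (starRingEnd ℂ) (rotated c (fun k => W k n m) x) := by
      simp only [herglotzUp, Matrix.sub_apply, Matrix.conjTranspose_apply, Matrix.smul_apply,
        Matrix.of_apply, smul_eq_mul, star_sub, star_mul', Complex.star_def, Complex.conj_ofReal,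
        Matrix.one_apply]
      by_cases hmn : m = n
      · simp [hmn]
      · simp [hmn, Ne.symm hmn]; ring
    rw [this]
    refine (norm_sub_le _ _).trans (add_le_add (hS x m n) ?_)
    rw [Complex.norm_conj]; exact hS x n m
  -- The even extension is continuous on ℝ, including at 0, so the criterion for functions on the
  -- whole line applies.
  set f : ℝ → ℂ := fun x => jump c Ω W |x| j l with hf
  have hcont : Continuous f := by
    have e : f = fun x : ℝ => regularExt c Ω W P j l (|x| : ℝ) -
        (starRingEnd ℂ) (regularExt c Ω W P l j (|x| : ℝ)) :=
      funext fun x => h.jump_eq hc hP0 h0 (abs_nonneg x) j l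
    have hre : ∀ j l, Continuous fun x : ℝ => regularExt c Ω W P j l (|x| : ℝ) := fun j l =>
      (h.continuousOn_regularExt hc hP0 hP h0 j l).comp_continuous
        (Complex.continuous_ofReal.comp continuous_abs) (by simp)
    rw [e]
    exact (hre j l).sub (Complex.continuous_conj.comp (hre l j))
  have hint : Integrable f := by
    refine integrable_of_continuous_of_norm_le hcont
      (C := ∑ n, (∑ m, 4 * (B m n + B n m)) * 4) (ρ := ρ + 1) fun x hx => ?_
    have hx0 : 0 < |x| := by linarith
    have hxρ : ρ < |(|x|)| := by rw [abs_abs]; linarith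
    rw [hf]
    simp only [hid _ hx0, Matrix.mul_apply]
    rw [Finset.sum_div]
    refine (norm_sum_le _ _).trans (Finset.sum_le_sum fun n _ => ?_)
    rw [norm_mul, Matrix.conjTranspose_apply, norm_star]
    have hg := hGup _ hx0 hxρ
    rw [abs_abs] at hg
    have h1 : ‖∑ m, (herglotzUp c Ω W |x|)⁻¹ j m *
        ((herglotzUp c Ω W |x|).conjTranspose - herglotzUp c Ω W |x|) m n‖ ≤
        ∑ m, 4 / |x| * (B m n + B n m) := by
      refine (norm_sum_le _ _).trans (Finset.sum_le_sum fun m _ => ?_)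
      rw [norm_mul]
      exact mul_le_mul (hg j m) (hdiff _ m n) (norm_nonneg _) (by positivity)
    calc _ ≤ (∑ m, 4 / |x| * (B m n + B n m)) * (4 / |x|) :=
          mul_le_mul h1 (hg l n) (norm_nonneg _) ((norm_nonneg _).trans h1)
      _ = _ := by
          have : ∀ m, 4 / |x| * (B m n + B n m) = (4 * (B m n + B n m)) / |x| := fun m => by ring
          simp only [this]
          rw [← Finset.sum_div]; field_simp
  refine hint.integrableOn.congr_fun (fun x hx => ?_) measurableSet_Ioi
  simp only [hf, abs_of_pos (show 0 < x from hx)]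

end Poles

/-! ### Plane waves on the sphere -/

section Sphere

/-- Three-dimensional Euclidean space. -/
abbrev Space : Type := EuclideanSpace ℝ (Fin 3)

/-- The surface measure of the unit sphere. -/
noncomputable def sphereMeasure : Measure (Metric.sphere (0 : Space) 1) :=
  (volume : Measure Space).toSphere

instance : IsFiniteMeasure sphereMeasure := by unfold sphereMeasure; infer_instance

instance : sphereMeasure.IsOpenPosMeasure := by unfold sphereMeasure; infer_instance

theorem integral_polar {f : Space → ℂ} (hf : Integrable f) :
    ∫ p, f p = ∫ r in Ioi (0 : ℝ), (r : ℂ) ^ 2 * ∫ ω, f (r • (ω : Space)) ∂sphereMeasure := by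
  have hfr : Module.finrank ℝ Space - 1 = 2 := by simp
  have hmp := (volume : Measure Space).measurePreserving_homeomorphUnitSphereProd
  have hemb : MeasurableEmbedding (homeomorphUnitSphereProd Space) :=
    Homeomorph.measurableEmbedding _
  set F : Metric.sphere (0 : Space) 1 × Ioi (0 : ℝ) → ℂ :=
    fun q => f ((q.2 : ℝ) • (q.1 : Space)) with hF
  have hFc : ∀ p : ({0}ᶜ : Set Space), F (homeomorphUnitSphereProd Space p) = f p := by
    intro p
    have hne : ‖(p : Space)‖ ≠ 0 := norm_ne_zero_iff.2 p.2
    simp only [hF, homeomorphUnitSphereProd_apply_snd_coe, homeomorphUnitSphereProd_apply_fst_coe]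
    rw [smul_smul, mul_inv_cancel₀ hne, one_smul]
  have hFi : Integrable F
      (sphereMeasure.prod (.volumeIoiPow (Module.finrank ℝ Space - 1))) := by
    rw [sphereMeasure, ← hmp.integrable_comp_emb hemb]
    have : F ∘ homeomorphUnitSphereProd Space = f ∘ Subtype.val := funext hFc
    rw [this, ← integrableOn_iff_comap_subtypeVal (measurableSet_singleton _).compl]
    exact hf.integrableOn
  calc ∫ p, f p =
        ∫ p : ({0}ᶜ : Set Space), f p.1 ∂((volume : Measure Space).comap Subtype.val) := by
        rw [integral_subtype_comap (measurableSet_singleton _).compl f, restrict_compl_singleton]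
    _ = ∫ q, F q ∂sphereMeasure.prod (.volumeIoiPow (Module.finrank ℝ Space - 1)) := by
        rw [sphereMeasure, ← hmp.integral_comp hemb]
        exact integral_congr_ae (Eventually.of_forall fun p => (hFc p).symm)
    _ = ∫ r : Ioi (0 : ℝ), ∫ ω, F (ω, r) ∂sphereMeasure ∂.volumeIoiPow (Module.finrank ℝ Space - 1) :=
        integral_prod_symm _ hFi
    _ = _ := by
        simp only [Measure.volumeIoiPow, ENNReal.ofReal]
        rw [integral_withDensity_eq_integral_smul,
          integral_subtype_comap measurableSet_Ioi
            fun a : ℝ => Real.toNNReal (a ^ (Module.finrank ℝ Space - 1)) •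
              ∫ ω, f (a • (ω : Space)) ∂sphereMeasure]
        · refine setIntegral_congr_fun measurableSet_Ioi fun x hx => ?_
          simp only [NNReal.smul_def]
          rw [Real.coe_toNNReal _ (pow_nonneg hx.out.le _), hfr, Complex.real_smul,
            Complex.ofReal_pow]
        · exact (measurable_subtype_coe.pow_const _).real_toNNReal

/-- The spherical average of a plane wave. -/
noncomputable def planeWave (y : Space) (r : ℝ) : ℂ :=
  ∫ ω, Complex.exp (Complex.I * r * (inner ℝ y (ω : Space) : ℝ)) ∂sphereMeasure

theorem norm_wave (r a : ℝ) : ‖Complex.exp (Complex.I * r * a)‖ = 1 := by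
  rw [show Complex.I * r * a = ((r * a : ℝ) : ℂ) * Complex.I by push_cast; ring,
    Complex.norm_exp_ofReal_mul_I]

theorem continuous_wave (y : Space) (r : ℝ) : Continuous fun ω : Metric.sphere (0 : Space) 1 =>
    Complex.exp (Complex.I * r * (inner ℝ y (ω : Space) : ℝ)) := by fun_prop

theorem continuous_planeWave (y : Space) : Continuous (planeWave y) := by
  refine continuous_of_dominated (bound := fun _ => 1) ?_ ?_ (integrable_const _) ?_
  · exact fun r => (continuous_wave y r).aestronglyMeasurable
  · exact fun r => Eventually.of_forall fun ω => (norm_wave _ _).le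
  · exact Eventually.of_forall fun ω => by fun_prop

theorem norm_planeWave_le (y : Space) (r : ℝ) : ‖planeWave y r‖ ≤ sphereMeasure.real univ := by
  have := norm_integral_le_of_norm_le_const (μ := sphereMeasure) (C := 1)
    (f := fun ω => Complex.exp (Complex.I * r * (inner ℝ y (ω : Space) : ℝ)))
    (Eventually.of_forall fun ω => (norm_wave _ _).le)
  simpa [planeWave] using this

/-- The Fourier transform of a Gaussian on ℝ³, read in polar coordinates. -/
theorem gaussian_planeWave (y : Space) {b : ℂ} (hb : 0 < b.re) :
    ∫ r in Ioi (0 : ℝ), (r : ℂ) ^ 2 * (Complex.exp (-b * r ^ 2) * planeWave y r) =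
      (Real.pi / b) ^ (3 / 2 : ℂ) * Complex.exp (-(‖y‖ : ℂ) ^ 2 / (4 * b)) := by
  have hG := GaussianFourier.integral_cexp_neg_mul_sq_norm_add hb Complex.I y
  have hi := GaussianFourier.integrable_cexp_neg_mul_sq_norm_add hb Complex.I y
  rw [integral_polar hi] at hG
  rw [finrank_euclideanSpace_fin, Complex.I_sq, neg_one_mul] at hG
  push_cast at hG
  rw [← hG]
  refine setIntegral_congr_fun measurableSet_Ioi fun r hr => ?_
  rw [planeWave, ← integral_const_mul]
  congr 2
  ext ω
  rw [← Complex.exp_add]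
  congr 1
  have h1 : ‖(ω : Space)‖ = 1 := by simp
  rw [norm_smul, h1, inner_smul_right]
  have : (‖r‖ : ℂ) ^ 2 = (r : ℂ) ^ 2 := by
    rw [Real.norm_eq_abs, ← Complex.ofReal_pow, sq_abs, Complex.ofReal_pow]
  push_cast
  rw [mul_one, this]; ring

theorem hasDerivAt_mul_sinc (ρ r : ℝ) :
    HasDerivAt (fun r : ℝ => r * Real.sinc (r * ρ)) (Real.cos (r * ρ)) r := by
  by_cases hρ : ρ = 0
  · subst hρ
    simp [hasDerivAt_id' r]
  · have e : (fun r : ℝ => r * Real.sinc (r * ρ)) = fun r => Real.sin (r * ρ) / ρ := by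
      ext r
      by_cases hr : r = 0
      · simp [hr]
      · rw [Real.sinc_of_ne_zero (mul_ne_zero hr hρ)]; field_simp
    rw [e]
    have h1 := ((hasDerivAt_id r).mul_const ρ).sin.div_const ρ
    refine h1.congr_deriv ?_
    simp only [id]; field_simp

theorem norm_cexp_gauss (b : ℂ) (r : ℝ) :
    ‖Complex.exp (-b * (r : ℂ) ^ 2)‖ = Real.exp (-b.re * r ^ 2) := by
  rw [Complex.norm_exp, ← Complex.ofReal_pow, Complex.re_mul_ofReal]; simp

theorem integrable_sq_mul_gauss {b : ℂ} (hb : 0 < b.re) {f : ℝ → ℂ} (hf : Continuous f) {C : ℝ}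
    (hC : ∀ r, ‖f r‖ ≤ C) :
    Integrable fun r : ℝ => (r : ℂ) ^ 2 * (Complex.exp (-b * r ^ 2) * f r) := by
  have h1 := (integrable_exp_neg_mul_sq (half_pos hb)).const_mul (2 / b.re * C)
  refine Integrable.mono' h1 (Continuous.aestronglyMeasurable (by fun_prop))
    (Eventually.of_forall fun r => ?_)
  rw [norm_mul, norm_mul, norm_cexp_gauss, norm_pow, Complex.norm_real, Real.norm_eq_abs, sq_abs]
  have h2 : b.re / 2 * r ^ 2 ≤ Real.exp (b.re / 2 * r ^ 2) := by
    linarith [Real.add_one_le_exp (b.re / 2 * r ^ 2)]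
  have h3 : Real.exp (-b.re * r ^ 2) =
      Real.exp (-(b.re / 2) * r ^ 2) * Real.exp (-(b.re / 2) * r ^ 2) := by
    rw [← Real.exp_add]; ring_nf
  have h4 : Real.exp (b.re / 2 * r ^ 2) * Real.exp (-(b.re / 2) * r ^ 2) = 1 := by
    rw [← Real.exp_add]; simp
  have h5 : r ^ 2 * Real.exp (-(b.re / 2) * r ^ 2) ≤ 2 / b.re := by
    rw [le_div_iff₀ hb]
    have := mul_le_mul_of_nonneg_right h2 (Real.exp_pos (-(b.re / 2) * r ^ 2)).le
    rw [h4] at this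
    linarith
  have hC0 : 0 ≤ C := (norm_nonneg _).trans (hC 0)
  calc r ^ 2 * (Real.exp (-b.re * r ^ 2) * ‖f r‖)
      = (r ^ 2 * Real.exp (-(b.re / 2) * r ^ 2)) * Real.exp (-(b.re / 2) * r ^ 2) * ‖f r‖ := by
        rw [h3]; ring
    _ ≤ 2 / b.re * Real.exp (-(b.re / 2) * r ^ 2) * C := by
        gcongr
        exact hC r
    _ = _ := by ring

theorem integral_cos_gauss {b : ℂ} (hb : 0 < b.re) (ρ : ℝ) :
    IntegrableOn (fun r : ℝ => Complex.exp (-b * r ^ 2) * (Real.cos (r * ρ) : ℂ)) (Ioi 0) ∧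
    2 * ∫ r in Ioi (0 : ℝ), Complex.exp (-b * r ^ 2) * (Real.cos (r * ρ) : ℂ) =
      (Real.pi / b) ^ (1 / 2 : ℂ) * Complex.exp (-(ρ : ℂ) ^ 2 / (4 * b)) := by
  have hg := fourierIntegral_gaussian hb (ρ : ℂ)
  have hi : ∀ a : ℝ, Integrable fun x : ℝ =>
      Complex.exp (Complex.I * a * x) * Complex.exp (-b * x ^ 2) := fun a => by
    refine (integrable_exp_neg_mul_sq hb).mono' (Continuous.aestronglyMeasurable (by fun_prop))
      (Eventually.of_forall fun x => ?_)
    rw [norm_mul, norm_wave, norm_cexp_gauss, one_mul]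
  have hcos : ∀ x : ℝ, Complex.exp (-b * x ^ 2) * (Real.cos (x * ρ) : ℂ) =
      1 / 2 * (Complex.exp (Complex.I * ρ * x) * Complex.exp (-b * x ^ 2)) +
      1 / 2 * (Complex.exp (Complex.I * (-ρ : ℝ) * x) * Complex.exp (-b * x ^ 2)) := by
    intro x
    rw [Complex.ofReal_cos, Complex.cos]
    push_cast
    rw [show (x * ρ : ℂ) * Complex.I = Complex.I * ρ * x by ring,
      show -(x * ρ : ℂ) * Complex.I = Complex.I * -ρ * x by ring]
    ring
  have hint : Integrable fun x : ℝ => Complex.exp (-b * x ^ 2) * (Real.cos (x * ρ) : ℂ) :=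
    (((hi ρ).const_mul _).add ((hi (-ρ)).const_mul _)).congr
      (Eventually.of_forall fun x => (hcos x).symm)
  refine ⟨hint.integrableOn, ?_⟩
  have hsplit := integral_add_compl (measurableSet_Ioi (a := (0 : ℝ))) (hi ρ)
  rw [compl_Ioi] at hsplit
  have hneg : ∫ x in Iic (0 : ℝ), Complex.exp (Complex.I * ρ * x) * Complex.exp (-b * x ^ 2) =
      ∫ x in Ioi (0 : ℝ), Complex.exp (Complex.I * (-ρ : ℝ) * x) * Complex.exp (-b * x ^ 2) := by
    have := integral_comp_neg_Ioi (0 : ℝ)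
      (fun x : ℝ => Complex.exp (Complex.I * ρ * x) * Complex.exp (-b * x ^ 2))
    rw [neg_zero] at this
    rw [← this]
    congr 1; ext x; push_cast
    rw [neg_sq]
    congr 2
    ring
  rw [← hg, ← hsplit, hneg]
  simp only [hcos]
  rw [integral_add ((hi ρ).integrableOn.const_mul _) ((hi (-ρ)).integrableOn.const_mul _),
    integral_const_mul, integral_const_mul]
  ring

/-- Integrating the derivative of r sinc(rρ) e^{-br²} reduces the integral to ∫ cos(rρ) e^{-br²}, a
one-dimensional Gaussian Fourier integral. The value is the one in `gaussian_planeWave`. -/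
theorem gaussian_sinc {b : ℂ} (hb : 0 < b.re) (ρ : ℝ) :
    ∫ r in Ioi (0 : ℝ), (r : ℂ) ^ 2 *
      (Complex.exp (-b * r ^ 2) * ((4 * Real.pi * Real.sinc (r * ρ) : ℝ) : ℂ)) =
      (Real.pi / b) ^ (3 / 2 : ℂ) * Complex.exp (-(ρ : ℂ) ^ 2 / (4 * b)) := by
  have hb0 : b ≠ 0 := by rintro rfl; simp at hb
  obtain ⟨hci, hcv⟩ := integral_cos_gauss hb ρ
  have hsc : Continuous fun r : ℝ => ((Real.sinc (r * ρ) : ℝ) : ℂ) :=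
    Complex.continuous_ofReal.comp (Real.continuous_sinc.comp (by fun_prop))
  have hsb : ∀ r : ℝ, ‖((Real.sinc (r * ρ) : ℝ) : ℂ)‖ ≤ 1 := fun r => by
    rw [Complex.norm_real]; exact Real.abs_sinc_le_one _
  have hsi := (integrable_sq_mul_gauss hb hsc hsb).integrableOn (s := Ioi 0)
  have hder : ∀ r ∈ Ioi (0 : ℝ), HasDerivAt
      (fun r : ℝ => ((r * Real.sinc (r * ρ) : ℝ) : ℂ) * Complex.exp (-b * r ^ 2))
      (Complex.exp (-b * r ^ 2) * (Real.cos (r * ρ) : ℂ) -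
        2 * b * ((r : ℂ) ^ 2 * (Complex.exp (-b * r ^ 2) * (Real.sinc (r * ρ) : ℂ)))) r := by
    intro r _
    have h1 := (hasDerivAt_mul_sinc ρ r).ofReal_comp
    have h2 : HasDerivAt (fun r : ℝ => Complex.exp (-b * (r : ℂ) ^ 2))
        (Complex.exp (-b * (r : ℂ) ^ 2) * (-b * (2 * r))) r := by
      have h3 : HasDerivAt (fun w : ℂ => Complex.exp (-b * w ^ 2))
          (Complex.exp (-b * (r : ℂ) ^ 2) * (-b * (2 * r))) (r : ℂ) := by
        have := ((hasDerivAt_pow 2 (r : ℂ)).const_mul (-b)).cexp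
        simpa using this
      exact h3.comp_ofReal
    refine (h1.mul h2).congr_deriv ?_
    push_cast; ring
  have hlim : Tendsto (fun r : ℝ => ((r * Real.sinc (r * ρ) : ℝ) : ℂ) * Complex.exp (-b * r ^ 2))
      atTop (𝓝 0) := by
    have h1 : Tendsto (fun r : ℝ => 1 / (b.re * r)) atTop (𝓝 0) :=
      tendsto_const_nhds.div_atTop (tendsto_id.const_mul_atTop hb)
    refine squeeze_zero_norm' ?_ h1
    filter_upwards [eventually_gt_atTop 0] with r hr
    rw [norm_mul, norm_cexp_gauss, Complex.norm_real, norm_mul, Real.norm_of_nonneg hr.le]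
    have h2 : |Real.sinc (r * ρ)| ≤ 1 := Real.abs_sinc_le_one _
    have h3 : b.re * r ^ 2 ≤ Real.exp (b.re * r ^ 2) := by
      linarith [Real.add_one_le_exp (b.re * r ^ 2)]
    have h4 : Real.exp (-b.re * r ^ 2) = (Real.exp (b.re * r ^ 2))⁻¹ := by
      rw [← Real.exp_neg]; ring_nf
    have h5 : 0 < b.re * r ^ 2 := by positivity
    rw [h4]
    calc r * ‖Real.sinc (r * ρ)‖ * (Real.exp (b.re * r ^ 2))⁻¹ ≤ r * 1 * (b.re * r ^ 2)⁻¹ := by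
          gcongr
          exact h2
      _ = 1 / (b.re * r) := by field_simp
  have key := integral_Ioi_of_hasDerivAt_of_tendsto (a := (0 : ℝ)) ?_ hder
    (hci.sub (hsi.const_mul (2 * b))) hlim
  · rw [integral_sub hci (hsi.const_mul _), integral_const_mul] at key
    simp only [zero_mul, Complex.ofReal_zero, sub_zero] at key
    have e : ∀ r : ℝ, (r : ℂ) ^ 2 *
        (Complex.exp (-b * r ^ 2) * ((4 * Real.pi * Real.sinc (r * ρ) : ℝ) : ℂ)) =
        4 * Real.pi * ((r : ℂ) ^ 2 * (Complex.exp (-b * r ^ 2) * (Real.sinc (r * ρ) : ℂ))) :=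
      fun r => by push_cast; ring
    simp only [e]
    rw [integral_const_mul]
    have hpb : (Real.pi / b : ℂ) ≠ 0 :=
      div_ne_zero (by exact_mod_cast Real.pi_ne_zero) hb0
    have hpow : (Real.pi / b : ℂ) ^ (3 / 2 : ℂ) = (Real.pi / b) * (Real.pi / b : ℂ) ^ (1 / 2 : ℂ) := by
      rw [show (3 / 2 : ℂ) = 1 + 1 / 2 by norm_num, Complex.cpow_add _ _ hpb, Complex.cpow_one]
    rw [hpow, mul_assoc (Real.pi / b : ℂ), ← hcv]
    have h6 : ∫ r in Ioi (0 : ℝ), (r : ℂ) ^ 2 *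
        (Complex.exp (-b * r ^ 2) * (Real.sinc (r * ρ) : ℂ)) =
        (∫ r in Ioi (0 : ℝ), Complex.exp (-b * r ^ 2) * (Real.cos (r * ρ) : ℂ)) / (2 * b) := by
      rw [eq_div_iff (mul_ne_zero two_ne_zero hb0)]
      linear_combination -key
    rw [h6]
    generalize (∫ r in Ioi (0 : ℝ), Complex.exp (-b * r ^ 2) * (Real.cos (r * ρ) : ℂ)) = Q
    field_simp
    ring
  · refine Continuous.continuousWithinAt ?_
    exact (Complex.continuous_ofReal.comp (continuous_id.mul
      (Real.continuous_sinc.comp (by fun_prop)))).mul (by fun_prop)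

/-- The spherical average of a plane wave is a `sinc`. -/
theorem planeWave_eq (y : Space) {r : ℝ} (hr : 0 < r) :
    planeWave y r = ((4 * Real.pi * Real.sinc (r * ‖y‖) : ℝ) : ℂ) := by
  set D : ℝ → ℂ := fun r => planeWave y r - ((4 * Real.pi * Real.sinc (r * ‖y‖) : ℝ) : ℂ) with hD
  have hsc : Continuous fun r : ℝ => ((4 * Real.pi * Real.sinc (r * ‖y‖) : ℝ) : ℂ) :=
    Complex.continuous_ofReal.comp
      (continuous_const.mul (Real.continuous_sinc.comp (by fun_prop)))
  have hsb : ∀ r : ℝ, ‖((4 * Real.pi * Real.sinc (r * ‖y‖) : ℝ) : ℂ)‖ ≤ 4 * Real.pi := fun r => by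
    have hpi := Real.pi_pos
    rw [Complex.norm_real, norm_mul, Real.norm_of_nonneg (by positivity)]
    exact mul_le_of_le_one_right (by positivity) (Real.abs_sinc_le_one _)
  have hDc : Continuous D := (continuous_planeWave y).sub hsc
  set C : ℝ := sphereMeasure.real univ + 4 * Real.pi with hC
  have hDb : ∀ r, ‖D r‖ ≤ C := fun r =>
    (norm_sub_le _ _).trans (add_le_add (norm_planeWave_le y r) (hsb r))
  have hC0 : 0 ≤ C := (norm_nonneg _).trans (hDb 0)
  -- With u = r², the integral ∫ r² e^{-br²} D(r) dr is half the Laplace transform of √u D(√u) at b.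
  -- It vanishes on Re b = 1, and the transform is injective.
  set h : ℝ → ℂ := fun u => (Real.sqrt u : ℂ) * D (Real.sqrt u) with hh
  have hhc : Continuous h :=
    (Complex.continuous_ofReal.comp Real.continuous_sqrt).mul (hDc.comp Real.continuous_sqrt)
  have hhb : ∀ u : ℝ, 0 ≤ u → ‖h u‖ ≤ C * Real.exp (1 / 2 * u) := by
    intro u hu
    rw [hh, norm_mul, Complex.norm_real, Real.norm_of_nonneg (Real.sqrt_nonneg u), mul_comm]
    have h1 : Real.sqrt u ≤ Real.exp (1 / 2 * u) := by
      have h2 := Real.add_one_le_exp (1 / 2 * u)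
      nlinarith [sq_nonneg (Real.sqrt u - 1), Real.sq_sqrt hu]
    exact mul_le_mul (hDb _) h1 (Real.sqrt_nonneg u) hC0
  have hzero := eq_zero_of_laplace_eq_zero (h := h) (σ := 1) hhc.continuousOn ?_ ?_
    (t := r ^ 2) (by positivity)
  · rw [hh] at hzero
    simp only [Real.sqrt_sq hr.le, mul_eq_zero, Complex.ofReal_eq_zero, hr.ne', false_or] at hzero
    exact sub_eq_zero.1 hzero
  · have := integrableOn_laplace hhc.continuousOn hhb (s := 1) (by norm_num)
    simpa using this
  · intro τ
    set b : ℂ := ((1 : ℝ) : ℂ) + τ * Complex.I with hbdef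
    have hb : 0 < b.re := by simp [hbdef]
    rw [← integral_comp_rpow_Ioi_of_pos (g := fun t : ℝ => Complex.exp (-(b * t)) * h t)
      (p := 2) two_pos]
    have e : EqOn (fun x : ℝ => ((2 : ℝ) * x ^ ((2 : ℝ) - 1)) •
          (Complex.exp (-(b * ((x ^ (2 : ℝ) : ℝ) : ℂ))) * h (x ^ (2 : ℝ))))
        (fun r : ℝ => 2 * ((r : ℂ) ^ 2 * (Complex.exp (-b * r ^ 2) * planeWave y r) -
          (r : ℂ) ^ 2 * (Complex.exp (-b * r ^ 2) *
            ((4 * Real.pi * Real.sinc (r * ‖y‖) : ℝ) : ℂ)))) (Ioi 0) := by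
      intro x hx
      have hx : 0 < x := hx
      have h1 : (x : ℝ) ^ ((2 : ℝ) - 1) = x := by norm_num
      have h2 : (x : ℝ) ^ (2 : ℝ) = x ^ 2 := Real.rpow_two x
      simp only [h1, h2, hh, Real.sqrt_sq hx.le, hD, Complex.real_smul]
      push_cast
      ring_nf
    rw [setIntegral_congr_fun measurableSet_Ioi e, integral_const_mul,
      integral_sub (integrable_sq_mul_gauss hb (continuous_planeWave y)
        (norm_planeWave_le y)).integrableOn (integrable_sq_mul_gauss hb hsc hsb).integrableOn,
      gaussian_planeWave y hb, gaussian_sinc hb, sub_self, mul_zero]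

/-! Linear independence of plane waves on the sphere -/

theorem exists_separating_direction {N : ℕ} (x : Fin N → Space) (hx : Function.Injective x) :
    ∃ e e' : Space, ‖e‖ = 1 ∧ ‖e'‖ = 1 ∧ inner ℝ e e' = 0 ∧
      Function.Injective fun l => inner ℝ (x l) e' := by
  obtain ⟨f, hf⟩ := Module.exists_dual_forall_apply_ne_zero (K := ℝ) (M := Space)
    -- The extra vector at `none` forces the functional to be nonzero even when there are no
    -- differences, that is for N ≤ 1.
    (Option.elim · (EuclideanSpace.single (0 : Fin 3) (1 : ℝ))
      (fun q : {q : Fin N × Fin N // q.1 ≠ q.2} => x q.1.1 - x q.1.2)) (by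
      rintro (_ | q)
      · simp
      · exact sub_ne_zero.2 (hx.ne q.2))
  set w : Space :=
    (InnerProductSpace.toDual ℝ Space).symm (LinearMap.toContinuousLinearMap f) with hw
  have hwf : ∀ v, inner ℝ v w = f v := fun v => by
    rw [real_inner_comm, hw, InnerProductSpace.toDual_symm_apply]; rfl
  have hw0 : w ≠ 0 := by
    intro h0
    have := hf none
    rw [← hwf, h0, inner_zero_right] at this
    exact this rfl
  have hwn : ‖w‖ ≠ 0 := norm_ne_zero_iff.2 hw0
  have hdim : Module.finrank ℝ (ℝ ∙ w)ᗮ ≠ 0 := by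
    have h1 := Submodule.finrank_add_finrank_orthogonal (ℝ ∙ w)
    rw [finrank_span_singleton hw0, finrank_euclideanSpace_fin] at h1
    omega
  obtain ⟨d, hd⟩ := Module.finrank_pos_iff_exists_ne_zero.1 (Nat.pos_of_ne_zero hdim)
  have hd0 : (d : Space) ≠ 0 := fun h0 => hd (Subtype.ext h0)
  have hdn : ‖(d : Space)‖ ≠ 0 := norm_ne_zero_iff.2 hd0
  have hdw : inner ℝ (d : Space) w = 0 := by
    rw [real_inner_comm]; exact Submodule.mem_orthogonal_singleton_iff_inner_right.1 d.2
  refine ⟨‖(d : Space)‖⁻¹ • (d : Space), ‖w‖⁻¹ • w, ?_, ?_, ?_, ?_⟩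
  · rw [norm_smul, norm_inv, norm_norm, inv_mul_cancel₀ hdn]
  · rw [norm_smul, norm_inv, norm_norm, inv_mul_cancel₀ hwn]
  · rw [inner_smul_left, inner_smul_right, hdw]; simp
  · intro l m hlm
    by_contra hne
    have h1 := hf (some ⟨(l, m), hne⟩)
    simp only [Option.elim] at h1
    rw [← hwf, inner_sub_left] at h1
    simp only [inner_smul_right] at hlm
    have := mul_left_cancel₀ (inv_ne_zero hwn) hlm
    exact h1 (sub_eq_zero.2 this)

/-- Exponentials with distinct rates are independent. -/
theorem eq_zero_of_exp_sum {N : ℕ} {v : Fin N → ℂ} {b : Fin N → ℝ} (hb : Function.Injective b)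
    {a : Fin N → ℝ → ℂ} (ha : ∀ l τ, ‖a l τ‖ = 1)
    (h : ∀ τ : ℝ, ∑ l, v l * (a l τ * Real.exp (τ * b l)) = 0) : v = 0 := by
  by_contra hv
  have hne : (Finset.univ.filter fun l => v l ≠ 0).Nonempty := by
    obtain ⟨l, hl⟩ := Function.ne_iff.1 hv
    exact ⟨l, by simpa using hl⟩
  -- Among the indices with nonzero coefficient the largest rate dominates as τ → ∞.
  obtain ⟨m, hm, hmax⟩ := Finset.exists_max_image _ b hne
  have hvm : v m ≠ 0 := (Finset.mem_filter.1 hm).2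
  have hle : ∀ τ : ℝ, ‖v m‖ ≤ ∑ l ∈ Finset.univ.erase m, ‖v l‖ * Real.exp (τ * (b l - b m)) := by
    intro τ
    have h1 := h τ
    rw [← Finset.add_sum_erase _ _ (Finset.mem_univ m)] at h1
    have h2 : ‖v m‖ * Real.exp (τ * b m) ≤
        ∑ l ∈ Finset.univ.erase m, ‖v l‖ * Real.exp (τ * b l) := by
      have h3 : ‖v m * (a m τ * Real.exp (τ * b m))‖ = ‖v m‖ * Real.exp (τ * b m) := by
        rw [norm_mul, norm_mul, ha, one_mul, Complex.norm_real,
          Real.norm_of_nonneg (Real.exp_pos _).le]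
      rw [← h3, eq_neg_of_add_eq_zero_left h1, norm_neg]
      refine (norm_sum_le _ _).trans (Finset.sum_le_sum fun l _ => ?_)
      rw [norm_mul, norm_mul, ha, one_mul, Complex.norm_real, Real.norm_of_nonneg (Real.exp_pos _).le]
    have h4 : ∀ l, ‖v l‖ * Real.exp (τ * (b l - b m)) =
        ‖v l‖ * Real.exp (τ * b l) / Real.exp (τ * b m) := fun l => by
      rw [mul_sub, Real.exp_sub, mul_div_assoc]
    simp only [h4]
    rw [← Finset.sum_div, le_div_iff₀ (Real.exp_pos _)]
    exact h2
  have hlim : Tendsto (fun τ : ℝ => ∑ l ∈ Finset.univ.erase m,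
      ‖v l‖ * Real.exp (τ * (b l - b m))) atTop (𝓝 0) := by
    rw [← Finset.sum_const_zero (s := Finset.univ.erase m)]
    refine tendsto_finsetSum _ fun l hl => ?_
    by_cases hvl : v l = 0
    · simp [hvl]
    · have hlt : b l - b m < 0 := by
        have h1 := hmax l (by simpa using hvl)
        have h2 : b l ≠ b m := hb.ne (Finset.mem_erase.1 hl).1
        exact sub_neg.2 (lt_of_le_of_ne h1 h2)
      have := (Real.tendsto_exp_atBot.comp (tendsto_id.atTop_mul_const_of_neg hlt)).const_mul ‖v l‖
      simpa using this
  have := ge_of_tendsto' hlim hle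
  exact hvm (norm_le_zero_iff.1 this)

/-- Restrict the sum to the great circle cos θ e + sin θ e'. It is entire in θ and vanishes for real
θ, hence for all θ; imaginary θ turns the oscillation along e' into real exponentials whose rates
k⟨x_l, e'⟩ are distinct. -/
theorem eq_zero_of_planeWave_sum {N : ℕ} {x : Fin N → Space} (hx : Function.Injective x) {k : ℝ}
    (hk : 0 < k) {v : Fin N → ℂ}
    (h : ∀ ω : Space, ‖ω‖ = 1 → ∑ l, v l * Complex.exp (Complex.I * k * (inner ℝ (x l) ω : ℝ)) = 0) :
    v = 0 := by
  obtain ⟨e, e', he, he', hee, hinj⟩ := exists_separating_direction x hx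
  set a : Fin N → ℝ := fun l => inner ℝ (x l) e with ha
  set b : Fin N → ℝ := fun l => inner ℝ (x l) e' with hb
  set f : ℂ → ℂ := fun θ => ∑ l, v l *
    Complex.exp (Complex.I * k * (Complex.cos θ * a l + Complex.sin θ * b l)) with hf
  have hfd : Differentiable ℂ f := by
    refine Differentiable.fun_sum fun l _ => ?_
    exact (Differentiable.cexp (((Complex.differentiable_cos.mul_const _).add
      (Complex.differentiable_sin.mul_const _)).const_mul _)).const_mul _
  have hreal : ∀ θ : ℝ, f θ = 0 := by
    intro θ
    have hn : ‖Real.cos θ • e + Real.sin θ • e'‖ = 1 := by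
      have h1 : ‖Real.cos θ • e + Real.sin θ • e'‖ ^ 2 = 1 := by
        rw [norm_add_sq_real, norm_smul, norm_smul, he, he', inner_smul_left, inner_smul_right, hee]
        simp
      nlinarith [norm_nonneg (Real.cos θ • e + Real.sin θ • e')]
    rw [hf]
    simp only
    rw [← h _ hn]
    refine Finset.sum_congr rfl fun l _ => ?_
    rw [inner_add_right, inner_smul_right, inner_smul_right]
    push_cast; rfl
  have hzero : f = 0 := by
    refine AnalyticOnNhd.eq_of_frequently_eq (z₀ := 0)
      (hfd.differentiableOn.analyticOnNhd isOpen_univ |>.mono (subset_univ _))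
      (analyticOnNhd_const) ?_
    have h1 : Tendsto (fun t : ℝ => (t : ℂ)) (𝓝[≠] 0) (𝓝[≠] (0 : ℂ)) := by
      simpa using tendsto_ofReal_punctured 0
    exact h1.frequently (Eventually.of_forall fun t => hreal t).frequently
  refine eq_zero_of_exp_sum (b := fun l => k * b l)
    (fun l m hlm => hinj (mul_left_cancel₀ hk.ne' hlm))
    (a := fun l s => Complex.exp (((k * Real.cosh (Real.arsinh s) * a l : ℝ) : ℂ) * Complex.I))
    (fun l s => Complex.norm_exp_ofReal_mul_I _) fun s => ?_
  -- At θ = -i arsinh s one has sin θ = -is, so the e' part becomes e^{ksb}, while cos θ is real and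
  -- leaves a phase of modulus 1.
  have h1 := congrFun hzero (-(Real.arsinh s : ℂ) * Complex.I)
  rw [hf] at h1
  simp only [Pi.zero_apply] at h1
  rw [← h1]
  refine Finset.sum_congr rfl fun l _ => ?_
  rw [Complex.ofReal_exp, ← Complex.exp_add, Complex.cos_mul_I, Complex.sin_mul_I,
    Complex.cosh_neg, Complex.sinh_neg, ← Complex.ofReal_cosh, ← Complex.ofReal_sinh,
    Real.sinh_arsinh]
  congr 2
  push_cast
  linear_combination ((s : ℂ) * k * b l) * Complex.I_sq

/-- Strict positive definiteness of the `sinc` kernel in `ℝ³`. -/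
theorem sinc_form_pos {N : ℕ} {x : Fin N → Space} (hx : Function.Injective x) {k : ℝ}
    (hk : 0 < k) {v : Fin N → ℂ} (hv : v ≠ 0) :
    ∃ q : ℝ, 0 < q ∧ ∑ j, ∑ l, (star (v j) * v l) * (sphKernel k (dist (x j) (x l)) : ℂ) = q := by
  set ψ : Metric.sphere (0 : Space) 1 → ℂ := fun ω =>
    ∑ l, v l * Complex.exp (Complex.I * k * (inner ℝ (x l) (ω : Space) : ℝ)) with hψ
  have hψc : Continuous ψ := by
    refine continuous_finsetSum _ fun l _ => continuous_const.mul (continuous_wave _ _)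
  have hpc : Continuous fun ω => ‖ψ ω‖ ^ 2 := by fun_prop
  have hpi : Integrable (fun ω => ‖ψ ω‖ ^ 2) sphereMeasure :=
    hpc.integrable_of_hasCompactSupport (HasCompactSupport.of_compactSpace _)
  refine ⟨∫ ω, ‖ψ ω‖ ^ 2 ∂sphereMeasure, ?_, ?_⟩
  · refine lt_of_le_of_ne (integral_nonneg fun ω => by positivity) fun h0 => hv ?_
    have h1 := (integral_eq_zero_iff_of_nonneg (fun ω => by positivity) hpi).1 h0.symm
    -- Surface measure charges every nonempty open set, so a continuous function vanishing almost
    -- everywhere vanishes on the whole sphere.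
    have h2 : (fun ω => ‖ψ ω‖ ^ 2) = 0 := (hpc.ae_eq_iff_eq sphereMeasure continuous_const).1 h1
    refine eq_zero_of_planeWave_sum hx hk fun ω hω => ?_
    have h3 := congrFun h2 ⟨ω, by simpa using hω⟩
    simpa [hψ] using h3
  · have e : ∀ ω, ((‖ψ ω‖ ^ 2 : ℝ) : ℂ) = ∑ j, ∑ l, (star (v j) * v l) *
        Complex.exp (Complex.I * k * (inner ℝ (x l - x j) (ω : Space) : ℝ)) := by
      intro ω
      rw [Complex.ofReal_pow, ← Complex.conj_mul', hψ, map_sum, Finset.sum_mul_sum]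
      refine Finset.sum_congr rfl fun j _ => Finset.sum_congr rfl fun l _ => ?_
      rw [inner_sub_left, map_mul, ← Complex.exp_conj]
      have : Complex.I * k * ((inner ℝ (x l) (ω : Space) - inner ℝ (x j) (ω : Space) : ℝ) : ℂ) =
          (starRingEnd ℂ) (Complex.I * k * (inner ℝ (x j) (ω : Space) : ℝ)) +
          Complex.I * k * (inner ℝ (x l) (ω : Space) : ℝ) := by
        simp only [map_mul, Complex.conj_I, Complex.conj_ofReal]
        push_cast; ring
      rw [this, Complex.exp_add, Complex.star_def]; ring
    have hwi : ∀ y : Space, Integrable (fun ω : Metric.sphere (0 : Space) 1 =>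
        Complex.exp (Complex.I * k * (inner ℝ y (ω : Space) : ℝ))) sphereMeasure := fun y =>
      (continuous_wave y k).integrable_of_hasCompactSupport (HasCompactSupport.of_compactSpace _)
    rw [← integral_complex_ofReal]
    simp only [e]
    rw [integral_finsetSum _ fun j _ => integrable_finsetSum _ fun l _ => (hwi _).const_mul _]
    refine Finset.sum_congr rfl fun j _ => ?_
    rw [integral_finsetSum _ fun l _ => (hwi _).const_mul _]
    refine Finset.sum_congr rfl fun l _ => ?_
    rw [integral_const_mul]
    congr 1
    have := planeWave_eq (x l - x j) hk
    rw [planeWave] at this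
    rw [this, sphKernel, dist_eq_norm, norm_sub_rev]

end Sphere

/-! ### The weight of the photon field -/

/-- The entire function `sin (kr) / r`, equal to `k` at `r = 0`. -/
noncomputable def sineRatio (r : ℝ) (k : ℂ) : ℂ := if r = 0 then k else Complex.sin (k * r) / r

theorem differentiable_sineRatio (r : ℝ) : Differentiable ℂ (sineRatio r) := by
  unfold sineRatio
  split_ifs
  · exact differentiable_id
  · fun_prop

theorem norm_sin_le_exp (z : ℂ) : ‖Complex.sin z‖ ≤ Real.exp ‖z‖ := by
  have h : ∀ w : ℂ, ‖w‖ = ‖z‖ → ‖Complex.exp w‖ ≤ Real.exp ‖z‖ := fun w hw =>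
    hw ▸ Complex.norm_exp_le_exp_norm w
  have h1 := h (-z * Complex.I) (by simp)
  have h2 := h (z * Complex.I) (by simp)
  rw [Complex.sin, norm_div, norm_mul, Complex.norm_I, mul_one, Complex.norm_ofNat,
    div_le_iff₀ two_pos]
  refine (norm_sub_le _ _).trans ?_
  linarith

theorem exists_norm_sineRatio_le (r : ℝ) :
    ∃ C D : ℝ, 0 ≤ C ∧ ∀ k, ‖sineRatio r k‖ ≤ C * Real.exp (D * ‖k‖) := by
  by_cases hr : r = 0
  · refine ⟨1, 1, zero_le_one, fun k => ?_⟩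
    rw [sineRatio, if_pos hr, one_mul, one_mul]
    linarith [Real.add_one_le_exp ‖k‖]
  · refine ⟨|r|⁻¹, |r|, by positivity, fun k => ?_⟩
    rw [sineRatio, if_neg hr, norm_div, Complex.norm_real, Real.norm_eq_abs, div_eq_inv_mul]
    refine mul_le_mul_of_nonneg_left ((norm_sin_le_exp _).trans_eq ?_) (by positivity)
    rw [norm_mul, Complex.norm_real, Real.norm_eq_abs, mul_comm]

/-- The analytic continuation of `g² / (2π)³ k² e^{-k²R²} f(k, r)` in `k`. -/
noncomputable def photonWeight (g R : ℝ) {N : ℕ} (x : Fin N → EuclideanSpace ℝ (Fin 3)) (k : ℂ) :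
    Matrix (Fin N) (Fin N) ℂ :=
  Matrix.of fun j l => (coupling g * (4 * Real.pi) : ℂ) *
    (k * (Complex.exp (-(k ^ 2 * R ^ 2)) * sineRatio (dist (x j) (x l)) k))

theorem coupling_pos {g : ℝ} (hg : 0 < g) : 0 < coupling g := by
  unfold coupling; positivity

/-- Completing the square: the Gaussian absorbs any exponential and leaves e^{-t}. -/
theorem exp_sq_le {R t D : ℝ} (hR : 0 < R) :
    Real.exp (-(R ^ 2 * (t ^ 2 / 2))) * Real.exp (D * t) ≤
      Real.exp ((D + 1) ^ 2 / (2 * R ^ 2)) * Real.exp (-t) := by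
  rw [← Real.exp_add, ← Real.exp_add, Real.exp_le_exp]
  have h : (D + 1) ^ 2 / (2 * R ^ 2) + -t - (-(R ^ 2 * (t ^ 2 / 2)) + D * t) =
      (D + 1 - R ^ 2 * t) ^ 2 / (2 * R ^ 2) := by
    field_simp; ring
  have : 0 ≤ (D + 1 - R ^ 2 * t) ^ 2 / (2 * R ^ 2) := by positivity
  linarith

/-- In the sector Re k² ≥ |k|²/2 the Gaussian factor keeps its decay and beats the exponential
growth of the sine; one factor k remains for the behaviour at 0. -/
theorem exists_sectorDecay_photonWeight (g : ℝ) {R : ℝ} (hR : 0 < R) {N : ℕ}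
    (x : Fin N → EuclideanSpace ℝ (Fin 3)) (j l : Fin N) :
    ∃ K, SectorDecay (fun k => photonWeight g R x k j l) K := by
  obtain ⟨C, D, hC, hb⟩ := exists_norm_sineRatio_le (dist (x j) (x l))
  have hs : SectorDecay
      (fun k => k * (Complex.exp (-(k ^ 2 * R ^ 2)) * sineRatio (dist (x j) (x l)) k))
      (C * Real.exp ((D + 1) ^ 2 / (2 * R ^ 2))) := by
    refine ⟨by positivity, ?_, fun k _ hk => ?_⟩
    · have := differentiable_sineRatio (dist (x j) (x l))
      fun_prop
    · have h1 : ‖Complex.exp (-(k ^ 2 * R ^ 2))‖ ≤ Real.exp (-(R ^ 2 * (‖k‖ ^ 2 / 2))) := by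
        rw [Complex.norm_exp, Real.exp_le_exp, ← Complex.ofReal_pow, Complex.neg_re,
          Complex.re_mul_ofReal, mul_comm]
        exact neg_le_neg (mul_le_mul_of_nonneg_left hk (sq_nonneg R))
      rw [norm_mul, norm_mul]
      calc ‖k‖ * (‖Complex.exp (-(k ^ 2 * R ^ 2))‖ * ‖sineRatio (dist (x j) (x l)) k‖)
          ≤ ‖k‖ * (Real.exp (-(R ^ 2 * (‖k‖ ^ 2 / 2))) * (C * Real.exp (D * ‖k‖))) := by
            gcongr
            exact hb k
        _ = C * ‖k‖ * (Real.exp (-(R ^ 2 * (‖k‖ ^ 2 / 2))) * Real.exp (D * ‖k‖)) := by ring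
        _ ≤ C * ‖k‖ * (Real.exp ((D + 1) ^ 2 / (2 * R ^ 2)) * Real.exp (-‖k‖)) :=
            mul_le_mul_of_nonneg_left (exp_sq_le hR) (by positivity)
        _ = _ := by ring
  exact ⟨_, hs.const_mul _⟩

theorem SectorDecay.mono {φ : ℂ → ℂ} {K K' : ℝ} (h : SectorDecay φ K) (hK : K ≤ K') :
    SectorDecay φ K' :=
  ⟨h.nonneg.trans hK, h.diff, fun k h1 h2 =>
    (h.bound k h1 h2).trans (mul_le_mul_of_nonneg_right hK (by positivity))⟩

theorem sineRatio_ofReal (r : ℝ) {k : ℝ} (hk : 0 < k) :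
    sineRatio r k = k * (Real.sinc (k * r) : ℂ) := by
  unfold sineRatio
  split_ifs with hr
  · simp [hr]
  · have hk0 : (k : ℂ) ≠ 0 := by exact_mod_cast hk.ne'
    have hr0 : (r : ℂ) ≠ 0 := by exact_mod_cast hr
    rw [Real.sinc_of_ne_zero (mul_ne_zero hk.ne' hr)]
    push_cast
    field_simp

theorem photonWeight_ofReal (g R : ℝ) {N : ℕ} (x : Fin N → EuclideanSpace ℝ (Fin 3)) {k : ℝ}
    (hk : 0 < k) (j l : Fin N) : photonWeight g R x k j l =
      ((coupling g * (k ^ 2 * Real.exp (-(k ^ 2 * R ^ 2))) : ℝ) : ℂ) *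
        (sphKernel k (dist (x j) (x l)) : ℂ) := by
  rw [photonWeight, Matrix.of_apply, sineRatio_ofReal _ hk, sphKernel]
  push_cast
  ring

theorem exists_admissibleWeight {g R : ℝ} (hg : 0 < g) (hR : 0 < R) {N : ℕ}
    {x : Fin N → EuclideanSpace ℝ (Fin 3)} (hx : Function.Injective x) :
    ∃ K, AdmissibleWeight (photonWeight g R x) K := by
  choose K hK using exists_sectorDecay_photonWeight g hR x
  refine ⟨∑ j, ∑ l, K j l, fun j l => (hK j l).mono ?_, fun j l k hk => ?_, fun j l k => ?_,
    fun k hk v hv => ?_⟩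
  · refine le_trans ?_ (Finset.single_le_sum
      (fun i _ => Finset.sum_nonneg fun m _ => (hK i m).nonneg) (Finset.mem_univ j))
    exact Finset.single_le_sum (fun m _ => (hK j m).nonneg) (Finset.mem_univ l)
  · rw [photonWeight_ofReal g R x hk, map_mul, Complex.conj_ofReal, Complex.conj_ofReal]
  · simp only [photonWeight, Matrix.of_apply, dist_comm]
  · obtain ⟨q, hq, hs⟩ := sinc_form_pos hx hk hv
    have e : star v ⬝ᵥ (photonWeight g R x k).mulVec v =
        ((coupling g * (k ^ 2 * Real.exp (-(k ^ 2 * R ^ 2))) * q : ℝ) : ℂ) := by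
      rw [dotProduct_mulVec_eq_sum, Complex.ofReal_mul, ← hs, Finset.mul_sum]
      refine Finset.sum_congr rfl fun j _ => ?_
      rw [Finset.mul_sum]
      refine Finset.sum_congr rfl fun l _ => ?_
      rw [photonWeight_ofReal g R x hk]; ring
    rw [e, Complex.ofReal_re]
    have := coupling_pos hg
    positivity

/-! ### The matrices of the theorem in terms of the Herglotz function -/

section Identification

variable {c Ω g R : ℝ} {N : ℕ} {x : Fin N → EuclideanSpace ℝ (Fin 3)}

theorem EMat_eq (y : ℂ) : EMat c g R x y = selfEnergy c (photonWeight g R x) (-y) := by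
  ext j l
  rw [EMat, selfEnergy, Matrix.of_apply, Matrix.of_apply, stieltjes, ← integral_const_mul]
  refine setIntegral_congr_fun measurableSet_Ioi fun k hk => ?_
  simp only [photonWeight_ofReal g R x hk]
  push_cast
  rw [sub_neg_eq_add, add_comm y]
  ring

theorem resolv_eq : resolv c Ω g R x = fun y => (herglotz c Ω (photonWeight g R x) (-y))⁻¹ := by
  ext1 y
  rw [resolv, herglotz, EMat_eq, sub_neg_eq_add, add_comm y]

theorem threshold_eq : (Ω : ℂ) • (1 : Matrix (Fin N) (Fin N) ℂ) - EMat c g R x 0 =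
    herglotz c Ω (photonWeight g R x) 0 := by
  rw [herglotz, EMat_eq, sub_zero, neg_zero]

/-- At s = -iz the denominator s/(ic) + k becomes (ck - z)/c. -/
theorem coupling_mul_Gam (hc : 0 < c) (z : ℂ) (j l : Fin N) :
    (coupling g : ℂ) / c * (Complex.I * c * Gam c R x (-Complex.I * z) j l) =
      stieltjes c (fun k => photonWeight g R x k j l) z := by
  have hc0 : (c : ℂ) ≠ 0 := by exact_mod_cast hc.ne'
  rw [Gam, Matrix.of_apply, stieltjes, ← mul_assoc (Complex.I * c), mul_one_div_cancel
    (mul_ne_zero Complex.I_ne_zero hc0), one_mul, ← integral_const_mul]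
  refine setIntegral_congr_fun measurableSet_Ioi fun k hk => ?_
  simp only [photonWeight_ofReal g R x hk]
  have e : -Complex.I * z / (Complex.I * c) + k = (c * k - z) / c := by
    field_simp
    ring
  push_cast
  rw [e, div_div_eq_mul_div]
  field_simp

/-- Here -iy + ε = -i(y + iε): the limit from the right of the imaginary axis is the one from the
upper half-plane in z. -/
theorem tendsto_Gam_minus (hc : 0 < c) (hg : 0 < g) {K : ℝ}
    (h : AdmissibleWeight (photonWeight g R x) K) (y : ℝ) (j l : Fin N) :
    Tendsto (fun ε : ℝ => Complex.I * c * Gam c R x (-Complex.I * y + ε) j l) (𝓝[>] 0)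
      (𝓝 (c / coupling g * rotated c (fun k => photonWeight g R x k j l) y)) := by
  have hc0 : (c : ℂ) ≠ 0 := by exact_mod_cast hc.ne'
  have hg0 : (coupling g : ℂ) ≠ 0 := by exact_mod_cast (coupling_pos hg).ne'
  have h1 := (((h.decay j l).tendsto_stieltjes_upper hc y).comp
    (tendsto_add_mul_I_upper y)).const_mul (c / coupling g : ℂ)
  refine h1.congr fun ε => ?_
  simp only [Function.comp]
  rw [← coupling_mul_Gam hc]
  have e : -Complex.I * (y + ε * Complex.I) = -Complex.I * y + ε := by
    linear_combination (-(ε : ℂ)) * Complex.I_sq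
  rw [e]
  field_simp

/-- Here -iy - ε corresponds to y - iε; conjugation symmetry reduces this to the limit from above.
-/
theorem tendsto_Gam_plus (hc : 0 < c) (hg : 0 < g) {K : ℝ}
    (h : AdmissibleWeight (photonWeight g R x) K) (y : ℝ) (j l : Fin N) :
    Tendsto (fun ε : ℝ => Complex.I * c * Gam c R x (-Complex.I * y - ε) j l) (𝓝[>] 0)
      (𝓝 (c / coupling g *
        (starRingEnd ℂ) (rotated c (fun k => photonWeight g R x k j l) y))) := by
  have hc0 : (c : ℂ) ≠ 0 := by exact_mod_cast hc.ne'
  have hg0 : (coupling g : ℂ) ≠ 0 := by exact_mod_cast (coupling_pos hg).ne'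
  have h1 := ((Complex.continuous_conj.tendsto _).comp
    (((h.decay j l).tendsto_stieltjes_upper hc y).comp
      (tendsto_add_mul_I_upper y))).const_mul (c / coupling g : ℂ)
  refine h1.congr fun ε => ?_
  simp only [Function.comp]
  rw [← stieltjes_conj (h.real j l), ← coupling_mul_Gam hc]
  have e : -Complex.I * (starRingEnd ℂ) (y + ε * Complex.I) = -Complex.I * y - ε := by
    simp only [map_add, map_mul, Complex.conj_ofReal, Complex.conj_I]
    linear_combination (ε : ℂ) * Complex.I_sq
  rw [e]
  field_simp

theorem DMinus_eq (hc : 0 < c) (hg : 0 < g) {K : ℝ}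
    (h : AdmissibleWeight (photonWeight g R x) K) (y : ℝ) :
    DMinus c Ω g R x y = -herglotzUp c Ω (photonWeight g R x) y := by
  have hc0 : (c : ℂ) ≠ 0 := by exact_mod_cast hc.ne'
  have hg0 : (coupling g : ℂ) ≠ 0 := by exact_mod_cast (coupling_pos hg).ne'
  ext j l
  simp only [DMinus, AMinus, herglotzUp, Matrix.add_apply, Matrix.smul_apply, Matrix.of_apply,
    Matrix.neg_apply, Matrix.sub_apply, (tendsto_Gam_minus hc hg h y j l).limUnder_eq, smul_eq_mul]
  field_simp
  ring

theorem DPlus_eq (hc : 0 < c) (hg : 0 < g) {K : ℝ}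
    (h : AdmissibleWeight (photonWeight g R x) K) (y : ℝ) :
    DPlus c Ω g R x y = -(herglotzUp c Ω (photonWeight g R x) y).conjTranspose := by
  have hc0 : (c : ℂ) ≠ 0 := by exact_mod_cast hc.ne'
  have hg0 : (coupling g : ℂ) ≠ 0 := by exact_mod_cast (coupling_pos hg).ne'
  ext j l
  have hsymm : (fun k => photonWeight g R x k l j) = fun k => photonWeight g R x k j l :=
    funext fun k => h.symm l j k
  have h1 : (1 : Matrix (Fin N) (Fin N) ℂ) l j = (1 : Matrix (Fin N) (Fin N) ℂ) j l := by
    simp only [Matrix.one_apply, eq_comm]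
  have h2 : (starRingEnd ℂ) ((1 : Matrix (Fin N) (Fin N) ℂ) j l) =
      (1 : Matrix (Fin N) (Fin N) ℂ) j l := by
    rw [Matrix.one_apply]; split_ifs <;> simp
  simp only [DPlus, APlus, herglotzUp, Matrix.add_apply, Matrix.smul_apply, Matrix.of_apply,
    Matrix.neg_apply, Matrix.sub_apply, (tendsto_Gam_plus hc hg h y j l).limUnder_eq, smul_eq_mul,
    Matrix.conjTranspose_apply, hsymm, h1, star_sub, star_mul', Complex.star_def,
    Complex.conj_ofReal, h2]
  field_simp
  ring

theorem inv_neg_of_det_ne_zero {A : Matrix (Fin N) (Fin N) ℂ} (hA : A.det ≠ 0) :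
    (-A)⁻¹ = -A⁻¹ :=
  Matrix.inv_eq_right_inv (by rw [neg_mul_neg, Matrix.mul_nonsing_inv A hA.isUnit])

theorem isUnit_neg_of_det_ne_zero {A : Matrix (Fin N) (Fin N) ℂ} (hA : A.det ≠ 0) :
    IsUnit (-A) := ((Matrix.isUnit_iff_isUnit_det A).2 hA.isUnit).neg

theorem det_conjTranspose_ne_zero {A : Matrix (Fin N) (Fin N) ℂ} (hA : A.det ≠ 0) :
    A.conjTranspose.det ≠ 0 := by
  rw [Matrix.det_conjTranspose]
  exact star_ne_zero.2 hA

theorem HPlus_sub_HMinus (hc : 0 < c) (hg : 0 < g) {K : ℝ}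
    (h : AdmissibleWeight (photonWeight g R x) K) {y : ℝ} (hy : 0 < y) :
    HPlus c Ω g R x y - HMinus c Ω g R x y = jump c Ω (photonWeight g R x) y := by
  have hd : (herglotzUp c Ω (photonWeight g R x) y).det ≠ 0 := h.det_herglotzUp_ne_zero hc hy
  rw [HPlus, HMinus, DPlus_eq hc hg h, DMinus_eq hc hg h, jump, inv_neg_of_det_ne_zero hd,
    inv_neg_of_det_ne_zero (det_conjTranspose_ne_zero hd), Matrix.conjTranspose_nonsing_inv]
  abel

end Identification

/-! ### The propagator -/

section Oscillatory

variable {a : ℝ → ℂ}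

theorem norm_cexp_neg_I_mul (μ y t : ℝ) : ‖Complex.exp (-Complex.I * μ * y * t)‖ = 1 := by
  rw [show -Complex.I * μ * y * t = ((-(μ * y * t) : ℝ) : ℂ) * Complex.I by push_cast; ring]
  exact Complex.norm_exp_ofReal_mul_I _

theorem norm_cexp_I_mul (μ t : ℝ) : ‖Complex.exp (Complex.I * μ * t)‖ = 1 := by
  rw [show Complex.I * μ * t = ((μ * t : ℝ) : ℂ) * Complex.I by push_cast; ring]
  exact Complex.norm_exp_ofReal_mul_I _

theorem integrableOn_mul_oscillation (ha : IntegrableOn a (Ioi 0)) (μ t : ℝ) :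
    IntegrableOn (fun y : ℝ => a y * Complex.exp (-Complex.I * μ * y * t)) (Ioi 0) :=
  Integrable.mono ha (ha.aestronglyMeasurable.mul
    (Continuous.aestronglyMeasurable (by fun_prop)))
    (Eventually.of_forall fun y => by rw [norm_mul, norm_cexp_neg_I_mul, mul_one])

theorem norm_superposition_le (μ t : ℝ) :
    ‖∫ y in Ioi (0 : ℝ), a y * Complex.exp (-Complex.I * μ * y * t)‖ ≤
      ∫ y in Ioi (0 : ℝ), ‖a y‖ := by
  refine (norm_integral_le_integral_norm _).trans_eq ?_
  simp only [norm_mul, norm_cexp_neg_I_mul, mul_one]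

theorem continuous_superposition (ha : IntegrableOn a (Ioi 0)) (μ : ℝ) :
    Continuous fun t : ℝ => ∫ y in Ioi (0 : ℝ), a y * Complex.exp (-Complex.I * μ * y * t) := by
  refine continuous_of_dominated (bound := fun y => ‖a y‖)
    (fun t => (integrableOn_mul_oscillation ha μ t).aestronglyMeasurable)
    (fun t => Eventually.of_forall fun y => ?_) ha.norm (Eventually.of_forall fun y => ?_)
  · rw [norm_mul, norm_cexp_neg_I_mul, mul_one]
  · fun_prop

/-- Laplace transform of a modulated superposition of oscillating exponentials. -/
theorem laplace_modulated_superposition (ha : IntegrableOn a (Ioi 0)) (μ Ω : ℝ) {s : ℂ}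
    (hs : 0 < s.re) :
    ∫ t in Ioi (0 : ℝ), Complex.exp (-(s * t)) * (Complex.exp (Complex.I * Ω * t) *
        ∫ y in Ioi (0 : ℝ), a y * Complex.exp (-Complex.I * μ * y * t)) =
      -Complex.I * ∫ y in Ioi (0 : ℝ), a y / (μ * y - (Complex.I * s + Ω)) := by
  have hs' : 0 < (s - Complex.I * Ω).re := by simpa using hs
  have h1 := laplace_superposition ha μ hs'
  calc _ = ∫ t in Ioi (0 : ℝ), Complex.exp (-((s - Complex.I * Ω) * t)) *
        ∫ y in Ioi (0 : ℝ), a y * Complex.exp (-Complex.I * μ * y * t) := by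
        refine integral_congr_ae (Eventually.of_forall fun t => ?_)
        simp only [← mul_assoc, ← Complex.exp_add]
        congr 2
        ring
    _ = _ := by
        rw [h1, ← integral_const_mul]
        refine integral_congr_ae (Eventually.of_forall fun y => ?_)
        have e : s - Complex.I * Ω + Complex.I * μ * y =
            Complex.I * (μ * y - (Complex.I * s + Ω)) := by
          linear_combination s * Complex.I_sq
        simp only [e]
        rw [← div_div, div_eq_mul_inv (a y), Complex.inv_I]
        ring

end Oscillatory

section Propagator

variable {N : ℕ} {W : ℂ → Matrix (Fin N) (Fin N) ℂ} {K c Ω : ℝ} {P : Finset ℝ}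

/-- The memory kernel `e^{iΩt} ∫₀^∞ W(k) e^{-ickt} dk`. -/
noncomputable def memoryKernel (c Ω : ℝ) (W : ℂ → Matrix (Fin N) (Fin N) ℂ) (j l : Fin N)
    (t : ℝ) : ℂ :=
  Complex.exp (Complex.I * Ω * t) *
    ∫ k in Ioi (0 : ℝ), W k j l * Complex.exp (-Complex.I * c * k * t)

theorem AdmissibleWeight.continuous_memoryKernel (h : AdmissibleWeight W K) (j l : Fin N) :
    Continuous (memoryKernel c Ω W j l) := by
  have := continuous_superposition (h.decay j l).integrableOn c
  unfold memoryKernel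
  fun_prop

theorem exists_norm_memoryKernel_le (c Ω : ℝ) (W : ℂ → Matrix (Fin N) (Fin N) ℂ) :
    ∃ M : ℝ, 0 ≤ M ∧ ∀ j l t, 0 ≤ t → ‖memoryKernel c Ω W j l t‖ ≤ M := by
  have h0 : ∀ j l, 0 ≤ ∫ k in Ioi (0 : ℝ), ‖W k j l‖ := fun j l =>
    integral_nonneg fun k => norm_nonneg _
  refine ⟨∑ j, ∑ l, ∫ k in Ioi (0 : ℝ), ‖W k j l‖,
    Finset.sum_nonneg fun j _ => Finset.sum_nonneg fun l _ => h0 j l, fun j l t _ => ?_⟩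
  rw [memoryKernel, norm_mul, norm_cexp_I_mul, one_mul]
  refine (norm_superposition_le c t).trans ?_
  refine le_trans (Finset.single_le_sum (fun m _ => h0 j m) (Finset.mem_univ l)) ?_
  exact Finset.single_le_sum (f := fun i => ∑ m, ∫ k in Ioi (0 : ℝ), ‖W k i m‖)
    (fun i _ => Finset.sum_nonneg fun m _ => h0 i m) (Finset.mem_univ j)

/-- The modulation e^{iΩt} shifts the spectral variable to z = is + Ω, which maps Re s > 0 onto the
upper half-plane. -/
theorem AdmissibleWeight.laplace_memoryKernel (h : AdmissibleWeight W K) (j l : Fin N) {s : ℂ}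
    (hs : 0 < s.re) :
    ∫ t in Ioi (0 : ℝ), Complex.exp (-(s * t)) * memoryKernel c Ω W j l t =
      -Complex.I * selfEnergy c W (Complex.I * s + Ω) j l :=
  laplace_modulated_superposition (h.decay j l).integrableOn c Ω hs

/-- The matrix that maps the initial datum to the solution at time `t`. -/
noncomputable def propagator (c Ω : ℝ) (W : ℂ → Matrix (Fin N) (Fin N) ℂ) (P : Finset ℝ)
    (t : ℝ) : Matrix (Fin N) (Fin N) ℂ :=
  Matrix.of fun j l =>
    (2 * Real.pi * Complex.I)⁻¹ * (Complex.exp (Complex.I * Ω * t) *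
      ∫ y in Ioi (0 : ℝ), jump c Ω W y j l * Complex.exp (-Complex.I * (1 : ℝ) * y * t)) +
    ∑ p ∈ P, matrixResidue (fun w => (herglotz c Ω W (-w))⁻¹) (p : ℂ) j l *
      Complex.exp (Complex.I * (p + Ω : ℝ) * t)

theorem continuous_propagator {j l : Fin N}
    (hj : IntegrableOn (fun y => jump c Ω W y j l) (Ioi 0)) :
    Continuous fun t => propagator c Ω W P t j l := by
  have := continuous_superposition hj 1
  simp only [propagator, Matrix.of_apply]
  fun_prop

theorem exists_norm_propagator_le (c Ω : ℝ) (W : ℂ → Matrix (Fin N) (Fin N) ℂ) (P : Finset ℝ)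
    (j l : Fin N) : ∃ M : ℝ, ∀ t, ‖propagator c Ω W P t j l‖ ≤ M := by
  refine ⟨‖(2 * Real.pi * Complex.I : ℂ)⁻¹‖ * (∫ y in Ioi (0 : ℝ), ‖jump c Ω W y j l‖) +
    ∑ p ∈ P, ‖matrixResidue (fun w => (herglotz c Ω W (-w))⁻¹) (p : ℂ) j l‖, fun t => ?_⟩
  rw [propagator, Matrix.of_apply]
  refine (norm_add_le _ _).trans (add_le_add ?_ ((norm_sum_le _ _).trans_eq ?_))
  · rw [norm_mul, norm_mul, norm_cexp_I_mul, one_mul]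
    exact mul_le_mul_of_nonneg_left (norm_superposition_le 1 t) (norm_nonneg _)
  · simp only [norm_mul, norm_cexp_I_mul, mul_one]

theorem integrableOn_laplace_of_bounded {f : ℝ → ℂ} (hf : Continuous f) {M : ℝ}
    (hM : ∀ t, ‖f t‖ ≤ M) {s : ℂ} (hs : 0 < s.re) :
    IntegrableOn (fun t : ℝ => Complex.exp (-(s * t)) * f t) (Ioi 0) :=
  integrableOn_laplace hf.continuousOn (C := M) (σ := 0) (fun t _ => by simpa using hM t) hs

theorem laplace_exponential (q : ℝ) (r : ℂ) {s : ℂ} (hs : 0 < s.re) :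
    ∫ t in Ioi (0 : ℝ), Complex.exp (-(s * t)) * (r * Complex.exp (Complex.I * q * t)) =
      r / (s - Complex.I * q) := by
  have hs' : 0 < (s - Complex.I * q).re := by simpa using hs
  rw [div_eq_mul_one_div r, ← integral_cexp_neg_mul hs', ← integral_const_mul]
  refine integral_congr_ae (Eventually.of_forall fun t => ?_)
  simp only
  rw [mul_left_comm, ← Complex.exp_add]
  congr 2
  ring

/-- Termwise this is the representation `inv_herglotz_eq` at z = is + Ω: each oscillation e^{-iyt}
gives a Cauchy kernel 1/(y - z), each e^{i(p+Ω)t} gives a fraction 1/(z + p). -/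
theorem AdmissibleWeight.laplace_propagator (h : AdmissibleWeight W K) (hc : 0 < c)
    (hP0 : ∀ p ∈ P, 0 < p)
    (hP : ∀ p : ℝ, 0 < p → (p ∈ P ↔ IsMatrixPole (fun w => (herglotz c Ω W (-w))⁻¹) (p : ℂ)))
    (h0 : (herglotz c Ω W 0).det ≠ 0) {s : ℂ} (hs : 0 < s.re) (j l : Fin N) :
    ∫ t in Ioi (0 : ℝ), Complex.exp (-(s * t)) * propagator c Ω W P t j l =
      -Complex.I * (herglotz c Ω W (Complex.I * s + Ω))⁻¹ j l := by
  have hz : 0 < (Complex.I * s + Ω).im := by simpa using hs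
  have hj := h.integrableOn_jump (Ω := Ω) hc hP0 hP h0 j l
  rw [h.inv_herglotz_eq hc hP0 hP h0 hz]
  have hcont := continuous_superposition hj 1
  have hc1 : Continuous fun t : ℝ => Complex.exp (Complex.I * Ω * t) *
      ∫ y in Ioi (0 : ℝ), jump c Ω W y j l * Complex.exp (-Complex.I * (1 : ℝ) * y * t) := by
    fun_prop
  have hi1 := integrableOn_laplace_of_bounded hc1
    (M := ∫ y in Ioi (0 : ℝ), ‖jump c Ω W y j l‖) (fun t => by
      rw [norm_mul, norm_cexp_I_mul, one_mul]
      exact norm_superposition_le 1 t) hs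
  have hi2 : ∀ (p : ℝ) (r : ℂ), IntegrableOn (fun t : ℝ => Complex.exp (-(s * t)) *
      (r * Complex.exp (Complex.I * (p + Ω : ℝ) * t))) (Ioi 0) := fun p r =>
    integrableOn_laplace_of_bounded (by fun_prop) (M := ‖r‖)
      (fun t => by rw [norm_mul, norm_cexp_I_mul, mul_one]) hs
  simp only [propagator, Matrix.of_apply, mul_add, Finset.mul_sum, mul_left_comm _
    (2 * Real.pi * Complex.I : ℂ)⁻¹ _]
  rw [integral_add (hi1.const_mul _) (integrable_finsetSum _ fun p _ => hi2 p _),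
    integral_finsetSum _ fun p _ => hi2 p _, integral_const_mul,
    laplace_modulated_superposition hj 1 Ω hs, mul_sub, Finset.mul_sum, sub_eq_add_neg,
    ← Finset.sum_neg_distrib]
  congr 1
  · simp only [Complex.ofReal_one, one_mul]
    ring
  · refine Finset.sum_congr rfl fun p _ => ?_
    rw [laplace_exponential _ _ hs]
    have e : s - Complex.I * (p + Ω : ℝ) = -Complex.I * (Complex.I * s + Ω + p) := by
      push_cast
      linear_combination s * Complex.I_sq
    rw [e, ← div_div, div_eq_mul_inv _ (-Complex.I), inv_neg, Complex.inv_I]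
    ring

/-- Solutions of the Volterra system are given by the propagator. -/
theorem AdmissibleWeight.eq_propagator_mulVec (h : AdmissibleWeight W K) (hc : 0 < c)
    (hP0 : ∀ p ∈ P, 0 < p)
    (hP : ∀ p : ℝ, 0 < p → (p ∈ P ↔ IsMatrixPole (fun w => (herglotz c Ω W (-w))⁻¹) (p : ℂ)))
    (h0 : (herglotz c Ω W 0).det ≠ 0) {β : ℝ → Fin N → ℂ} (hβ : ContinuousOn β (Ici 0))
    (hd : ∀ t : ℝ, 0 < t → ∀ j, HasDerivAt (fun s => β s j)
      (-∑ l, ∫ τ in (0 : ℝ)..t, β τ l * memoryKernel c Ω W j l (t - τ)) t)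
    {t : ℝ} (ht : 0 ≤ t) (j : Fin N) :
    β t j = ∑ l, propagator c Ω W P t j l * β 0 l := by
  obtain ⟨M, hM, hkb⟩ := exists_norm_memoryKernel_le c Ω W
  obtain ⟨σ, hσ, hb⟩ := exists_exp_bound hβ hM hkb hd
  have hβc : ∀ l, ContinuousOn (fun t => β t l) (Ici 0) := fun l => continuousOn_pi.1 hβ l
  have hβb : ∀ l, ∀ t : ℝ, 0 ≤ t → ‖β t l‖ ≤ 2 * ‖β 0‖ * Real.exp (σ * t) := fun l t ht =>
    (norm_le_pi_norm _ _).trans (hb t ht)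
  have hpc : ∀ l, Continuous fun t => propagator c Ω W P t j l := fun l =>
    continuous_propagator (h.integrableOn_jump hc hP0 hP h0 j l)
  choose B hB using fun l => exists_norm_propagator_le c Ω W P j l
  have hlap : ∀ s : ℂ, σ < s.re →
      IntegrableOn (fun t : ℝ => Complex.exp (-(s * t)) *
        (β t j - ∑ l, propagator c Ω W P t j l * β 0 l)) (Ioi 0) ∧
      ∫ t in Ioi (0 : ℝ), Complex.exp (-(s * t)) *
        (β t j - ∑ l, propagator c Ω W P t j l * β 0 l) = 0 := by
    intro s hs
    have hs0 : 0 < s.re := hσ.trans hs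
    have hz : 0 < (Complex.I * s + Ω).im := by simpa using hs0
    set b : Fin N → ℂ := fun i => ∫ t in Ioi (0 : ℝ), Complex.exp (-(s * t)) * β t i with hbdef
    -- The transformed equation s b - i S b = β(0), multiplied by -i; note Ω - z = -is.
    have hF : (herglotz c Ω W (Complex.I * s + Ω)).mulVec b = -Complex.I • β 0 := by
      ext i
      have h1 := laplace_volterra hβ (fun i l => h.continuous_memoryKernel i l |>.continuousOn)
        hkb hd hσ hb hs i
      simp only [h.laplace_memoryKernel _ _ hs0] at h1
      rw [herglotz, Matrix.sub_mulVec, Matrix.smul_mulVec, Matrix.one_mulVec]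
      simp only [Pi.sub_apply, Pi.smul_apply, smul_eq_mul, Matrix.mulVec, dotProduct]
      have h2 : ∑ l, b l * (-Complex.I * selfEnergy c W (Complex.I * s + Ω) i l) =
          -Complex.I * ∑ l, selfEnergy c W (Complex.I * s + Ω) i l * b l := by
        rw [Finset.mul_sum]
        exact Finset.sum_congr rfl fun l _ => by ring
      rw [h2] at h1
      rw [← h1]
      linear_combination (-∑ l, selfEnergy c W (Complex.I * s + Ω) i l * b l) * Complex.I_sq
    have hdet := h.det_herglotz_ne_zero_upper (Ω := Ω) hc hz
    have hb' : b j = -Complex.I * ∑ l, (herglotz c Ω W (Complex.I * s + Ω))⁻¹ j l * β 0 l := by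
      have h3 : b = (herglotz c Ω W (Complex.I * s + Ω))⁻¹.mulVec (-Complex.I • β 0) := by
        rw [← hF, Matrix.mulVec_mulVec, Matrix.nonsing_inv_mul _ hdet.isUnit, Matrix.one_mulVec]
      have h4 := congrFun h3 j
      rwa [Matrix.mulVec_smul] at h4
    have hpi : ∀ l, IntegrableOn (fun t : ℝ =>
        Complex.exp (-(s * t)) * propagator c Ω W P t j l) (Ioi 0) := fun l =>
      integrableOn_laplace_of_bounded (hpc l) (hB l) hs0
    have hpi' : ∀ l, IntegrableOn (fun t : ℝ =>
        Complex.exp (-(s * t)) * propagator c Ω W P t j l * β 0 l) (Ioi 0) := fun l =>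
      (hpi l).mul_const _
    have hβi := integrableOn_laplace (hβc j) (hβb j) hs
    simp only [mul_sub, Finset.mul_sum, ← mul_assoc]
    refine ⟨hβi.sub (integrable_finsetSum _ fun l _ => hpi' l), ?_⟩
    rw [integral_sub hβi (integrable_finsetSum _ fun l _ => hpi' l),
      integral_finsetSum _ fun l _ => hpi' l]
    have h5 : ∀ l, ∫ t in Ioi (0 : ℝ),
        Complex.exp (-(s * t)) * propagator c Ω W P t j l * β 0 l =
        -Complex.I * ((herglotz c Ω W (Complex.I * s + Ω))⁻¹ j l * β 0 l) := fun l => by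
      rw [integral_mul_const, h.laplace_propagator hc hP0 hP h0 hs0, mul_assoc]
    simp only [h5, ← Finset.mul_sum]
    exact sub_eq_zero.2 hb'
  have hcont : ContinuousOn (fun t => β t j - ∑ l, propagator c Ω W P t j l * β 0 l) (Ici 0) :=
    (hβc j).sub (Continuous.continuousOn (by fun_prop))
  have hpos : ∀ t : ℝ, 0 < t → β t j - ∑ l, propagator c Ω W P t j l * β 0 l = 0 := by
    intro t ht
    -- The line must lie strictly to the right of the growth rate σ of the solution.
    refine eq_zero_of_laplace_eq_zero (σ := σ + 1) (hcont.mono Ioi_subset_Ici_self) ?_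
      (fun τ => ?_) ht
    · exact (hlap ((σ + 1 : ℝ) : ℂ) (by simp)).1
    · exact (hlap ((σ + 1 : ℝ) + τ * Complex.I) (by simp)).2
  rcases ht.eq_or_lt with rfl | ht
  · have h1 : Tendsto (fun t => β t j - ∑ l, propagator c Ω W P t j l * β 0 l) (𝓝[>] 0)
        (𝓝 (β 0 j - ∑ l, propagator c Ω W P 0 j l * β 0 l)) :=
      (hcont 0 self_mem_Ici).mono_left (nhdsWithin_mono _ Ioi_subset_Ici_self)
    have h2 : Tendsto (fun t => β t j - ∑ l, propagator c Ω W P t j l * β 0 l) (𝓝[>] 0) (𝓝 0) :=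
      tendsto_const_nhds.congr' (eventually_nhdsWithin_of_forall fun t ht => (hpos t ht).symm)
    exact sub_eq_zero.1 (tendsto_nhds_unique h1 h2)
  · exact sub_eq_zero.1 (hpos t ht)

end Propagator

/-- The coupling constant moves inside the k-integral and becomes part of the weight. -/
theorem IsSolution.hasDerivAt_memoryKernel {c Ω g R : ℝ} {N : ℕ}
    {x : Fin N → EuclideanSpace ℝ (Fin 3)} {β : ℝ → Fin N → ℂ} (hβ : IsSolution c Ω g R x β)
    {t : ℝ} (ht : 0 < t) (j : Fin N) :
    HasDerivAt (fun s => β s j) (-∑ l, ∫ τ in (0 : ℝ)..t,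
      β τ l * memoryKernel c Ω (photonWeight g R x) j l (t - τ)) t := by
  refine (hβ.hasDerivAt t ht j).congr_deriv ?_
  rw [neg_mul, Finset.mul_sum]
  congr 1
  refine Finset.sum_congr rfl fun l _ => ?_
  rw [← intervalIntegral.integral_const_mul]
  refine intervalIntegral.integral_congr fun τ _ => ?_
  simp only [memoryKernel]
  rw [mul_assoc (β τ l), mul_left_comm, mul_left_comm (coupling g : ℂ), ← integral_const_mul,
    Complex.ofReal_sub]
  congr 2
  refine setIntegral_congr_fun measurableSet_Ioi fun k hk => ?_
  simp only [photonWeight_ofReal g R x hk]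
  push_cast
  rw [sub_eq_add_neg (-Complex.I * c * k * (t - τ)), Complex.exp_add]
  ring

end AtomPhoton

/-! ### The theorem -/

theorem mainTheorem2 (c Ω g R : ℝ) (hc : 0 < c) (hΩ : 0 < Ω) (hg : 0 < g) (hR : 0 < R)
    (N : ℕ) (x : Fin N → EuclideanSpace ℝ (Fin 3)) (hx : Function.Injective x) :
    -- `(y + Ω - E(y))⁻¹` is meromorphic on the complement of `(-∞, 0]`
    (∀ y ∈ Complex.slitPlane, ∀ j l : Fin N,
      MeromorphicAt (fun z => AtomPhoton.resolv c Ω g R x z j l) y) ∧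
    -- the limits that define `A⁺(y)` and `A⁻(y)` exist
    (∀ y : ℝ, 0 < y → ∀ j l : Fin N,
      Tendsto (fun ε : ℝ => Complex.I * c * AtomPhoton.Gam c R x (-Complex.I * y - ε) j l)
        (𝓝[>] 0) (𝓝 (AtomPhoton.APlus c R x y j l)) ∧
      Tendsto (fun ε : ℝ => Complex.I * c * AtomPhoton.Gam c R x (-Complex.I * y + ε) j l)
        (𝓝[>] 0) (𝓝 (AtomPhoton.AMinus c R x y j l))) ∧
    -- the matrices inverted in `H⁺(y)` and `H⁻(y)` are invertible
    (∀ y : ℝ, 0 < y →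
      IsUnit (AtomPhoton.DPlus c Ω g R x y) ∧ IsUnit (AtomPhoton.DMinus c Ω g R x y)) ∧
    -- the set of poles is a set of at most `N` positive reals
    ∃ P : Finset ℝ,
      {p : ℂ | p ∈ Complex.slitPlane ∧
        AtomPhoton.IsMatrixPole (AtomPhoton.resolv c Ω g R x) p} = (fun p : ℝ => (p : ℂ)) '' P ∧
      (∀ p ∈ P, 0 < p) ∧
      P.card ≤ N ∧
      -- the representation of the solution, away from the threshold `det (Ω - E(0)) = 0`
      (((Ω : ℂ) • (1 : Matrix (Fin N) (Fin N) ℂ) - AtomPhoton.EMat c g R x 0).det ≠ 0 →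
        ∀ β : ℝ → Fin N → ℂ, AtomPhoton.IsSolution c Ω g R x β →
          ∀ t : ℝ, 0 ≤ t →
            IntegrableOn (fun y : ℝ => Complex.exp (-Complex.I * y * t) •
              (AtomPhoton.HPlus c Ω g R x y - AtomPhoton.HMinus c Ω g R x y).mulVec (β 0))
              (Ioi 0) ∧
            β t =
              (Complex.exp (Complex.I * Ω * t) / (2 * Real.pi * Complex.I)) •
                (∫ y in Ioi (0 : ℝ), Complex.exp (-Complex.I * y * t) •
                  (AtomPhoton.HPlus c Ω g R x y - AtomPhoton.HMinus c Ω g R x y).mulVec (β 0)) +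
              ∑ p ∈ P, Complex.exp (Complex.I * (p + Ω) * t) •
                (AtomPhoton.matrixResidue (AtomPhoton.resolv c Ω g R x) p).mulVec (β 0)) := by
  obtain ⟨K, h⟩ := AtomPhoton.exists_admissibleWeight hg hR hx
  obtain ⟨P, hpoles, hP0, hcard, hP⟩ := h.exists_poles (Ω := Ω) hc
  refine ⟨fun y hy j l => ?_, fun y _ j l => ?_, fun y hy => ?_, P, ?_, hP0, hcard, ?_⟩
  · rw [AtomPhoton.resolv_eq]
    exact h.meromorphicAt_inv hc hy j l
  · constructor
    · rw [AtomPhoton.APlus, Matrix.of_apply,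
        (AtomPhoton.tendsto_Gam_plus hc hg h y j l).limUnder_eq]
      exact AtomPhoton.tendsto_Gam_plus hc hg h y j l
    · rw [AtomPhoton.AMinus, Matrix.of_apply,
        (AtomPhoton.tendsto_Gam_minus hc hg h y j l).limUnder_eq]
      exact AtomPhoton.tendsto_Gam_minus hc hg h y j l
  · have hd := h.det_herglotzUp_ne_zero (Ω := Ω) hc hy
    rw [AtomPhoton.DPlus_eq hc hg h, AtomPhoton.DMinus_eq hc hg h]
    exact ⟨AtomPhoton.isUnit_neg_of_det_ne_zero (AtomPhoton.det_conjTranspose_ne_zero hd),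
      AtomPhoton.isUnit_neg_of_det_ne_zero hd⟩
  · rw [AtomPhoton.resolv_eq]
    exact hpoles
  · intro h0 β hβ t ht
    rw [AtomPhoton.threshold_eq] at h0
    have hj := fun j l => AtomPhoton.integrableOn_mul_oscillation
      (h.integrableOn_jump hc hP0 hP h0 j l) 1 t
    -- The difference H⁺ - H⁻ is the jump only for y > 0, hence the restriction; the frequency `(1 :
    -- ℝ)` matches the form of the superposition lemmas.
    have hentry : ∀ j, ∀ y ∈ Ioi (0 : ℝ), (Complex.exp (-Complex.I * y * t) •
        (AtomPhoton.HPlus c Ω g R x y - AtomPhoton.HMinus c Ω g R x y).mulVec (β 0)) j =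
        ∑ l, AtomPhoton.jump c Ω (AtomPhoton.photonWeight g R x) y j l *
          Complex.exp (-Complex.I * (1 : ℝ) * y * t) * β 0 l := by
      intro j y hy
      rw [AtomPhoton.HPlus_sub_HMinus hc hg h hy, Pi.smul_apply, Matrix.mulVec, dotProduct,
        smul_eq_mul, Finset.mul_sum]
      refine Finset.sum_congr rfl fun l _ => ?_
      rw [Complex.ofReal_one, mul_one]
      ring
    have hint : ∀ j, IntegrableOn (fun y : ℝ => (Complex.exp (-Complex.I * y * t) •
        (AtomPhoton.HPlus c Ω g R x y - AtomPhoton.HMinus c Ω g R x y).mulVec (β 0)) j)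
        (Ioi 0) := fun j =>
      IntegrableOn.congr_fun (integrable_finsetSum _ fun l _ => (hj j l).mul_const _)
        (fun y hy => (hentry j y hy).symm) measurableSet_Ioi
    refine ⟨Integrable.of_eval hint, ?_⟩
    ext j
    rw [h.eq_propagator_mulVec hc hP0 hP h0 hβ.continuousOn
      (fun t ht j => hβ.hasDerivAt_memoryKernel ht j) ht j, Pi.add_apply, Pi.smul_apply,
      eval_integral hint, setIntegral_congr_fun measurableSet_Ioi (hentry j),
      integral_finsetSum _ fun l _ => (hj j l).mul_const _, Finset.sum_apply]
    simp only [AtomPhoton.propagator, Matrix.of_apply, add_mul, Finset.sum_add_distrib,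
      Finset.sum_mul, integral_mul_const, smul_eq_mul, Finset.mul_sum, Pi.smul_apply,
      Matrix.mulVec, dotProduct, AtomPhoton.resolv_eq]
    congr 1
    · refine Finset.sum_congr rfl fun l _ => ?_
      rw [div_eq_inv_mul]
      ring
    · rw [Finset.sum_comm]
      refine Finset.sum_congr rfl fun p _ => Finset.sum_congr rfl fun l _ => ?_
      push_cast
      ring
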